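/- Let $F$ be a finite extension of $\mathbb{Q}_p$ ($p$ any prime, $p=2$ allowed), $\mathfrak{o}$ its ring of integers, $\pi$ a uniformizer, $\mathrm{ord}$ the normalized valuation, $\kappa=\mathfrak{o}/\pi$, and $f=\#\kappa$. Let $(L,q_L)$ be a quadratic lattice of rank $n\ge 1$ over $\mathfrak{o}$, i.e. $L$ is free of rank $n$, $q_L:L\to\mathfrak{o}$ is a quadratic form, and $V=L\otimes_{\mathfrak{o}}F$ is nondegenerate. *Local density and Siegel series.* For $k\ge n$ let $H_k$ be $\mathfrak{o}^{2k}$ with $q_k(x,y)=\sum_{i=1}^k x_iy_i$, and let $\mathrm{O}(L,H_k)(\mathfrak{o})$ be the set of $\mathfrak{o}$-linear maps $L\to H_k$ preserving the quadratic forms. Let $\omega_{\mathfrak M}$, $\omega_{\mathfrak Q}$ be the translation-invariant top forms on the spaces of linear maps $V\to H_k\otimes F$ and of quadratic forms on $V$, normalized so that the linear maps $L\to H_k$, respectively the $\mathfrak{o}$-valued quadratic forms on $L$, have volume $1$. With $\rho(m)=q_k\circ m$, the local density is $\alpha(L,H_k)=\int_{\mathrm{O}(L,H_k)(\mathfrak{o})}|\omega_{\mathfrak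 M}/\rho^*\omega_{\mathfrak Q}|$. The Siegel series of $L$ is the polynomial $\mathcal{F}_L(X)$ with $\mathcal{F}_L(f^{-k})=\alpha(L,H_k)$ for all integers $k\ge n$. *Gross–Keating invariant.* $\mathrm{GK}(L)$ is the lexicographically greatest non-decreasing sequence $(a_1,\dots,a_n)$ of non-negative integers for which $L$ has a basis $(x_i)$ with $\mathrm{ord}(q_L(x_i))\ge a_i$ for all $i$ and $\mathrm{ord}(q_L(x_i+x_j)-q_L(x_i)-q_L(x_j))\ge (a_i+a_j)/2$ for all $i\le j$. Put $|\mathrm{GK}(L)|=a_1+\cdots+a_n$, and let $n_0$ be the number of $i$ with $a_i=0$. *Overlattices.* For a lattice $L'\supseteq L$ in $V$ on which the quadratic form of $V$ takes values in $\mathfrak{o}$, write $L'\otimes\kappa=\bar L'_0\perp \mathrm{Rad}(L'\otimes\kappa)$, where $\mathrm{Rad}$ is the radical of the reduced quadratic form, and put $a=\dim_\kappa\bar L'_0$. The symbol $a^+$ (respectively $a^-$) is assigned to $L'$ if $a$ is even and $\bar L'_0$ is split, i.e. a sum of hyperbolic planes (respectively is not split); for odd $a$ the symbol is just $a=a^+=a^-$;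 and $0^+=0^-$. Let $\mathcal{S}_{(L,a^\pm,b)}$ be the set of such $L'$ to which $a^\pm$ is assigned and for which $L'/L$ has length $b$. Let $\chi(a^\pm)=0$ if $a$ is odd, $\chi(a^+)=1$ if $a$ is even, $\chi(0^\pm)=1$, and $\chi(a^-)=-1$ if $a>0$ is even. Then for every integer $k\ge n$ $$\alpha(L,H_k)=(1-f^{-k})\sum_{\substack{0\le b\le |\mathrm{GK}(L)|/2\\ n_0\le a\le n}}\#\mathcal{S}_{(L,a^\pm,b)}\, f^{b(n+1-2k)}\,(1+\chi(a^\pm)f^{n-a/2-k})\prod_{1\le i<n-a/2}(1-f^{2i-2k}),$$ and there is exactly one Siegel series of $L$, namely $$\mathcal{F}_L(X)=(1-X)\sum_{\substack{0\le b\le |\mathrm{GK}(L)|/2\\ n_0\le a\le n}}\#\mathcal{S}_{(L,a^\pm,b)}\, f^{b(n+1)}X^{2b}\,(1+\chi(a^\pm)f^{n-a/2}X)\prod_{1\le i<n-a/2}(1-f^{2i}X^2).$$ In both sums, for $a$ odd or $a=0$ only one of $\mathcal{S}_{(L,a^+,b)}=\mathcal{S}_{(L,a^-,b)}$ is counted,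 and for even $a>0$ the terms for $a^+$ and $a^-$ are both counted. -/

import Mathlib

open scoped ENNReal Polynomial ValuativeRel
open IsLocalRing MeasureTheory

noncomputable section

namespace SiegelSeries

/-! ## Quadratic forms over a commutative ring -/

/-- The quadratic form `q_k` of the lattice `H_k`, the orthogonal sum of `k` hyperbolic planes with
matrix `(0 1/2; 1/2 0)`: on `R ^ (2k)` it is `∑ i, x_i * y_i`. -/
def hyperbolicForm (R : Type*) [CommRing R] (k : ℕ) : QuadraticForm R (Fin k ⊕ Fin k → R) :=
  ∑ i : Fin k, QuadraticMap.linMulLin (LinearMap.proj (Sum.inl i)) (LinearMap.proj (Sum.inr i))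

section Density

variable {R : Type*} [CommRing R] {L : Type*} [AddCommGroup L] [Module R L] {n k : ℕ}

/-- The set `O(L, H_k)(R)` of linear maps from `L` to `H_k` preserving the quadratic forms. -/
def isometrySet (q : QuadraticForm R L) (k : ℕ) : Set (L →ₗ[R] (Fin k ⊕ Fin k → R)) :=
  {φ | ∀ x, hyperbolicForm R k (φ x) = q x}

/-- Index set for the `n (n + 1) / 2` coefficients of a quadratic form of rank `n`. -/
abbrev UpperPair (n : ℕ) : Type := {s : Fin n × Fin n // s.1 ≤ s.2}

/-- Index set for the `2 k n` coordinates of a linear map from a lattice of rank `n` to `H_k`. -/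
abbrev Coord (n k : ℕ) : Type := Fin n × (Fin k ⊕ Fin k)

/-- The coefficient of `X_i X_j` (where `s = (i, j)`, `i ≤ j`) of a quadratic form `g` on `L` with
respect to the basis `b`. These coefficients are integral coordinates on the space of quadratic
forms on `L`; the wedge product of their differentials is the invariant form on that space that
gives volume `1` to the integral quadratic forms on `L`. -/
def formCoeff (b : Module.Basis (Fin n) R L) (g : L → R) (s : UpperPair n) : R :=
  if s.1.1 = s.1.2 then g (b s.1.1) else QuadraticMap.polar g (b s.1.1) (b s.1.2)

/-- The coordinate `c = (l, r)` of a linear map `φ`: the `r`-th entry of `φ (b l)`. -/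
def mapCoord (b : Module.Basis (Fin n) R L) (φ : L →ₗ[R] (Fin k ⊕ Fin k → R))
    (c : Coord n k) : R :=
  φ (b c.1) c.2

/-- The linear map whose coordinate `c` is `1` and whose other coordinates are `0`. -/
def elementaryMap (b : Module.Basis (Fin n) R L) (c : Coord n k) :
    L →ₗ[R] (Fin k ⊕ Fin k → R) :=
  b.constr R (Pi.single c.1 (Pi.single c.2 1))

/-- The differential at `φ`, in the direction `ψ`, of the map `ρ : φ ↦ q_k ∘ φ` from linear maps
to quadratic forms on `L`: it is the quadratic form `x ↦ B_k (φ x, ψ x)`, where `B_k` is the polar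
form of `q_k`. -/
def diffRho (φ ψ : L →ₗ[R] (Fin k ⊕ Fin k → R)) (x : L) : R :=
  QuadraticMap.polar (hyperbolicForm R k) (φ x) (ψ x)

/-- The minor of the Jacobian matrix of `ρ` at `φ` belonging to the `n (n + 1) / 2` coordinates
selected by `J`. -/
def jacobianMinor (b : Module.Basis (Fin n) R L) (J : UpperPair n ↪ Coord n k)
    (φ : L →ₗ[R] (Fin k ⊕ Fin k → R)) : R :=
  Matrix.det (Matrix.of fun s t : UpperPair n =>
    formCoeff b (diffRho φ (elementaryMap b (J t))) s)

/-- The Haar measure of total mass `1` of a compact additive group, on the Borel `σ`-algebra. -/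
def haarProb (G : Type*) [AddCommGroup G] [TopologicalSpace G] [IsTopologicalAddGroup G]
    [CompactSpace G] : @Measure G (borel G) :=
  letI : MeasurableSpace G := borel G
  haveI : BorelSpace G := ⟨rfl⟩
  Measure.addHaarMeasure ⊤

variable [IsDomain R] [IsDiscreteValuationRing R]

/-- The normalized absolute value `|x| = f ^ (- ord x)` of a discrete valuation ring with residue
field of cardinality `f`. -/
def normAbs (x : R) : ℝ≥0∞ :=
  open Classical in
  if x = 0 then 0
  else (Nat.card (ResidueField R) : ℝ≥0∞)⁻¹ ^ (IsDiscreteValuationRing.addVal R x).toNat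

/-- The minor selected by `J` is of maximal absolute value at `φ`. -/
def IsMaxMinor (b : Module.Basis (Fin n) R L) (J : UpperPair n ↪ Coord n k)
    (φ : L →ₗ[R] (Fin k ⊕ Fin k → R)) : Prop :=
  ∀ J' : UpperPair n ↪ Coord n k,
    normAbs (jacobianMinor b J' φ) ≤ normAbs (jacobianMinor b J φ)

/-- A partition of unity: `chartWeight b J φ` is `1 / m` if `J` is one of the `m` choices of
coordinates whose minor at `φ` is of maximal absolute value, and `0` if it is not.
On the fibres `ρ⁻¹(q)`, `q` nondegenerate, these minors do not vanish, and the weights are locally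
constant. -/
def chartWeight (b : Module.Basis (Fin n) R L) (J : UpperPair n ↪ Coord n k)
    (φ : L →ₗ[R] (Fin k ⊕ Fin k → R)) : ℝ≥0∞ :=
  open Classical in
  if IsMaxMinor b J φ then
    (Nat.card {J' : UpperPair n ↪ Coord n k // IsMaxMinor b J' φ} : ℝ≥0∞)⁻¹
  else 0

variable [TopologicalSpace R] [IsTopologicalRing R] [CompactSpace R]

/-- The volume of a set `A` of integral points of a fibre of `ρ` with respect to the gauge form
`ω = ω_M / ρ^* ω_Q`, where `ω_M` is the wedge product of the `d x_c` (`c : Coord n k`) and `ω_Q` is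
the wedge product of the differentials of the form coefficients.

Where the minor `Δ_J` of the Jacobian of `ρ` is nonzero, the coordinates `x_c` with `c` outside the
range of `J` are local coordinates of the fibre, and `|ω| = |Δ_J|⁻¹ ∏_{c ∉ range J} |d x_c|`. The
integral over `A` is computed in these charts by means of the partition of unity `chartWeight`; the
inner sum runs over the points of `A` with given chart coordinates `y`. -/
def gaugeVolume (b : Module.Basis (Fin n) R L) (k : ℕ)
    (A : Set (L →ₗ[R] (Fin k ⊕ Fin k → R))) : ℝ≥0∞ :=
  ∑ J : UpperPair n ↪ Coord n k,
    ∫⁻ y : ({c : Coord n k // c ∉ Set.range J} → R),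
      (∑' φ : {φ : L →ₗ[R] (Fin k ⊕ Fin k → R) // φ ∈ A ∧ ∀ c, mapCoord b φ c.1 = y c},
        chartWeight b J φ.1 * (normAbs (jacobianMinor b J φ.1))⁻¹)
      ∂(haarProb ({c : Coord n k // c ∉ Set.range J} → R))

/-- The local density `α(L, H_k)`: the volume of `O(L, H_k)(R)` with respect to the gauge form.
(It does not depend on the basis.) -/
def localDensity [Module.Free R L] [Module.Finite R L] (q : QuadraticForm R L) (k : ℕ) : ℝ≥0∞ :=
  gaugeVolume (Module.finBasis R L) k (isometrySet q k)

/-- The polynomial `P` is the Siegel series of `(L, q)`: `P (f ^ (-k)) = α(L, H_k)` for all integers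
`k ≥ n`, where `n` is the rank of `L`. -/
def IsSiegelSeries [Module.Free R L] [Module.Finite R L] (q : QuadraticForm R L) (P : ℝ[X]) :
    Prop :=
  ∀ k : ℕ, Module.finrank R L ≤ k →
    localDensity q k ≠ ∞ ∧
      (localDensity q k).toReal = P.eval ((Nat.card (ResidueField R) : ℝ) ^ (-(k : ℤ)))

end Density

/-! ## The Gross-Keating invariant -/

section GrossKeating

variable {R : Type*} [CommRing R] [IsDomain R] [IsDiscreteValuationRing R]
  {L : Type*} [AddCommGroup L] [Module R L]

/-- The set `S(B)`, where `B` is the half-integral matrix of `q` in the basis `b`: its diagonal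
entries are `q (b i)`, and twice its entry at `(i, j)` is the value of the polar form of `q`. -/
def gkSet {n : ℕ} (q : QuadraticForm R L) (b : Module.Basis (Fin n) R L) : Set (Fin n → ℕ) :=
  {a | Monotone a ∧
    (∀ i, (a i : ℕ∞) ≤ IsDiscreteValuationRing.addVal R (q (b i))) ∧
    ∀ i j, i ≤ j → (a i + a j : ℕ∞) ≤
      2 * IsDiscreteValuationRing.addVal R (QuadraticMap.polar q (b i) (b j))}

/-- The Gross-Keating invariant of `(L, q)`: the greatest element, in the lexicographic order, of
the union of the sets `S(B)` over all bases of `L`. -/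
def grossKeating (q : QuadraticForm R L) : Fin (Module.finrank R L) → ℕ :=
  ofLex (Classical.epsilon fun a : Lex (Fin (Module.finrank R L) → ℕ) =>
    IsGreatest {a | ∃ b : Module.Basis (Fin (Module.finrank R L)) R L, ofLex a ∈ gkSet q b} a)

/-- `|GK(L)|`, the sum of the entries of the Gross-Keating invariant. -/
def gkSum (q : QuadraticForm R L) : ℕ := ∑ i, grossKeating q i

/-- The number of zeros in the Gross-Keating invariant. -/
def gkZeros (q : QuadraticForm R L) : ℕ := Nat.card {i // grossKeating q i = 0}

end GrossKeating

/-! ## Reduction modulo the maximal ideal -/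

section Reduction

variable {R : Type*} [CommRing R] [IsLocalRing R] {L : Type*} [AddCommGroup L] [Module R L]

/-- The quadratic form `q` followed by reduction modulo the maximal ideal. -/
def modForm (q : QuadraticForm R L) : QuadraticMap R L (R ⧸ maximalIdeal R) :=
  (Algebra.linearMap R (R ⧸ maximalIdeal R)).compQuadraticMap q

theorem smul_top_le_radical (q : QuadraticForm R L) :
    maximalIdeal R • (⊤ : Submodule R L) ≤ (modForm q).radical := by
  rw [Submodule.smul_le]
  intro r hr x _
  have h0 : ∀ z : R ⧸ maximalIdeal R, r • z = 0 := fun z => by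
    rw [Algebra.smul_def]
    exact mul_eq_zero_of_left (Ideal.Quotient.eq_zero_iff_mem.mpr hr) z
  refine QuadraticMap.mem_radical_iff'.mpr ⟨?_, fun y => ?_⟩
  · rw [QuadraticMap.map_smul, mul_smul, h0]
  · rw [QuadraticMap.map_add (modForm q), QuadraticMap.map_smul, QuadraticMap.polar_smul_left, mul_smul, h0,
      h0, zero_add, add_zero]

/-- The reduction `q mod π`, a quadratic form over the residue field `R / 𝔪` on `L / 𝔪 L`. -/
def reducedForm (q : QuadraticForm R L) :
    QuadraticForm (R ⧸ maximalIdeal R) (L ⧸ (maximalIdeal R • ⊤ : Submodule R L)) :=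
  let g := (modForm q).lift _ (smul_top_le_radical q)
  QuadraticMap.ofPolar g
    (fun a x => by
      obtain ⟨a, rfl⟩ := Ideal.Quotient.mk_surjective a
      exact (g.map_smul a x).trans (Algebra.smul_def _ _))
    (fun x x' y => QuadraticMap.polar_add_left g x x' y)
    (fun a x y => by
      obtain ⟨a, rfl⟩ := Ideal.Quotient.mk_surjective a
      exact (QuadraticMap.polar_smul_left g a x y).trans (Algebra.smul_def _ _))

theorem reducedForm_mk (q : QuadraticForm R L) (x : L) :
    reducedForm q (Submodule.Quotient.mk x) = Ideal.Quotient.mk (maximalIdeal R) (q x) :=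
  rfl

/-- The integer `a` assigned to `(L, q)`: the dimension of a complement of the radical of the
reduction. -/
def nonsingularDim (q : QuadraticForm R L) : ℕ :=
  Module.finrank (R ⧸ maximalIdeal R)
    ((L ⧸ (maximalIdeal R • ⊤ : Submodule R L)) ⧸ (reducedForm q).radical)

/-- The nonsingular part of the reduction of `(L, q)` is split, i.e. an orthogonal sum of hyperbolic
planes. -/
def IsSplitReduction (q : QuadraticForm R L) : Prop :=
  ∃ L₀ : Submodule (R ⧸ maximalIdeal R) (L ⧸ (maximalIdeal R • ⊤ : Submodule R L)),
    IsCompl L₀ (reducedForm q).radical ∧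
    ∃ m : ℕ, Nonempty (((reducedForm q).comp L₀.subtype).IsometryEquiv
      (hyperbolicForm (R ⧸ maximalIdeal R) m))

/-- The sign `χ(a^±)` assigned to `(L, q)`: `0` if `a` is odd, `1` if `a` is even and the nonsingular
part of the reduction is split (in particular if `a = 0`), `-1` otherwise. -/
def reductionSign (q : QuadraticForm R L) : SignType :=
  open Classical in
  if Odd (nonsingularDim q) then 0 else if IsSplitReduction q then 1 else -1

end Reduction

/-! ## Lattices in a quadratic space -/

section Lattice

variable {F : Type*} [Field F] [ValuativeRel F] {V : Type*} [AddCommGroup V] [Module F V]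

/-- `Q` takes integral values on `L`. -/
def IsIntegralOn (Q : QuadraticForm F V) (L : Submodule 𝒪[F] V) : Prop :=
  ∀ x ∈ L, Q x ∈ 𝒪[F]

/-- The integral quadratic form on `L` obtained from `Q` by restriction. -/
def latticeForm (Q : QuadraticForm F V) (L : Submodule 𝒪[F] V) (h : IsIntegralOn Q L) :
    QuadraticForm 𝒪[F] L :=
  QuadraticMap.ofPolar (fun x => ⟨Q x, h x x.2⟩)
    (fun a x => Subtype.ext (QuadraticMap.map_smul Q (a : F) (x : V)))
    (fun x x' y => Subtype.ext (QuadraticMap.polar_add_left Q (x : V) x' y))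
    (fun a x y => Subtype.ext (QuadraticMap.polar_smul_left Q (a : F) (x : V) y))

/-- The set `S_(L, a^±, b)` of the lattices `L'` in `V` containing `L` on which `Q` is integral, with
`[L' : L] = b` (the length of `L' / L`), whose reduction has a nonsingular part of dimension `a` and
of type `±`. The type is recorded by `s = χ(a^±)`: thus `s = 0` for odd `a`, `s = 1` for `a = 0`, and
`s = 1` for `a^+`, `s = -1` for `a^-` if `a` is even and positive. For all other pairs `(a, s)` the
set is empty. -/
def overlattices (Q : QuadraticForm F V) (L : Submodule 𝒪[F] V) [IsLocalRing 𝒪[F]]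
    (a : ℕ) (s : SignType) (b : ℕ) : Set (Submodule 𝒪[F] V) :=
  {L' | L ≤ L' ∧ L'.FG ∧ Module.length 𝒪[F] (L' ⧸ L.submoduleOf L') = b ∧
    ∃ h : IsIntegralOn Q L', nonsingularDim (latticeForm Q L' h) = a ∧
      reductionSign (latticeForm Q L' h) = s}

end Lattice

end SiegelSeries

end

/-!
The theorem evaluates the local density `α(L, H_k)` by counting over the residue field `κ` of `f`
elements.

**Local densities count congruences.** The gauge volume of a fibre of a quadratic map `ρ` is computed
on balls so small that some maximal minor of the Jacobian matrix, of valuation `m`, dominates on each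
of them. On such a ball a change of coordinates makes `ρ` affine (`apply_add_smul_eq`), so the ball
contributes `f ^ m` to the volume, up to normalization. By Smith normal form `f ^ m` is also the index
of the image of the differential, which governs the number of solutions of the congruences. Hence
`α(L, H_k)` is the normalized number of `φ` modulo `ϖ ^ M` with `q_k ∘ φ ≡ q_L`, for all large `M`
(`fibreVolume_eq_cardMod`, `localDensity_mul_eq`).

**Decomposition along overlattices.** An isometry `φ : L → H_k` is primitive, that is, injective
modulo `ϖ`, on exactly one integral lattice containing `L`: the lattice of all vectors of `V` that
`φ` maps into `H_k` (`eq_saturation`, `exists_primitive_extension`). The differential of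
`φ ↦ q_k ∘ φ` at a primitive map is surjective because `H_k` is unimodular
(`IsPrimitive.exists_section`). So the primitive maps on `L'` contribute the number of embeddings of
the reduction `L' ⊗ κ` into `H_k ⊗ κ`, and passing from `L'` to `L` contributes the factor
`f ^ (b (n + 1 - 2 k))`, where `b` is the length of `L' / L` (`cardMod_primitive`,
`localDensity_eq_sum`).

**Embeddings over the residue field.** A quadratic space over `κ` is the orthogonal sum of its
radical, of hyperbolic planes, and of an anisotropic space of dimension at most `2`. Eichler
transformations show that the orthogonal group of `H_k ⊗ κ` is transitive on the nonzero vectors of a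
given norm, which gives recursions for splitting off a radical line or a hyperbolic plane; the
anisotropic cases are counted directly. This works in all characteristics (`embFormula`).

**The ranges of summation.** For a basis that realizes the Gross-Keating invariant `(a_i)`, let `M_e`
be the lattice `2 ord x_i + a_i ≥ e`. If `ord Q(x) ≥ e` and `x` pairs with `M_{1 - e}` into the
maximal ideal, then `x` lies in `M_e`; otherwise `x` could be used to improve the basis
(`mem_gkLattice_of_pairing`, `false_of_improvement`). Comparing `L'` and `ϖ L'` with `M_0` and `M_1`
by means of this duality gives `2 b ≤ |GK(L)|` (`two_mul_relLength_le`). The bound `n_0 ≤ a` holds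
because a basis of `L` adapted to the radical of the reduction of `L'` realizes a sequence with at
most `a` zeros (`card_zeros_le_nonsingularDim`).

Finally, a polynomial is determined by its values at the infinitely many points `f ^ (-k)`.
-/

namespace SiegelSeries

/-! ### Multiples of powers of a uniformizer, and indices of submodules -/

section PowSub

variable {R : Type*} [CommRing R] {M : Type*} [AddCommGroup M] [Module R M]

/-- The submodule `r ^ j M` of the multiples of `r ^ j` in `M`. -/
def powSub (M : Type*) [AddCommGroup M] [Module R M] (r : R) (j : ℕ) : Submodule R M :=
  LinearMap.range (r ^ j • (LinearMap.id : M →ₗ[R] M))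

theorem mem_powSub {r : R} {j : ℕ} {x : M} : x ∈ powSub M r j ↔ ∃ z, r ^ j • z = x := by
  simp [powSub, LinearMap.mem_range]

theorem pow_smul_mem_powSub (r : R) (j : ℕ) (x : M) : r ^ j • x ∈ powSub M r j :=
  mem_powSub.2 ⟨x, rfl⟩

theorem powSub_zero (r : R) : powSub M r 0 = ⊤ := by
  ext x; simp [mem_powSub]

theorem powSub_anti (r : R) {i j : ℕ} (h : i ≤ j) : powSub M r j ≤ powSub M r i := by
  intro x hx
  obtain ⟨z, rfl⟩ := mem_powSub.1 hx
  refine mem_powSub.2 ⟨r ^ (j - i) • z, ?_⟩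
  rw [smul_smul, ← pow_add, Nat.add_sub_cancel' h]

theorem map_mem_powSub {N : Type*} [AddCommGroup N] [Module R N] {r : R} {j : ℕ} (g : M →ₗ[R] N)
    {x : M} (hx : x ∈ powSub M r j) : g x ∈ powSub N r j := by
  obtain ⟨z, rfl⟩ := mem_powSub.1 hx
  exact mem_powSub.2 ⟨g z, by simp⟩

theorem smul_mem_powSub_add {r : R} {i j : ℕ} {x : M} (hx : x ∈ powSub M r j) :
    r ^ i • x ∈ powSub M r (i + j) := by
  obtain ⟨z, rfl⟩ := mem_powSub.1 hx
  exact mem_powSub.2 ⟨z, by rw [pow_add, smul_smul]⟩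

theorem mem_powSub_iff_repr {ι : Type*} [Finite ι] (b : Module.Basis ι R M) {r : R} {j : ℕ} {x : M} :
    x ∈ powSub M r j ↔ ∀ i, r ^ j ∣ b.repr x i := by
  cases nonempty_fintype ι
  constructor
  · intro hx i
    obtain ⟨z, rfl⟩ := mem_powSub.1 hx
    simp
  · intro h
    choose z hz using h
    refine mem_powSub.2 ⟨∑ i, z i • b i, ?_⟩
    conv_rhs => rw [← b.sum_repr x]
    rw [Finset.smul_sum]
    exact Finset.sum_congr rfl fun i _ => by rw [hz i, smul_smul]

theorem mem_powSub_pi {ι : Type*} [Finite ι] {r : R} {j : ℕ} {x : ι → R} :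
    x ∈ powSub (ι → R) r j ↔ ∀ i, r ^ j ∣ x i := by
  cases nonempty_fintype ι
  simpa using mem_powSub_iff_repr (Pi.basisFun R ι) (r := r) (j := j) (x := x)

theorem smul_mem_powSub_iff [IsDomain R] [Module.IsTorsionFree R M] {r : R} (hr : r ≠ 0) {i j : ℕ}
    {x : M} : r ^ i • x ∈ powSub M r (i + j) ↔ x ∈ powSub M r j := by
  refine ⟨fun h => ?_, smul_mem_powSub_add⟩
  obtain ⟨z, hz⟩ := mem_powSub.1 h
  refine mem_powSub.2 ⟨z, ?_⟩
  rw [pow_add, ← smul_smul] at hz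
  exact smul_right_injective M (pow_ne_zero i hr) hz

/-- The number of cosets of `P` met by `T`. -/
noncomputable def cardMod (P : Submodule R M) (T : Set M) : ℕ :=
  (Submodule.Quotient.mk (p := P) '' T).ncard

/-- A map that preserves and reflects congruence preserves the number of residue classes. -/
theorem cardMod_bij (P : Submodule R M) {N : Type*} [AddCommGroup N] [Module R N]
    (P' : Submodule R N) (τ : M → N)
    (h : ∀ x y, τ x - τ y ∈ P' ↔ x - y ∈ P) (T : Set M) : cardMod P' (τ '' T) = cardMod P T := by
  unfold cardMod
  have hl : ∀ x y, (Submodule.Quotient.mk x : M ⧸ P) = Submodule.Quotient.mk y ↔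
      (Submodule.Quotient.mk (τ x) : N ⧸ P') = Submodule.Quotient.mk (τ y) := by
    intro x y
    rw [Submodule.Quotient.eq, Submodule.Quotient.eq, h]
  symm
  refine Set.ncard_congr (fun a _ => Submodule.Quotient.mk (τ (Quotient.out a))) ?_ ?_ ?_
  · rintro _ ⟨x, hx, rfl⟩
    refine ⟨τ x, ⟨x, hx, rfl⟩, ?_⟩
    rw [← hl]
    exact (Quotient.out_eq _).symm
  · intro a a' _ _ e
    rw [← hl] at e
    have h1 : (Submodule.Quotient.mk (Quotient.out a) : M ⧸ P) = a := Quotient.out_eq a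
    have h2 : (Submodule.Quotient.mk (Quotient.out a') : M ⧸ P) = a' := Quotient.out_eq a'
    rw [← h1, ← h2, e]
  · rintro _ ⟨_, ⟨x, hx, rfl⟩, rfl⟩
    refine ⟨Submodule.Quotient.mk x, ⟨x, hx, rfl⟩, ?_⟩
    rw [← hl]
    exact Quotient.out_eq _

theorem cardMod_preimage (P : Submodule R M) {τ : M → M} (hs : Function.Surjective τ)
    (h : ∀ x y, τ x - τ y ∈ P ↔ x - y ∈ P) (Z : Set M) : cardMod P (τ ⁻¹' Z) = cardMod P Z := by
  rw [← cardMod_bij P P τ h, Set.image_preimage_eq Z hs]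

theorem cardMod_translate (P : Submodule R M) (v : M) (T : Set M) :
    cardMod P ((fun x => v + x) '' T) = cardMod P T :=
  cardMod_bij P P _ (fun x y => by simp) T

theorem cardMod_submodule (P Z : Submodule R M) :
    cardMod P (Z : Set M) = P.toAddSubgroup.relIndex Z.toAddSubgroup := by
  have h1 : P.toAddSubgroup.relIndex Z.toAddSubgroup
      = Nat.card (Z.map P.mkQ) := by
    have := AddSubgroup.relIndex_ker (K := Z.toAddSubgroup) (P.mkQ.toAddMonoidHom)
    rw [show P.mkQ.toAddMonoidHom.ker = P.toAddSubgroup from ?_] at this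
    · exact this
    · ext x; simp
  rw [h1]
  rfl

/-- Residue classes of a disjoint union of sets that are unions of cosets of `P`. -/
theorem cardMod_iUnion (P : Submodule R M) [Finite (M ⧸ P)] {ι : Type*} (s : Finset ι)
    (T : ι → Set M) (hsat : ∀ i ∈ s, ∀ x y, x ∈ T i → x - y ∈ P → y ∈ T i)
    (hd : ∀ i ∈ s, ∀ j ∈ s, ∀ x, x ∈ T i → x ∈ T j → i = j) :
    cardMod P {x | ∃ i ∈ s, x ∈ T i} = ∑ i ∈ s, cardMod P (T i) := by
  classical
  have : Fintype (M ⧸ P) := Fintype.ofFinite _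
  unfold cardMod
  have : (Submodule.Quotient.mk (p := P) '' {x | ∃ i ∈ s, x ∈ T i}) =
      (s.biUnion fun i => (Submodule.Quotient.mk (p := P) '' T i).toFinset : Finset (M ⧸ P)) := by
    ext a
    simp only [Set.mem_image, Set.mem_ofPred_eq, Finset.coe_biUnion, Set.mem_iUnion, Set.coe_toFinset]
    constructor
    · rintro ⟨x, ⟨i, hi, hx⟩, rfl⟩; exact ⟨i, hi, x, hx, rfl⟩
    · rintro ⟨i, hi, x, hx, rfl⟩; exact ⟨x, ⟨i, hi, hx⟩, rfl⟩
  rw [this, Set.ncard_coe_finset, Finset.card_biUnion]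
  · exact Finset.sum_congr rfl fun i _ => by rw [Set.ncard_eq_toFinset_card']
  · intro i hi j hj hij
    rw [Function.onFun, Finset.disjoint_left]
    intro a ha ha'
    simp only [Set.mem_toFinset, Set.mem_image] at ha ha'
    obtain ⟨x, hx, rfl⟩ := ha
    obtain ⟨y, hy, e⟩ := ha'
    rw [Submodule.Quotient.eq] at e
    exact hij (hd i hi j hj x hx (hsat j hj y x hy e))

theorem cardMod_mul_relIndex {P' P : Submodule R M} (h : P' ≤ P) [Finite (M ⧸ P')] (T : Set M)
    (hsat : ∀ x y, x ∈ T → x - y ∈ P → y ∈ T) :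
    cardMod P' T = cardMod P T * P'.toAddSubgroup.relIndex P.toAddSubgroup := by
  classical
  have : Finite (M ⧸ P) := Finite.of_surjective _ (Submodule.factor_surjective h)
  have : Fintype (M ⧸ P) := Fintype.ofFinite _
  have key := cardMod_iUnion P' ((Submodule.Quotient.mk (p := P) '' T).toFinset)
    (fun a => {x | Submodule.Quotient.mk (p := P) x = a})
    (fun a _ x y hx hxy => by
      rw [Set.mem_ofPred_eq, ← hx, eq_comm, Submodule.Quotient.eq]; exact h hxy)
    (fun a _ a' _ x hx hx' => by rw [← hx, ← hx'])
  have hT : {x | ∃ a ∈ (Submodule.Quotient.mk (p := P) '' T).toFinset,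
      x ∈ {x | Submodule.Quotient.mk (p := P) x = a}} = T := by
    ext x
    simp only [Set.mem_toFinset, Set.mem_image, Set.mem_ofPred_eq]
    constructor
    · rintro ⟨_, ⟨y, hy, rfl⟩, e⟩
      exact hsat y x hy ((Submodule.Quotient.eq P).1 e.symm)
    · intro hx
      exact ⟨_, ⟨x, hx, rfl⟩, rfl⟩
  rw [hT] at key
  rw [key, Finset.sum_const_nat (m := P'.toAddSubgroup.relIndex P.toAddSubgroup)]
  · rw [cardMod, Set.ncard_eq_toFinset_card']
  · intro a ha
    obtain ⟨x, hx, rfl⟩ : ∃ x ∈ T, Submodule.Quotient.mk x = a := by simpa using ha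
    rw [← cardMod_submodule, ← cardMod_translate P' x (P : Set M)]
    congr 1
    ext y
    simp only [Set.mem_ofPred_eq, Set.mem_image, SetLike.mem_coe]
    rw [Submodule.Quotient.eq]
    exact ⟨fun h => ⟨y - x, h, by abel⟩, by rintro ⟨z, hz, rfl⟩; simpa using hz⟩

end PowSub

section Index

variable {R : Type*} [CommRing R] [IsDomain R] [IsDiscreteValuationRing R]

theorem card_quotient_span_pow {ϖ : R} (hϖ : Irreducible ϖ) (j : ℕ) :
    Nat.card (R ⧸ Ideal.span {ϖ ^ j}) = Nat.card (ResidueField R) ^ j := by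
  have h := cardQuot_pow_of_prime (S := R) (P := maximalIdeal R)
    (IsDiscreteValuationRing.not_a_field R) (i := j)
  rw [Submodule.cardQuot_apply, Submodule.cardQuot_apply, hϖ.maximalIdeal_eq,
    Ideal.span_singleton_pow] at h
  rw [h, ← hϖ.maximalIdeal_eq]
  rfl

variable {M : Type*} [AddCommGroup M] [Module R M] {ι : Type*}

/-- The sublattice of the vectors whose `i`-th coordinate is divisible by `ϖ ^ t i`. -/
def diagSub (b : Module.Basis ι R M) (ϖ : R) (t : ι → ℕ) : Submodule R M where
  carrier := {x | ∀ i, ϖ ^ t i ∣ b.repr x i}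
  zero_mem' := by simp
  add_mem' := fun hx hy i => by simpa using dvd_add (hx i) (hy i)
  smul_mem' := fun c x hx i => by simpa using Dvd.dvd.mul_left (hx i) c

theorem card_quotient_diagSub [Fintype ι] (b : Module.Basis ι R M) {ϖ : R} (hϖ : Irreducible ϖ)
    (t : ι → ℕ) :
    Nat.card (M ⧸ diagSub b ϖ t) = Nat.card (ResidueField R) ^ ∑ i, t i := by
  classical
  let g : M →ₗ[R] (∀ i, R ⧸ Ideal.span {ϖ ^ t i}) :=
    LinearMap.pi fun i => (Submodule.mkQ (Ideal.span {ϖ ^ t i})).comp (b.coord i)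
  have hker : LinearMap.ker g = diagSub b ϖ t := by
    ext x
    simp [g, LinearMap.mem_ker, funext_iff, diagSub, Ideal.Quotient.eq_zero_iff_mem,
      Ideal.mem_span_singleton]
  have hsurj : Function.Surjective g := by
    intro y
    choose z hz using fun i => Submodule.mkQ_surjective _ (y i)
    refine ⟨∑ i, z i • b i, ?_⟩
    ext i
    rw [← hz i]
    simp [g, Finsupp.single_apply, Algebra.smul_def]
  rw [← hker, Nat.card_congr (g.quotKerEquivOfSurjective hsurj).toEquiv, Nat.card_pi,
    ← Finset.prod_pow_eq_pow_sum]
  exact Finset.prod_congr rfl fun i _ => card_quotient_span_pow hϖ _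

theorem length_quotient_diagSub [Fintype ι] (b : Module.Basis ι R M) {ϖ : R} (hϖ : Irreducible ϖ)
    (t : ι → ℕ) :
    Module.length R (M ⧸ diagSub b ϖ t) = (∑ i, t i : ℕ) := by
  classical
  let g : M →ₗ[R] (∀ i, R ⧸ (maximalIdeal R) ^ t i) :=
    LinearMap.pi fun i => (Submodule.mkQ ((maximalIdeal R) ^ t i)).comp (b.coord i)
  have hker : LinearMap.ker g = diagSub b ϖ t := by
    ext x
    simp [g, LinearMap.mem_ker, funext_iff, diagSub, Ideal.Quotient.eq_zero_iff_mem,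
      hϖ.maximalIdeal_eq, Ideal.span_singleton_pow, Ideal.mem_span_singleton]
  have hsurj : Function.Surjective g := by
    intro y
    choose z hz using fun i => Submodule.mkQ_surjective _ (y i)
    refine ⟨∑ i, z i • b i, ?_⟩
    ext i
    rw [← hz i]
    simp [g, Finsupp.single_apply, Algebra.smul_def]
  rw [← hker, (g.quotKerEquivOfSurjective hsurj).length_eq, Module.length_pi_of_fintype]
  simp [IsDiscreteValuationRing.length_quotient_pow_maximalIdeal]

omit [IsDomain R] [IsDiscreteValuationRing R] in
theorem powSub_eq_diagSub [Finite ι] (b : Module.Basis ι R M) (ϖ : R) (j : ℕ) :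
    powSub M ϖ j = diagSub b ϖ fun _ => j := by
  ext x
  exact mem_powSub_iff_repr b

theorem card_quotient_powSub [Fintype ι] (b : Module.Basis ι R M) {ϖ : R} (hϖ : Irreducible ϖ)
    (j : ℕ) :
    Nat.card (M ⧸ powSub M ϖ j) = Nat.card (ResidueField R) ^ (j * Fintype.card ι) := by
  rw [powSub_eq_diagSub b, card_quotient_diagSub b hϖ]
  simp [mul_comm]

theorem finite_quotient_powSub [Finite (ResidueField R)] [Finite ι] (b : Module.Basis ι R M) {ϖ : R}
    (hϖ : Irreducible ϖ) (j : ℕ) : Finite (M ⧸ powSub M ϖ j) := by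
  cases nonempty_fintype ι
  apply Nat.finite_of_card_ne_zero
  rw [card_quotient_powSub b hϖ]
  exact pow_ne_zero _ Nat.card_pos.ne'

/-- A sublattice of full rank is diagonal in a suitable basis. -/
theorem exists_eq_diagSub [Finite ι] (b : Module.Basis ι R M) {ϖ : R} (hϖ : Irreducible ϖ)
    (N : Submodule R M) (h : Module.finrank R N = Module.finrank R M) :
    ∃ (b' : Module.Basis ι R M) (t : ι → ℕ) (bN : Module.Basis ι R N),
      N = diagSub b' ϖ t ∧ ∀ i, (bN i : M) = ϖ ^ t i • b' i := by
  cases nonempty_fintype ι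
  obtain ⟨b', a, bN, hb⟩ := Submodule.exists_smith_normal_form_of_rank_eq b h
  have ha : ∀ i, a i ≠ 0 := fun i h0 => bN.ne_zero i (Subtype.ext (by rw [hb, h0, zero_smul]; rfl))
  choose t u hu using fun i => IsDiscreteValuationRing.eq_unit_mul_pow_irreducible (ha i) hϖ
  have hbN : ∀ i, ((bN.unitsSMul fun i => (u i)⁻¹) i : M) = ϖ ^ t i • b' i := by
    intro i
    rw [Module.Basis.unitsSMul_apply, Units.smul_def, Submodule.coe_smul, hb, hu i, smul_smul,
      ← mul_assoc, Units.inv_mul, one_mul]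
  refine ⟨b', t, bN.unitsSMul fun i => (u i)⁻¹, ?_, hbN⟩
  ext x
  constructor
  · intro hx
    have h2 := congrArg (Subtype.val) ((bN.unitsSMul fun i => (u i)⁻¹).sum_repr ⟨x, hx⟩)
    generalize (bN.unitsSMul fun i => (u i)⁻¹).repr ⟨x, hx⟩ = c at h2
    simp only [AddSubmonoidClass.coe_finsetSum, Submodule.coe_smul, hbN] at h2
    intro i
    classical
    rw [← h2]
    simp [Finsupp.single_apply]
  · intro hx
    choose z hz using hx
    rw [← b'.sum_repr x]
    refine Submodule.sum_mem _ fun i _ => ?_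
    rw [hz i, mul_comm, ← smul_smul, ← hbN]
    exact N.smul_mem _ (Subtype.prop _)

/-- An endomorphism whose determinant has valuation `m` has an image of index `f ^ m`. -/
theorem card_quotient_range [Fintype ι] (b : Module.Basis ι R M) {ϖ : R} (hϖ : Irreducible ϖ)
    (T : M →ₗ[R] M) {m : ℕ} (hT : Associated (LinearMap.det T) (ϖ ^ m)) :
    Nat.card (M ⧸ LinearMap.range T) = Nat.card (ResidueField R) ^ m := by
  classical
  have : Module.Free R M := Module.Free.of_basis b
  have : Module.Finite R M := Module.Finite.of_basis b
  have hdet : LinearMap.det T ≠ 0 := fun h0 => by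
    rw [h0, Associated.comm, associated_zero_iff_eq_zero] at hT
    exact pow_ne_zero m hϖ.ne_zero hT
  have hinj : Function.Injective T := by
    rw [← LinearMap.ker_eq_bot, LinearMap.ker_eq_bot']
    intro x hx
    have h1 := congrArg (LinearMap.toMatrix b b) (rfl : T = T)
    have h2 : (LinearMap.toMatrix b b T).mulVec (b.repr x) = 0 := by
      rw [LinearMap.toMatrix_mulVec_repr, hx]; simp
    have h3 := Matrix.eq_zero_of_mulVec_eq_zero (by rwa [LinearMap.det_toMatrix]) h2
    apply b.repr.injective
    ext i
    simpa using congrFun h3 i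
  let e : M ≃ₗ[R] LinearMap.range T := LinearEquiv.ofInjective T hinj
  obtain ⟨b', t, bN, hN, hb⟩ := exists_eq_diagSub b hϖ (LinearMap.range T) e.symm.finrank_eq
  let e' : M ≃ₗ[R] LinearMap.range T := b'.equiv bN (Equiv.refl _)
  have hass : Associated (LinearMap.det ((LinearMap.range T).subtype ∘ₗ (e : M →ₗ[R] _)))
      (LinearMap.det ((LinearMap.range T).subtype ∘ₗ (e' : M →ₗ[R] _))) :=
    LinearMap.associated_det_comp_equiv _ _ _
  have h1 : (LinearMap.range T).subtype ∘ₗ (e : M →ₗ[R] _) = T := by ext x; rfl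
  have h2 : LinearMap.det ((LinearMap.range T).subtype ∘ₗ (e' : M →ₗ[R] _)) = ϖ ^ ∑ i, t i := by
    rw [← LinearMap.det_toMatrix b', ← Finset.prod_pow_eq_pow_sum, ← Matrix.det_diagonal]
    congr 1
    ext i j
    rw [LinearMap.toMatrix_apply]
    simp only [LinearMap.comp_apply, LinearEquiv.coe_coe, e', Module.Basis.equiv_apply,
      Equiv.refl_apply, Submodule.subtype_apply, hb, map_smul, Module.Basis.repr_self,
      Finsupp.smul_single, smul_eq_mul, mul_one]
    by_cases h : i = j
    · subst h; simp
    · rw [Matrix.diagonal_apply_ne _ h, Finsupp.single_eq_of_ne h]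
  rw [h1, h2] at hass
  have hm : ∑ i, t i = m := by
    have := hass.symm.trans hT
    rw [← IsDiscreteValuationRing.addVal_eq_iff_associated, hϖ.addVal_pow, hϖ.addVal_pow] at this
    exact_mod_cast this
  rw [hN, card_quotient_diagSub b' hϖ, hm]

end Index

/-! ### Contractions of complete lattices -/

section Contraction

variable {R : Type*} [CommRing R] [IsDomain R] [IsDiscreteValuationRing R]
  {M : Type*} [AddCommGroup M] [Module R M]

/-- Completeness of a lattice, in terms of the submodules `ϖ ^ j M`. -/
theorem exists_limit [IsAdicComplete (maximalIdeal R) R] {ι : Type*} [Finite ι]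
    (b : Module.Basis ι R M) {ϖ : R} (hϖ : Irreducible ϖ) (x : ℕ → M)
    (hx : ∀ j, x (j + 1) - x j ∈ powSub M ϖ j) : ∃ y, ∀ j, y - x j ∈ powSub M ϖ j := by
  cases nonempty_fintype ι
  have hmem : ∀ (j : ℕ) (r : R), r ∈ (maximalIdeal R ^ j • ⊤ : Submodule R R) ↔ ϖ ^ j ∣ r := by
    intro j r
    rw [smul_eq_mul, Ideal.mul_top, hϖ.maximalIdeal_eq, Ideal.span_singleton_pow,
      Ideal.mem_span_singleton]
  have hx' : ∀ j m, j ≤ m → x m - x j ∈ powSub M ϖ j := by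
    intro j m hm
    induction m, hm using Nat.le_induction with
    | base => simp
    | succ m hm ih =>
      rw [← sub_add_sub_cancel _ (x m)]
      exact add_mem (powSub_anti ϖ hm (hx m)) ih
  have key : ∀ i, ∃ L : R, ∀ j, ϖ ^ j ∣ L - b.repr (x j) i := by
    intro i
    obtain ⟨L, hL⟩ := IsPrecomplete.prec' (I := maximalIdeal R) (M := R)
      (fun j => b.repr (x j) i) (fun {j m} hjm => by
        rw [SModEq.sub_mem, hmem, ← neg_sub, dvd_neg]
        simpa using (mem_powSub_iff_repr b).1 (hx' j m hjm) i)
    refine ⟨L, fun j => ?_⟩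
    have := hL j
    rwa [SModEq.sub_mem, hmem, ← neg_sub, dvd_neg] at this
  choose L hL using key
  refine ⟨∑ i, L i • b i, fun j => (mem_powSub_iff_repr b).2 fun i => ?_⟩
  classical
  simpa [Finsupp.single_apply] using hL i j

theorem eq_zero_of_forall_mem_powSub [IsAdicComplete (maximalIdeal R) R] {ι : Type*} [Finite ι]
    (b : Module.Basis ι R M) {ϖ : R} (hϖ : Irreducible ϖ) {x : M}
    (hx : ∀ j, x ∈ powSub M ϖ j) : x = 0 := by
  apply b.repr.injective
  ext i
  rw [map_zero, Finsupp.zero_apply]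
  apply IsHausdorff.haus' (I := maximalIdeal R) (M := R)
  intro j
  rw [SModEq.sub_mem, sub_zero, smul_eq_mul, Ideal.mul_top, hϖ.maximalIdeal_eq,
    Ideal.span_singleton_pow, Ideal.mem_span_singleton]
  exact (mem_powSub_iff_repr b).1 (hx j) i

omit [IsDomain R] [IsDiscreteValuationRing R] in
/-- A perturbation of the identity by a contraction is an isometric bijection of the lattice. -/
theorem isometry_of_contraction {ϖ : R} (η : M → M)
    (h : ∀ j x y, x - y ∈ powSub M ϖ j → η x - η y ∈ powSub M ϖ (j + 1)) (j : ℕ) (x y : M) :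
    (x + η x) - (y + η y) ∈ powSub M ϖ j ↔ x - y ∈ powSub M ϖ j := by
  have e : (x + η x) - (y + η y) = (x - y) + (η x - η y) := by abel
  rw [e]
  constructor
  · intro hj
    induction j with
    | zero => rw [powSub_zero]; trivial
    | succ j ih =>
      have := h j x y (ih (powSub_anti ϖ j.le_succ hj))
      simpa using sub_mem hj this
  · intro hj
    exact add_mem hj (powSub_anti ϖ j.le_succ (h j x y hj))

theorem bijective_of_contraction [IsAdicComplete (maximalIdeal R) R] {ι : Type*} [Finite ι]
    (b : Module.Basis ι R M) {ϖ : R} (hϖ : Irreducible ϖ) (η : M → M)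
    (h : ∀ j x y, x - y ∈ powSub M ϖ j → η x - η y ∈ powSub M ϖ (j + 1)) :
    Function.Bijective fun x => x + η x := by
  constructor
  · intro x y hxy
    rw [← sub_eq_zero]
    refine eq_zero_of_forall_mem_powSub b hϖ fun j => ?_
    rw [← isometry_of_contraction η h]
    simp only at hxy
    rw [hxy, sub_self]
    exact zero_mem _
  · intro z
    let x : ℕ → M := fun n => Nat.rec z (fun _ y => z - η y) n
    have hx : ∀ j, x (j + 1) - x j ∈ powSub M ϖ j := by
      intro j
      induction j with
      | zero => rw [powSub_zero]; trivial
      | succ j ih =>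
        have : x (j + 1 + 1) - x (j + 1) = -(η (x (j + 1)) - η (x j)) := by
          simp only [x]; abel
        rw [this]
        exact neg_mem (h j _ _ ih)
    obtain ⟨y, hy⟩ := exists_limit b hϖ x hx
    refine ⟨y, ?_⟩
    rw [← sub_eq_zero]
    refine eq_zero_of_forall_mem_powSub b hϖ fun j => ?_
    have : y + η y - z = (y - x (j + 1)) + (η y - η (x j)) := by
      simp only [x]; abel
    rw [this]
    exact add_mem (powSub_anti ϖ j.le_succ (hy (j + 1))) (powSub_anti ϖ j.le_succ (h j _ _ (hy j)))

end Contraction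

/-! ### Linearization of quadratic maps near points where the differential has a section -/

section Linearization

variable {R : Type*} [CommRing R] {E G : Type*} [AddCommGroup E] [Module R E] [AddCommGroup G]
  [Module R G]

theorem quadraticMap_sub_eq (ρ : QuadraticMap R E G) (x y : E) :
    ρ x - ρ y = QuadraticMap.polar ρ y (x - y) + ρ (x - y) := by
  simp only [QuadraticMap.polar]
  rw [show y + (x - y) = x by abel]
  abel

/-- If `s` is a section up to the factor `ϖ ^ c` of the differential of `ρ` at `x₀`, then
`straighten ρ s ϖ e` is a change of coordinates on the ball of radius `ϖ ^ (c + e + 1)` at `x₀`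
in which `ρ` becomes affine: see `apply_add_smul_eq`. -/
def straighten (ρ : QuadraticMap R E G) (s : G →ₗ[R] E) (ϖ : R) (e : ℕ) (δ : E) : E :=
  δ + ϖ ^ (e + 1) • s (ρ δ)

theorem straighten_contraction (ρ : QuadraticMap R E G) (s : G →ₗ[R] E) (ϖ : R) (e : ℕ) (j : ℕ)
    (x y : E) (h : x - y ∈ powSub E ϖ j) :
    ϖ ^ (e + 1) • s (ρ x) - ϖ ^ (e + 1) • s (ρ y) ∈ powSub E ϖ (j + 1) := by
  rw [← smul_sub, ← map_sub, quadraticMap_sub_eq]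
  obtain ⟨z, hz⟩ := mem_powSub.1 h
  have : QuadraticMap.polar ρ y (x - y) + ρ (x - y) ∈ powSub G ϖ j := by
    refine mem_powSub.2 ⟨QuadraticMap.polar ρ y z + ϖ ^ j • ρ z, ?_⟩
    rw [← hz, QuadraticMap.polar_smul_right, QuadraticMap.map_smul, smul_add, smul_smul]
  have h1 := smul_mem_powSub_add (i := e + 1) (map_mem_powSub s this)
  exact powSub_anti ϖ (by omega) h1

theorem straighten_sub_mem_iff (ρ : QuadraticMap R E G) (s : G →ₗ[R] E) (ϖ : R) (e : ℕ) (j : ℕ)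
    (x y : E) : straighten ρ s ϖ e x - straighten ρ s ϖ e y ∈ powSub E ϖ j ↔
      x - y ∈ powSub E ϖ j :=
  isometry_of_contraction (fun δ => ϖ ^ (e + 1) • s (ρ δ)) (straighten_contraction ρ s ϖ e) j x y

theorem straighten_bijective [IsDomain R] [IsDiscreteValuationRing R]
    [IsAdicComplete (maximalIdeal R) R] {ι : Type*} [Finite ι] (b : Module.Basis ι R E)
    (ρ : QuadraticMap R E G) (s : G →ₗ[R] E) {ϖ : R} (hϖ : Irreducible ϖ) (e : ℕ) :
    Function.Bijective (straighten ρ s ϖ e) :=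
  bijective_of_contraction b hϖ (fun δ => ϖ ^ (e + 1) • s (ρ δ)) (straighten_contraction ρ s ϖ e)

/-- A quadratic map is affine on small balls, up to a change of coordinates. -/
theorem apply_add_smul_eq (ρ : QuadraticMap R E G) (s : G →ₗ[R] E) (ϖ : R) (c e : ℕ) (x₀ : E)
    (hs : ∀ g, QuadraticMap.polar ρ x₀ (s g) = ϖ ^ c • g) (δ : E) :
    ρ (x₀ + ϖ ^ (c + e + 1) • δ) =
      ρ x₀ + ϖ ^ (c + e + 1) • QuadraticMap.polar ρ x₀ (straighten ρ s ϖ e δ) := by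
  rw [straighten, QuadraticMap.polar_add_right, QuadraticMap.polar_smul_right, hs,
    QuadraticMap.map_add (⇑ρ), QuadraticMap.polar_smul_right, QuadraticMap.map_smul, smul_add,
    smul_smul, smul_smul]
  have : ϖ ^ (c + e + 1) * ϖ ^ (c + e + 1) = ϖ ^ (c + e + 1) * (ϖ ^ (e + 1) * ϖ ^ c) := by ring
  rw [this, ← mul_assoc]
  abel

variable [IsDomain R] [IsDiscreteValuationRing R] [IsAdicComplete (maximalIdeal R) R]

/-- The points that the straightened map carries into a coset of `W` are as many, modulo `ϖ ^ j`, as the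
points that its linear part carries into `W`. -/
theorem cardMod_straighten {ι : Type*} [Finite ι] (b : Module.Basis ι R E)
    (ρ : QuadraticMap R E G) (s : G →ₗ[R] E) {ϖ : R} (hϖ : Irreducible ϖ) (e : ℕ)
    (D : E →ₗ[R] G) (W : Submodule R G) (g : G) (hg : ∃ y, g + D y ∈ W) (j : ℕ) :
    cardMod (powSub E ϖ j) {δ | g + D (straighten ρ s ϖ e δ) ∈ W} =
      (powSub E ϖ j).toAddSubgroup.relIndex (W.comap D).toAddSubgroup := by
  have h1 := cardMod_preimage (powSub E ϖ j) (straighten_bijective b ρ s hϖ e).2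
    (straighten_sub_mem_iff ρ s ϖ e j) {x | g + D x ∈ W}
  obtain ⟨y, hy⟩ := hg
  rw [← cardMod_submodule, ← cardMod_translate _ y (W.comap D : Set E)]
  refine h1.trans ?_
  congr 1
  ext x
  simp only [Set.mem_ofPred_eq, Set.mem_image, SetLike.mem_coe, Submodule.mem_comap]
  constructor
  · intro hx
    refine ⟨x - y, ?_, by abel⟩
    have := sub_mem hx hy
    rw [map_sub]
    convert this using 1
    abel
  · rintro ⟨z, hz, rfl⟩
    rw [map_add, ← add_assoc]
    exact add_mem hy hz

omit [IsDomain R] [IsDiscreteValuationRing R] [IsAdicComplete (maximalIdeal R) R] in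
theorem index_comap_eq_relIndex (D : E →ₗ[R] G) (W : Submodule R G) :
    (W.comap D).toAddSubgroup.index = W.toAddSubgroup.relIndex (LinearMap.range D).toAddSubgroup := by
  have := AddSubgroup.relIndex_comap W.toAddSubgroup D.toAddMonoidHom ⊤
  rw [AddSubgroup.relIndex_top_right] at this
  have h2 : AddSubgroup.map D.toAddMonoidHom ⊤ = (LinearMap.range D).toAddSubgroup := by
    ext x; simp
  rw [h2] at this
  exact this

/-- The number of solutions modulo `ϖ ^ (c + e + 1 + l)` of the congruence `ρ x ≡ ρ x₀` in the ball of
radius `ϖ ^ (c + e + 1)` at `x₀`. The map is affine there in suitable coordinates, so this is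
`f ^ (l * (dim E - dim G))` times the index `f ^ m` of the image of the differential. -/
theorem cardMod_ball {ι σ : Type*} [Fintype ι] [Fintype σ] (b : Module.Basis ι R E)
    (b' : Module.Basis σ R G) (ρ : QuadraticMap R E G) (s : G →ₗ[R] E) {ϖ : R}
    (hϖ : Irreducible ϖ) (c e l m : ℕ) (x₀ : E) (hcl : c ≤ l)
    (hs : ∀ g, QuadraticMap.polar ρ x₀ (s g) = ϖ ^ c • g)
    (hm : Nat.card (G ⧸ LinearMap.range (ρ.polarBilin x₀)) = Nat.card (ResidueField R) ^ m) :
    cardMod (powSub E ϖ (c + e + 1 + l)) {x | ρ x - ρ x₀ ∈ powSub G ϖ (c + e + 1 + l) ∧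
        x - x₀ ∈ powSub E ϖ (c + e + 1)} * Nat.card (ResidueField R) ^ (l * Fintype.card σ) =
      Nat.card (ResidueField R) ^ (l * Fintype.card ι) * Nat.card (ResidueField R) ^ m := by
  have : Module.IsTorsionFree R E := by
    have := Module.Free.of_basis b; infer_instance
  have : Module.IsTorsionFree R G := by
    have := Module.Free.of_basis b'; infer_instance
  set D := ρ.polarBilin x₀ with hD
  set N := c + e + 1
  have hset : {x | ρ x - ρ x₀ ∈ powSub G ϖ (N + l) ∧ x - x₀ ∈ powSub E ϖ N} =
      (fun δ => x₀ + ϖ ^ N • δ) '' {δ | 0 + D (straighten ρ s ϖ e δ) ∈ powSub G ϖ l} := by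
    ext x
    simp only [Set.mem_ofPred_eq, Set.mem_image, zero_add]
    constructor
    · rintro ⟨h1, h2⟩
      obtain ⟨δ, hδ⟩ := mem_powSub.1 h2
      have hx : x₀ + ϖ ^ N • δ = x := by rw [hδ]; abel
      refine ⟨δ, ?_, hx⟩
      rw [← hx, apply_add_smul_eq ρ s ϖ c e x₀ hs, add_sub_cancel_left,
        smul_mem_powSub_iff hϖ.ne_zero] at h1
      exact h1
    · rintro ⟨δ, h, rfl⟩
      refine ⟨?_, by rw [add_sub_cancel_left]; exact pow_smul_mem_powSub _ _ _⟩
      rw [apply_add_smul_eq ρ s ϖ c e x₀ hs, add_sub_cancel_left,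
        smul_mem_powSub_iff hϖ.ne_zero]
      exact h
  rw [hset, cardMod_bij (powSub E ϖ l) (powSub E ϖ (N + l)) (fun δ => x₀ + ϖ ^ N • δ)
    (fun x y => by
      rw [add_sub_add_left_eq_sub, ← smul_sub, smul_mem_powSub_iff hϖ.ne_zero]),
    cardMod_straighten b ρ s hϖ e D (powSub G ϖ l) 0 ⟨0, by simp⟩ l]
  have h1 : (powSub E ϖ l).toAddSubgroup ≤ ((powSub G ϖ l).comap D).toAddSubgroup :=
    fun x hx => map_mem_powSub D hx
  have h2 := AddSubgroup.relIndex_mul_index h1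
  have h3 : (powSub G ϖ l).toAddSubgroup ≤ (LinearMap.range D).toAddSubgroup := by
    intro x hx
    obtain ⟨z, rfl⟩ := mem_powSub.1 hx
    refine ⟨s (ϖ ^ (l - c) • z), ?_⟩
    change QuadraticMap.polar ρ x₀ (s (ϖ ^ (l - c) • z)) = _
    rw [hs, smul_smul, ← pow_add, Nat.add_sub_cancel' hcl]
  have h4 := AddSubgroup.relIndex_mul_index h3
  rw [index_comap_eq_relIndex] at h2
  have h5 : (powSub E ϖ l).toAddSubgroup.index = _ := card_quotient_powSub b hϖ l
  have h6 : (powSub G ϖ l).toAddSubgroup.index = _ := card_quotient_powSub b' hϖ l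
  have h7 : (LinearMap.range D).toAddSubgroup.index = _ := hm
  rw [h5] at h2
  rw [h6, h7] at h4
  rw [← h2, ← h4]
  ring

end Linearization

/-! ### Minors of the Jacobian matrix of a quadratic map -/

section Minors

variable {R : Type*} [CommRing R] {ι σ : Type*} [Fintype ι] [DecidableEq ι] [Fintype σ]
  [DecidableEq σ]

/-- The Jacobian matrix at `x` of a quadratic map in coordinates. -/
def jacobian (ρ : QuadraticMap R (ι → R) (σ → R)) (x : ι → R) : Matrix σ ι R :=
  Matrix.of fun s t => QuadraticMap.polar ρ x (Pi.single t 1) s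

/-- The maximal minor of the Jacobian matrix at `x` with columns selected by `J`. -/
def minor (ρ : QuadraticMap R (ι → R) (σ → R)) (J : σ ↪ ι) (x : ι → R) : R :=
  ((jacobian ρ x).submatrix id J).det

omit [Fintype σ] [DecidableEq σ] in
theorem jacobian_mulVec (ρ : QuadraticMap R (ι → R) (σ → R)) (x y : ι → R) :
    (jacobian ρ x).mulVec y = QuadraticMap.polar ρ x y := by
  conv_rhs => rw [← (Pi.basisFun R ι).sum_repr y]
  change _ = ρ.polarBilin x _
  rw [map_sum]
  ext s
  rw [Finset.sum_apply]
  refine Finset.sum_congr rfl fun t _ => ?_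
  rw [map_smul]
  simp [jacobian, mul_comm]

omit [Fintype ι] in
/-- Congruent points have congruent minors. -/
theorem minor_sub_dvd (ρ : QuadraticMap R (ι → R) (σ → R)) (J : σ ↪ ι) {ϖ : R} {N : ℕ}
    {x y : ι → R} (h : x - y ∈ powSub (ι → R) ϖ N) : ϖ ^ N ∣ minor ρ J x - minor ρ J y := by
  rw [← Ideal.mem_span_singleton, ← Ideal.Quotient.eq]
  unfold minor
  rw [RingHom.map_det, RingHom.map_det]
  congr 1
  ext s t
  simp only [RingHom.mapMatrix_apply, Matrix.map_apply, Matrix.submatrix_apply, id, jacobian,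
    Matrix.of_apply]
  rw [Ideal.Quotient.eq, Ideal.mem_span_singleton, ← Pi.sub_apply]
  obtain ⟨z, hz⟩ := mem_powSub.1 h
  have : QuadraticMap.polar ρ x (Pi.single (J t) 1) - QuadraticMap.polar ρ y (Pi.single (J t) 1) =
      ϖ ^ N • QuadraticMap.polar ρ z (Pi.single (J t) 1) := by
    rw [← QuadraticMap.polar_sub_left, ← hz, QuadraticMap.polar_smul_left]
  rw [this]
  exact Dvd.intro _ rfl

/-- A common divisor of the maximal minors of a matrix divides the determinant of any product with
a matrix on the right, by multilinearity. -/
theorem dvd_det_mul (D : Matrix σ ι R) (S : Matrix ι σ R) (a : R)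
    (h : ∀ J : σ ↪ ι, a ∣ (D.submatrix id J).det) : a ∣ (D * S).det := by
  rw [← Matrix.det_transpose]
  have h1 : (D * S).transpose = fun i => ∑ j, S j i • D.transpose j := by
    ext i s
    rw [Finset.sum_apply]
    simp [Matrix.mul_apply, mul_comm]
  change a ∣ Matrix.detRowAlternating (D * S).transpose
  rw [h1]
  change a ∣ (Matrix.detRowAlternating (R := R) (n := σ)).toMultilinearMap
    fun i => ∑ j, S j i • D.transpose j
  rw [MultilinearMap.map_sum]
  refine Finset.dvd_sum fun r _ => ?_
  rw [MultilinearMap.map_smul_univ]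
  apply Dvd.dvd.mul_left
  by_cases hr : Function.Injective r
  · have := h ⟨r, hr⟩
    rw [← Matrix.det_transpose] at this
    exact this
  · rw [Function.Injective] at hr
    push Not at hr
    obtain ⟨i, j, hij, hne⟩ := hr
    have : (Matrix.detRowAlternating (R := R) (n := σ)).toMultilinearMap
        (fun i => D.transpose (r i)) = 0 :=
      Matrix.detRowAlternating.map_eq_zero_of_eq _ (congrArg D.transpose hij) hne
    rw [this]
    exact dvd_zero a

end Minors

section Level

variable {R : Type*} [CommRing R] [IsDomain R] [IsDiscreteValuationRing R]
  {ι σ : Type*} [Fintype ι] [DecidableEq ι] [Fintype σ] [DecidableEq σ]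
  (ρ : QuadraticMap R (ι → R) (σ → R)) {ϖ : R}

/-- The minimal valuation of a maximal minor at `x` is `m`. -/
def HasLevel (ϖ : R) (x : ι → R) (m : ℕ) : Prop :=
  (∀ J, ϖ ^ m ∣ minor ρ J x) ∧ ∃ J, ¬ ϖ ^ (m + 1) ∣ minor ρ J x

omit [IsDiscreteValuationRing R] in
/-- A section of the differential up to the factor `ϖ ^ c` forces a minor of valuation at most
`c * card σ`, since the product of the Jacobian matrix with the section has determinant
`ϖ ^ (c * card σ)`. -/
theorem exists_hasLevel (hϖ : Irreducible ϖ) {c : ℕ} {x : ι → R} (s : (σ → R) →ₗ[R] (ι → R))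
    (hs : ∀ g, QuadraticMap.polar ρ x (s g) = ϖ ^ c • g) :
    ∃ m ≤ c * Fintype.card σ, HasLevel ρ ϖ x m := by
  have hdet : (jacobian ρ x * LinearMap.toMatrix' s).det = ϖ ^ (c * Fintype.card σ) := by
    have : jacobian ρ x * LinearMap.toMatrix' s = Matrix.diagonal fun _ => ϖ ^ c := by
      apply Matrix.toLin'.injective
      ext1 i
      ext1
      rw [Matrix.toLin'_mul, Matrix.toLin'_toMatrix']
      simp only [LinearMap.coe_comp, LinearMap.coe_single, Function.comp_apply]
      rw [Matrix.toLin'_apply, jacobian_mulVec, hs, Matrix.toLin'_apply]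
      ext j
      simp [Matrix.mulVec_diagonal]
    rw [this, Matrix.det_diagonal]
    simp [pow_mul]
  by_contra hcon
  push Not at hcon
  have key : ∀ m ≤ c * Fintype.card σ + 1, ∀ J, ϖ ^ m ∣ minor ρ J x := by
    intro m
    induction m with
    | zero => simp
    | succ m ih =>
      intro hm J
      by_contra hJ
      exact hcon m (by omega) ⟨ih (by omega), J, hJ⟩
  have := dvd_det_mul _ (LinearMap.toMatrix' s) _ (key _ le_rfl)
  rw [hdet, pow_dvd_pow_iff hϖ.ne_zero hϖ.not_isUnit] at this
  omega

omit [IsDomain R] [IsDiscreteValuationRing R] [Fintype ι] in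
theorem pow_dvd_minor_congr {N m : ℕ} (hm : m ≤ N) (J : σ ↪ ι) {x y : ι → R}
    (h : x - y ∈ powSub (ι → R) ϖ N) : ϖ ^ m ∣ minor ρ J x ↔ ϖ ^ m ∣ minor ρ J y := by
  have h1 := (pow_dvd_pow ϖ hm).trans (minor_sub_dvd ρ J h)
  exact dvd_iff_dvd_of_dvd_sub h1

omit [IsDomain R] [IsDiscreteValuationRing R] [Fintype ι] in
theorem HasLevel.congr {ρ : QuadraticMap R (ι → R) (σ → R)} {N m : ℕ} {x y : ι → R}
    (hx : HasLevel ρ ϖ x m) (hm : m < N) (h : y - x ∈ powSub (ι → R) ϖ N) : HasLevel ρ ϖ y m := by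
  refine ⟨fun J => (pow_dvd_minor_congr ρ hm.le J h).2 (hx.1 J), ?_⟩
  obtain ⟨J, hJ⟩ := hx.2
  exact ⟨J, fun h' => hJ ((pow_dvd_minor_congr ρ hm J h).1 h')⟩

theorem associated_pow_of_dvd (hϖ : Irreducible ϖ) {m : ℕ} {a : R} (h1 : ϖ ^ m ∣ a)
    (h2 : ¬ ϖ ^ (m + 1) ∣ a) : Associated a (ϖ ^ m) := by
  have ha : a ≠ 0 := fun h0 => h2 (h0 ▸ dvd_zero _)
  obtain ⟨j, u, rfl⟩ := IsDiscreteValuationRing.eq_unit_mul_pow_irreducible ha hϖ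
  have e1 : ∀ i, ϖ ^ i ∣ (u : R) * ϖ ^ j ↔ i ≤ j := fun i => by
    rw [Units.dvd_mul_left, pow_dvd_pow_iff hϖ.ne_zero hϖ.not_isUnit]
  rw [e1] at h1 h2
  have : j = m := by omega
  subst this
  exact ⟨u⁻¹, by rw [mul_comm, Units.inv_mul_cancel_left]⟩

variable {ρ}

/-- The columns of the Jacobian matrix are integral combinations of those selected by a maximal
minor, by Cramer's rule. -/
theorem exists_mulVec_submatrix_eq (hϖ : Irreducible ϖ) {m : ℕ} {x : ι → R} (hx : HasLevel ρ ϖ x m)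
    {J : σ ↪ ι} (hJ : ¬ ϖ ^ (m + 1) ∣ minor ρ J x) (y : ι → R) :
    ∃ w, ((jacobian ρ x).submatrix id J).mulVec w = (jacobian ρ x).mulVec y := by
  set A := (jacobian ρ x).submatrix id J with hA
  have hass := associated_pow_of_dvd hϖ (hx.1 J) hJ
  have hne : A.det ≠ 0 := fun h0 => hJ (by rw [show minor ρ J x = A.det from rfl, h0]; exact dvd_zero _)
  have hcol : ∀ t, ∃ w, A.mulVec w = fun s => jacobian ρ x s t := by
    intro t
    by_cases ht : ∃ i, J i = t
    · obtain ⟨i, rfl⟩ := ht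
      refine ⟨Pi.single i 1, ?_⟩
      ext s
      simp [A]
    · have hdvd : ∀ i, A.det ∣ A.cramer (fun s => jacobian ρ x s t) i := by
        intro i
        have hinj : Function.Injective (Function.update J i t) := by
          intro a b hab
          by_cases ha : a = i <;> by_cases hb : b = i
          · rw [ha, hb]
          · subst ha
            rw [Function.update_self, Function.update_of_ne hb] at hab
            exact absurd ⟨b, hab.symm⟩ ht
          · subst hb
            rw [Function.update_self, Function.update_of_ne ha] at hab
            exact absurd ⟨a, hab⟩ ht
          · rw [Function.update_of_ne ha, Function.update_of_ne hb] at hab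
            exact J.injective hab
        have h1 := hx.1 ⟨_, hinj⟩
        have h2 : minor ρ ⟨_, hinj⟩ x = A.cramer (fun s => jacobian ρ x s t) i := by
          rw [Matrix.cramer_apply, minor]
          congr 1
          ext s j
          by_cases hj : j = i
          · subst hj; simp
          · simp [A, Matrix.updateCol_ne hj, Function.update_of_ne hj]
        rw [← h2]
        exact hass.dvd.trans h1
      choose w hw using hdvd
      refine ⟨w, ?_⟩
      have h3 := Matrix.mulVec_cramer A fun s => jacobian ρ x s t
      have h4 : A.cramer (fun s => jacobian ρ x s t) = A.det • w := by
        ext i; rw [hw i]; rfl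
      rw [h4, Matrix.mulVec_smul] at h3
      exact smul_right_injective _ hne h3
  choose w hw using hcol
  refine ⟨∑ t, y t • w t, ?_⟩
  rw [Matrix.mulVec_sum]
  ext s
  rw [Finset.sum_apply]
  refine Finset.sum_congr rfl fun t _ => ?_
  rw [Matrix.mulVec_smul, hw, Pi.smul_apply, smul_eq_mul, mul_comm]

/-- A section, up to the factor `ϖ ^ m`, of the differential with values in the coordinates selected
by a maximal minor. -/
theorem exists_section_of_minor (hϖ : Irreducible ϖ) {m : ℕ} {x : ι → R} (hx : HasLevel ρ ϖ x m)
    {J : σ ↪ ι} (hJ : ¬ ϖ ^ (m + 1) ∣ minor ρ J x) :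
    ∃ s : (σ → R) →ₗ[R] (ι → R), (∀ g, QuadraticMap.polar ρ x (s g) = ϖ ^ m • g) ∧
      ∀ g, ∀ c ∉ Set.range J, s g c = 0 := by
  classical
  set A := (jacobian ρ x).submatrix id J with hA
  obtain ⟨u, hu⟩ := associated_pow_of_dvd hϖ (hx.1 J) hJ
  let S : (σ → R) →ₗ[R] (ι → R) :=
    (Fintype.linearCombination R fun i => Pi.single (M := fun _ => R) (J i) 1) ∘ₗ
      ((u : R) • Matrix.toLin' A.adjugate)
  have hlc : ∀ w : σ → R, (jacobian ρ x).mulVec (Fintype.linearCombination R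
      (fun i => Pi.single (M := fun _ => R) (J i) 1) w) = A.mulVec w := by
    intro w
    rw [Fintype.linearCombination_apply, Matrix.mulVec_sum]
    ext s
    rw [Finset.sum_apply]
    refine Finset.sum_congr rfl fun i _ => ?_
    rw [Matrix.mulVec_smul]
    simp [A, mul_comm]
  refine ⟨S, fun g => ?_, fun g c hc => ?_⟩
  · rw [← jacobian_mulVec]
    simp only [S, LinearMap.comp_apply, hlc, LinearMap.smul_apply, Matrix.toLin'_apply,
      Matrix.mulVec_smul, Matrix.mulVec_mulVec, Matrix.mul_adjugate, Matrix.smul_mulVec,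
      Matrix.one_mulVec]
    rw [smul_smul, ← hu, mul_comm]
    rfl
  · simp only [S, LinearMap.comp_apply, Fintype.linearCombination_apply]
    rw [Finset.sum_apply]
    refine Finset.sum_eq_zero fun i _ => ?_
    rw [Pi.smul_apply, Pi.single_eq_of_ne (fun h => hc ⟨i, h.symm⟩), smul_zero]

/-- The index of the image of the differential is given by the maximal minors. -/
theorem card_quotient_range_polarBilin (hϖ : Irreducible ϖ) {m : ℕ} {x : ι → R}
    (hx : HasLevel ρ ϖ x m) :
    Nat.card ((σ → R) ⧸ LinearMap.range (ρ.polarBilin x)) = Nat.card (ResidueField R) ^ m := by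
  obtain ⟨J, hJ⟩ := hx.2
  have hass := associated_pow_of_dvd hϖ (hx.1 J) hJ
  have hr : LinearMap.range (ρ.polarBilin x) =
      LinearMap.range (Matrix.toLin' ((jacobian ρ x).submatrix id J)) := by
    apply le_antisymm
    · rintro _ ⟨y, rfl⟩
      obtain ⟨w, hw⟩ := exists_mulVec_submatrix_eq hϖ hx hJ y
      exact ⟨w, by rw [Matrix.toLin'_apply, hw, jacobian_mulVec]; rfl⟩
    · rintro _ ⟨w, rfl⟩
      refine ⟨∑ i, w i • Pi.single (J i) 1, ?_⟩
      change QuadraticMap.polar ρ x _ = _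
      rw [← jacobian_mulVec, Matrix.mulVec_sum, Matrix.toLin'_apply]
      ext s
      rw [Finset.sum_apply]
      refine Finset.sum_congr rfl fun i _ => ?_
      rw [Matrix.mulVec_smul]
      simp [mul_comm]
  rw [hr]
  exact card_quotient_range (Pi.basisFun R σ) hϖ _ (by rw [LinearMap.det_toLin']; exact hass)

/-- In a small ball around a point of the fibre, the fibre is a graph over the coordinates
complementary to those selected by a maximal minor. -/
theorem existsUnique_mem_fibre [IsAdicComplete (maximalIdeal R) R] (hϖ : Irreducible ϖ) {m N : ℕ}
    (hmN : m < N) {x : ι → R} (hx : HasLevel ρ ϖ x m) {J : σ ↪ ι}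
    (hJ : ¬ ϖ ^ (m + 1) ∣ minor ρ J x) (z : {c : ι // c ∉ Set.range J} → R)
    (hz : (fun c => z c - x c.1) ∈ powSub ({c : ι // c ∉ Set.range J} → R) ϖ N) :
    ∃! y, ρ y = ρ x ∧ y - x ∈ powSub (ι → R) ϖ N ∧ ∀ c, y c.1 = z c := by
  classical
  obtain ⟨s, hs, hs0⟩ := exists_section_of_minor hϖ hx hJ
  obtain ⟨e, rfl⟩ : ∃ e, N = m + e + 1 := ⟨N - m - 1, by omega⟩
  set N := m + e + 1
  set τ := straighten ρ s ϖ e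
  have hτ : Function.Bijective τ := straighten_bijective (Pi.basisFun R ι) ρ s hϖ e
  -- the section only involves the coordinates selected by `J`, so straightening fixes the others
  have hτc : ∀ δ (c : {c : ι // c ∉ Set.range J}), τ δ c.1 = δ c.1 := by
    intro δ c
    simp only [τ, straighten, Pi.add_apply, Pi.smul_apply, hs0 _ c.1 c.2, smul_zero, add_zero]
  have hfib : ∀ δ, ρ (x + ϖ ^ N • δ) = ρ x ↔ QuadraticMap.polar ρ x (τ δ) = 0 := by
    intro δ
    rw [apply_add_smul_eq ρ s ϖ m e x hs]
    simp [τ, hϖ.ne_zero]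
  have hne : ((jacobian ρ x).submatrix id J).det ≠ 0 := fun h0 => hJ (by
    rw [show minor ρ J x = ((jacobian ρ x).submatrix id J).det from rfl, h0]; exact dvd_zero _)
  have hker : ∀ k : ι → R, QuadraticMap.polar ρ x k = 0 → (∀ c ∉ Set.range J, k c = 0) → k = 0 := by
    intro k hk hk0
    rw [← jacobian_mulVec] at hk
    have h1 : ((jacobian ρ x).submatrix id J).mulVec (k ∘ J) = 0 := by
      rw [← hk]
      ext s
      simp only [Matrix.mulVec, dotProduct, Matrix.submatrix_apply, id, Function.comp_apply]
      rw [← Finset.sum_map Finset.univ J (fun t => jacobian ρ x s t * k t)]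
      refine Finset.sum_subset (Finset.subset_univ _) fun t _ ht => ?_
      rw [hk0 t (by simpa using ht), mul_zero]
    have h2 := Matrix.eq_zero_of_mulVec_eq_zero hne h1
    ext t
    by_cases ht : t ∈ Set.range J
    · obtain ⟨i, rfl⟩ := ht
      exact congrFun h2 i
    · exact hk0 t ht
  obtain ⟨ζ, hζ⟩ := mem_powSub.1 hz
  -- the kernel vector with complementary coordinates `ζ`
  let ζ' : ι → R := fun t => if h : t ∉ Set.range J then ζ ⟨t, h⟩ else 0
  obtain ⟨w, hw⟩ := exists_mulVec_submatrix_eq hϖ hx hJ ζ'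
  let k : ι → R := ζ' - ∑ i, w i • Pi.single (J i) 1
  have hkc : ∀ c : {c : ι // c ∉ Set.range J}, k c.1 = ζ c := by
    intro c
    simp only [k, ζ', Pi.sub_apply, Finset.sum_apply, dif_pos c.2]
    rw [Finset.sum_eq_zero, sub_zero]
    intro i _
    rw [Pi.smul_apply, Pi.single_eq_of_ne (fun h => c.2 ⟨i, h.symm⟩), smul_zero]
  have hk : QuadraticMap.polar ρ x k = 0 := by
    rw [← jacobian_mulVec, Matrix.mulVec_sub, ← hw, sub_eq_zero, Matrix.mulVec_sum]
    ext s
    rw [Finset.sum_apply]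
    refine Finset.sum_congr rfl fun i _ => ?_
    rw [Matrix.mulVec_smul]
    simp [mul_comm]
  obtain ⟨δ, hδ⟩ := hτ.2 k
  refine ⟨x + ϖ ^ N • δ, ⟨(hfib δ).2 (hδ ▸ hk), ?_, fun c => ?_⟩, ?_⟩
  · rw [add_sub_cancel_left]; exact pow_smul_mem_powSub _ _ _
  · have hδc : δ c.1 = ζ c := by rw [← hτc δ c, hδ, hkc]
    rw [Pi.add_apply, Pi.smul_apply, hδc]
    have := congrFun hζ c
    simp only [Pi.smul_apply] at this
    rw [this]; ring
  · rintro y ⟨hy1, hy2, hy3⟩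
    obtain ⟨δ', hδ'⟩ := mem_powSub.1 hy2
    have hy : y = x + ϖ ^ N • δ' := by rw [hδ']; abel
    subst hy
    rw [hfib] at hy1
    have hc : ∀ c : {c : ι // c ∉ Set.range J}, δ' c.1 = ζ c := by
      intro c
      have h1 := congrFun hζ c
      rw [← hy3 c] at h1
      simp only [Pi.add_apply, Pi.smul_apply, smul_eq_mul, add_sub_cancel_left] at h1
      exact (mul_left_cancel₀ (pow_ne_zero _ hϖ.ne_zero) h1).symm
    have : τ δ' - k = 0 := by
      refine hker _ (by rw [QuadraticMap.polar_sub_right, hy1, hk, sub_zero]) fun c hc' => ?_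
      rw [Pi.sub_apply, hτc δ' ⟨c, hc'⟩, hkc ⟨c, hc'⟩, hc, sub_self]
    rw [hτ.1 ((sub_eq_zero.1 this).trans hδ.symm)]

end Level

/-! ### Normalized absolute values and Haar measure -/

section NormAbs

variable {R : Type*} [CommRing R] [IsDomain R] [IsDiscreteValuationRing R]

theorem normAbs_of_associated {ϖ : R} (hϖ : Irreducible ϖ) {a : R} {m : ℕ}
    (h : Associated a (ϖ ^ m)) : normAbs a = (Nat.card (ResidueField R) : ℝ≥0∞)⁻¹ ^ m := by
  have ha : a ≠ 0 := fun h0 => by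
    rw [h0, Associated.comm, associated_zero_iff_eq_zero] at h
    exact pow_ne_zero m hϖ.ne_zero h
  rw [normAbs, if_neg ha, (IsDiscreteValuationRing.addVal_eq_iff_associated _ _).2 h,
    hϖ.addVal_pow]
  rfl

theorem normAbs_le_iff_dvd [Finite (ResidueField R)] {a b : R} :
    normAbs a ≤ normAbs b ↔ b ∣ a := by
  have hf : 1 < Nat.card (ResidueField R) := Finite.one_lt_card
  have hf0 : (Nat.card (ResidueField R) : ℝ≥0∞)⁻¹ ≠ 0 := ENNReal.inv_ne_zero.2 (ENNReal.natCast_ne_top _)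
  obtain ⟨ϖ, hϖ⟩ := IsDiscreteValuationRing.exists_irreducible R
  by_cases ha : a = 0
  · subst ha; simp [normAbs]
  obtain ⟨i, hi⟩ := IsDiscreteValuationRing.associated_pow_irreducible ha hϖ
  rw [normAbs_of_associated hϖ hi]
  by_cases hb : b = 0
  · subst hb
    simp only [normAbs, if_true, nonpos_iff_eq_zero, zero_dvd_iff, ha, iff_false]
    exact pow_ne_zero _ hf0
  obtain ⟨j, hj⟩ := IsDiscreteValuationRing.associated_pow_irreducible hb hϖ
  rw [normAbs_of_associated hϖ hj, hi.dvd_iff_dvd_right, hj.dvd_iff_dvd_left,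
    pow_dvd_pow_iff hϖ.ne_zero hϖ.not_isUnit, ← ENNReal.inv_pow, ← ENNReal.inv_pow,
    ENNReal.inv_le_inv]
  norm_cast
  exact Nat.pow_le_pow_iff_right hf

end NormAbs

section Haar

variable {R : Type*} [CommRing R] [IsDomain R] [IsDiscreteValuationRing R]
  [Finite (ResidueField R)] [TopologicalSpace R] [IsTopologicalRing R] [CompactSpace R] [T2Space R]
  {κ : Type*} [Fintype κ]

theorem isOpen_powSub {ϖ : R} (hϖ : Irreducible ϖ) (N : ℕ) :
    IsOpen (powSub (κ → R) ϖ N : Set (κ → R)) := by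
  have hc : IsClosed (powSub (κ → R) ϖ N : Set (κ → R)) := by
    have : (powSub (κ → R) ϖ N : Set (κ → R)) =
        ⋂ i, (fun x : κ → R => x i) ⁻¹' (Ideal.span {ϖ ^ N} : Ideal R) := by
      ext x
      simp [mem_powSub_pi, Ideal.mem_span_singleton]
    rw [this]
    exact isClosed_iInter fun i =>
      (IsNoetherianRing.isClosed_ideal (Ideal.span {ϖ ^ N})).preimage (continuous_apply i)
  have : (powSub (κ → R) ϖ N).toAddSubgroup.FiniteIndex := by
    have : Finite ((κ → R) ⧸ (powSub (κ → R) ϖ N).toAddSubgroup) :=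
      finite_quotient_powSub (Pi.basisFun R κ) hϖ N
    exact AddSubgroup.finiteIndex_of_finite_quotient
  exact AddSubgroup.isOpen_of_isClosed_of_finiteIndex (powSub (κ → R) ϖ N).toAddSubgroup hc

theorem isOpen_of_saturated {ϖ : R} (hϖ : Irreducible ϖ) {N : ℕ} {T : Set (κ → R)}
    (h : ∀ x y, x ∈ T → x - y ∈ powSub (κ → R) ϖ N → y ∈ T) : IsOpen T := by
  rw [isOpen_iff_forall_mem_open]
  intro x hx
  refine ⟨(fun y => x - y) ⁻¹' (powSub (κ → R) ϖ N), fun y hy => h x y hx hy, ?_, by simp⟩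
  exact (isOpen_powSub hϖ N).preimage (by fun_prop)

theorem isClosed_of_saturated {ϖ : R} (hϖ : Irreducible ϖ) {N : ℕ} {T : Set (κ → R)}
    (h : ∀ x y, x ∈ T → x - y ∈ powSub (κ → R) ϖ N → y ∈ T) : IsClosed T := by
  rw [← isOpen_compl_iff]
  refine isOpen_of_saturated (N := N) hϖ fun x y hx hxy hy => hx (h y x hy ?_)
  rw [← neg_sub]
  exact neg_mem hxy

theorem haarProb_coset {ϖ : R} (hϖ : Irreducible ϖ) (N : ℕ) (v : κ → R) :
    haarProb (κ → R) {y | y - v ∈ powSub (κ → R) ϖ N} =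
      (Nat.card (ResidueField R) : ℝ≥0∞)⁻¹ ^ (N * Fintype.card κ) := by
  let : MeasurableSpace (κ → R) := borel _
  have : BorelSpace (κ → R) := ⟨rfl⟩
  have hfi : (powSub (κ → R) ϖ N).toAddSubgroup.FiniteIndex := by
    have : Finite ((κ → R) ⧸ (powSub (κ → R) ϖ N).toAddSubgroup) :=
      finite_quotient_powSub (Pi.basisFun R κ) hϖ N
    exact AddSubgroup.finiteIndex_of_finite_quotient
  have hopen := isOpen_powSub (κ := κ) hϖ N
  have huniv : haarProb (κ → R) Set.univ = 1 := by
    have := Measure.addHaarMeasure_self (G := κ → R) (K₀ := ⊤)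
    simpa [haarProb] using this
  have : (haarProb (κ → R)).IsAddHaarMeasure := by
    unfold haarProb; infer_instance
  have h1 := AddSubgroup.index_mul_measure (powSub (κ → R) ϖ N).toAddSubgroup
    hopen.measurableSet (haarProb (κ → R))
  have h2 : (powSub (κ → R) ϖ N).toAddSubgroup.index = _ :=
    card_quotient_powSub (Pi.basisFun R κ) hϖ N
  have h3 : {y | y - v ∈ powSub (κ → R) ϖ N} = (fun y => y + (-v)) ⁻¹' (powSub (κ → R) ϖ N) := by
    ext y; simp [sub_eq_add_neg]
  rw [h3, measure_preimage_add_right]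
  have hf0 : (Nat.card (ResidueField R) : ℝ≥0∞) ≠ 0 := by exact_mod_cast Nat.card_pos.ne'
  rw [huniv, h2] at h1
  rw [← ENNReal.inv_pow]
  push_cast at h1
  exact ENNReal.eq_inv_of_mul_eq_one_left (by rw [mul_comm]; exact h1)

end Haar

/-! ### The gauge volume of a fibre as a limit of numbers of solutions of congruences -/

section FibreVolume

variable {R : Type*} [CommRing R] [IsDomain R] [IsDiscreteValuationRing R]
  {ι σ : Type*} [Fintype ι] [DecidableEq ι] [Fintype σ] [DecidableEq σ]

/-- The minor selected by `J` is of maximal absolute value at `x`. -/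
def IsLargestMinor (ρ : QuadraticMap R (ι → R) (σ → R)) (J : σ ↪ ι) (x : ι → R) : Prop :=
  ∀ J' : σ ↪ ι, normAbs (minor ρ J' x) ≤ normAbs (minor ρ J x)

open Classical in
/-- The density of the gauge measure in the chart belonging to `J`, weighted by the partition of
unity over the minors of maximal absolute value. -/
noncomputable def chartDensity (ρ : QuadraticMap R (ι → R) (σ → R)) (J : σ ↪ ι) (x : ι → R) : ℝ≥0∞ :=
  (if IsLargestMinor ρ J x then (Nat.card {J' : σ ↪ ι // IsLargestMinor ρ J' x} : ℝ≥0∞)⁻¹ else 0) *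
    (normAbs (minor ρ J x))⁻¹

variable [Finite (ResidueField R)] {ρ : QuadraticMap R (ι → R) (σ → R)} {ϖ : R}

omit [Fintype ι] in
theorem isLargestMinor_iff (hϖ : Irreducible ϖ) {m : ℕ} {x : ι → R} (hx : HasLevel ρ ϖ x m)
    (J : σ ↪ ι) : IsLargestMinor ρ J x ↔ ¬ ϖ ^ (m + 1) ∣ minor ρ J x := by
  constructor
  · intro h hJ
    obtain ⟨J', hJ'⟩ := hx.2
    exact hJ' (hJ.trans (normAbs_le_iff_dvd.1 (h J')))
  · intro h J'
    rw [normAbs_le_iff_dvd]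
    exact (associated_pow_of_dvd hϖ (hx.1 J) h).dvd.trans (hx.1 J')

omit [Fintype ι] in
theorem chartDensity_of_not (hϖ : Irreducible ϖ) {m : ℕ} {x : ι → R} (hx : HasLevel ρ ϖ x m)
    {J : σ ↪ ι} (h : ϖ ^ (m + 1) ∣ minor ρ J x) : chartDensity ρ J x = 0 := by
  rw [chartDensity, if_neg (fun h' => (isLargestMinor_iff hϖ hx J).1 h' h), zero_mul]

omit [Fintype ι] in
theorem chartDensity_of (hϖ : Irreducible ϖ) {m : ℕ} {x : ι → R} (hx : HasLevel ρ ϖ x m)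
    {J : σ ↪ ι} (h : ¬ ϖ ^ (m + 1) ∣ minor ρ J x) : chartDensity ρ J x =
      (Nat.card {J' : σ ↪ ι // ¬ ϖ ^ (m + 1) ∣ minor ρ J' x} : ℝ≥0∞)⁻¹ *
        (Nat.card (ResidueField R) : ℝ≥0∞) ^ m := by
  rw [chartDensity, if_pos ((isLargestMinor_iff hϖ hx J).2 h),
    normAbs_of_associated hϖ (associated_pow_of_dvd hϖ (hx.1 J) h), ENNReal.inv_pow, inv_inv]
  simp_rw [isLargestMinor_iff hϖ hx]

omit [Fintype ι] in
/-- The chart densities are constant on balls of radius smaller than the absolute value of the largest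
minor. -/
theorem chartDensity_congr (hϖ : Irreducible ϖ) {m N : ℕ} {x y : ι → R} (hx : HasLevel ρ ϖ x m)
    (hm : m < N) (h : y - x ∈ powSub (ι → R) ϖ N) (J : σ ↪ ι) :
    chartDensity ρ J y = chartDensity ρ J x := by
  have hy := hx.congr hm h
  by_cases hJ : ϖ ^ (m + 1) ∣ minor ρ J x
  · rw [chartDensity_of_not hϖ hx hJ,
      chartDensity_of_not hϖ hy ((pow_dvd_minor_congr ρ hm J h).2 hJ)]
  · rw [chartDensity_of hϖ hx hJ,
      chartDensity_of hϖ hy (fun h' => hJ ((pow_dvd_minor_congr ρ hm J h).1 h'))]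
    simp_rw [pow_dvd_minor_congr ρ hm _ h]

/-- The weights of the partition of unity add up to `1`, so the chart densities at a point of level `m`
add up to `f ^ m`. -/
theorem sum_chartDensity (hϖ : Irreducible ϖ) {m : ℕ} {x : ι → R} (hx : HasLevel ρ ϖ x m) :
    ∑ J, chartDensity ρ J x = (Nat.card (ResidueField R) : ℝ≥0∞) ^ m := by
  classical
  have : ∀ J, chartDensity ρ J x = if ¬ ϖ ^ (m + 1) ∣ minor ρ J x then
      (Nat.card {J' : σ ↪ ι // ¬ ϖ ^ (m + 1) ∣ minor ρ J' x} : ℝ≥0∞)⁻¹ *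
        (Nat.card (ResidueField R) : ℝ≥0∞) ^ m else 0 := by
    intro J
    split_ifs with h
    · exact chartDensity_of_not hϖ hx h
    · exact chartDensity_of hϖ hx h
  simp_rw [this]
  rw [← Finset.sum_filter, Finset.sum_const, nsmul_eq_mul, ← Fintype.card_subtype,
    ← Nat.card_eq_fintype_card, ← mul_assoc, ENNReal.mul_inv_cancel, one_mul]
  · obtain ⟨J, hJ⟩ := hx.2
    have : Nonempty {J' : σ ↪ ι // ¬ ϖ ^ (m + 1) ∣ minor ρ J' x} := ⟨⟨J, hJ⟩⟩
    exact_mod_cast Nat.card_pos.ne'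
  · exact ENNReal.natCast_ne_top _

variable [TopologicalSpace R] [IsTopologicalRing R] [CompactSpace R]

omit [Finite (ResidueField R)] in
variable (ρ) in
/-- The volume of a set of points of a fibre of `ρ` with respect to the quotient of the standard
volume forms, computed in charts. -/
noncomputable def fibreVolume (A : Set (ι → R)) : ℝ≥0∞ :=
  ∑ J : σ ↪ ι, ∫⁻ y : ({c : ι // c ∉ Set.range J} → R),
    (∑' x : {x : ι → R // x ∈ A ∧ ∀ c, x c.1 = y c}, chartDensity ρ J x.1)
      ∂(haarProb ({c : ι // c ∉ Set.range J} → R))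

variable [T2Space R] [IsAdicComplete (maximalIdeal R) R]

omit [TopologicalSpace R] [IsTopologicalRing R] [CompactSpace R] [T2Space R] in
/-- The contribution of a ball to the volume of a fibre, in one chart: the ball contains exactly one
point of the fibre for each admissible value of the complementary coordinates. -/
theorem tsum_ball (hϖ : Irreducible ϖ) {m N : ℕ} (hmN : m < N) {x : ι → R}
    (hx : HasLevel ρ ϖ x m) (J : σ ↪ ι) (y : {c : ι // c ∉ Set.range J} → R) :
    ∑' z : ι → R, Set.indicator {z | ρ z = ρ x ∧ z - x ∈ powSub (ι → R) ϖ N ∧ ∀ c, z c.1 = y c}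
        (chartDensity ρ J) z =
      Set.indicator {y | y - (fun c => x c.1) ∈ powSub ({c : ι // c ∉ Set.range J} → R) ϖ N}
        (fun _ => chartDensity ρ J x) y := by
  by_cases hJ : ϖ ^ (m + 1) ∣ minor ρ J x
  · rw [chartDensity_of_not hϖ hx hJ]
    simp only [Set.indicator_zero]
    rw [ENNReal.tsum_eq_zero]
    intro z
    by_cases hz : z ∈ {z | ρ z = ρ x ∧ z - x ∈ powSub (ι → R) ϖ N ∧ ∀ c, z c.1 = y c}
    swap
    · exact Set.indicator_of_notMem hz _
    rw [Set.indicator_of_mem hz, chartDensity_congr hϖ hx hmN hz.2.1, chartDensity_of_not hϖ hx hJ]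
  by_cases hy : y - (fun c => x c.1) ∈ powSub ({c : ι // c ∉ Set.range J} → R) ϖ N
  · obtain ⟨z, hz, huniq⟩ := existsUnique_mem_fibre hϖ hmN hx hJ y hy
    rw [Set.indicator_of_mem (by exact hy), tsum_eq_single z, Set.indicator_of_mem (by exact hz),
      chartDensity_congr hϖ hx hmN hz.2.1]
    intro z' hz'
    rw [Set.indicator_of_notMem]
    intro h
    exact hz' (huniq z' h)
  · rw [Set.indicator_of_notMem (by exact hy), ENNReal.tsum_eq_zero]
    intro z
    apply Set.indicator_of_notMem
    rintro ⟨-, h2, h3⟩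
    apply hy
    rw [mem_powSub_pi] at h2 ⊢
    intro c
    rw [Pi.sub_apply, ← h3 c]
    exact h2 c.1

end FibreVolume

section FibreVolume

variable {R : Type*} [CommRing R] [IsDomain R] [IsDiscreteValuationRing R]
  [Finite (ResidueField R)] [TopologicalSpace R] [IsTopologicalRing R] [CompactSpace R]
  [T2Space R] {ϖ : R}

/-- Approximate points of a fibre are close to points of the fibre, by compactness. -/
theorem exists_forall_near_fibre [IsAdicComplete (maximalIdeal R) R] {ι σ : Type*} [Fintype ι]
    [Fintype σ] (hϖ : Irreducible ϖ) (ρ : QuadraticMap R (ι → R) (σ → R)) (q : σ → R) (N : ℕ) :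
    ∃ M₀, ∀ M, M₀ ≤ M → ∀ x, ρ x - q ∈ powSub (σ → R) ϖ M →
      ∃ x₀, ρ x₀ = q ∧ x - x₀ ∈ powSub (ι → R) ϖ N := by
  by_contra hcon
  push Not at hcon
  let C : ℕ → Set (ι → R) := fun M => {x | ρ x - q ∈ powSub (σ → R) ϖ M ∧
    ∀ x₀, ρ x₀ = q → x - x₀ ∉ powSub (ι → R) ϖ N}
  have hne : ∀ M, (C M).Nonempty := by
    intro M
    obtain ⟨M', hM', x, hx, hx'⟩ := hcon M
    exact ⟨x, powSub_anti ϖ hM' hx, hx'⟩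
  have hsat : ∀ M, ∀ x y, x ∈ C M → x - y ∈ powSub (ι → R) ϖ (max M N) → y ∈ C M := by
    rintro M x y ⟨h1, h2⟩ hxy
    have hM := powSub_anti ϖ (le_max_left M N) hxy
    have hN := powSub_anti ϖ (le_max_right M N) hxy
    constructor
    · have h3 : ρ x - ρ y ∈ powSub (σ → R) ϖ M := by
        obtain ⟨z, hz⟩ := mem_powSub.1 hM
        rw [quadraticMap_sub_eq, ← hz]
        refine mem_powSub.2 ⟨QuadraticMap.polar ρ y z + ϖ ^ M • ρ z, ?_⟩
        rw [QuadraticMap.polar_smul_right, QuadraticMap.map_smul, smul_add, smul_smul]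
      have := sub_mem h1 h3
      rwa [sub_sub_sub_cancel_left] at this
    · intro x₀ hx₀ hy
      refine h2 x₀ hx₀ ?_
      rw [← sub_add_sub_cancel x y x₀]
      exact add_mem hN hy
  have hcl : ∀ M, IsClosed (C M) := fun M => isClosed_of_saturated hϖ (hsat M)
  obtain ⟨x, hx⟩ := IsCompact.nonempty_iInter_of_sequence_nonempty_isCompact_isClosed C
    (fun M x hx => ⟨powSub_anti ϖ M.le_succ hx.1, hx.2⟩) hne (hcl 0).isCompact hcl
  rw [Set.mem_iInter] at hx
  have h0 : ρ x - q = 0 := eq_zero_of_forall_mem_powSub (Pi.basisFun R σ) hϖ fun j => (hx j).1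
  exact (hx 0).2 x (sub_eq_zero.1 h0) (by simp)

variable {ι σ : Type*} [Fintype ι] [DecidableEq ι] [Fintype σ] [DecidableEq σ]

/-- The volume of a fibre is computed by covering it by balls of radius `ϖ ^ N`: a ball around a point
of level `m` contributes `f ^ m` times the volume `f ^ (-N * (dim - codim))` of a ball in the
complementary coordinates. -/
theorem fibreVolume_eq_sum [IsAdicComplete (maximalIdeal R) R] (hϖ : Irreducible ϖ)
    (ρ : QuadraticMap R (ι → R) (σ → R)) (q : σ → R) (N : ℕ)
    {β : Type*} (s : Finset β) (x : β → (ι → R)) (m : β → ℕ)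
    (hxq : ∀ B ∈ s, ρ (x B) = q) (hm : ∀ B ∈ s, m B < N)
    (hlevel : ∀ B ∈ s, HasLevel ρ ϖ (x B) (m B))
    (hcover : ∀ z, ρ z = q → ∃! B, B ∈ s ∧ z - x B ∈ powSub (ι → R) ϖ N) :
    fibreVolume ρ {z | ρ z = q} = ∑ B ∈ s, (Nat.card (ResidueField R) : ℝ≥0∞) ^ m B *
      (Nat.card (ResidueField R) : ℝ≥0∞)⁻¹ ^ (N * (Fintype.card ι - Fintype.card σ)) := by
  classical
  have hJ : ∀ J : σ ↪ ι, ∀ y : {c : ι // c ∉ Set.range J} → R,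
      ∑' z : {z : ι → R // z ∈ {z | ρ z = q} ∧ ∀ c, z c.1 = y c}, chartDensity ρ J z.1 =
      ∑ B ∈ s, Set.indicator {y | y - (fun c => x B c.1) ∈
        powSub ({c : ι // c ∉ Set.range J} → R) ϖ N} (fun _ => chartDensity ρ J (x B)) y := by
    intro J y
    have h1 := tsum_subtype {z : ι → R | z ∈ {z | ρ z = q} ∧ ∀ c : {c : ι // c ∉ Set.range J},
      z c.1 = y c} (chartDensity ρ J)
    refine h1.trans ?_
    rw [Finset.sum_congr rfl fun B hB => (tsum_ball hϖ (hm B hB) (hlevel B hB) J y).symm,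
      ← Summable.tsum_finsetSum fun _ _ => ENNReal.summable]
    refine tsum_congr fun z => ?_
    by_cases hz : z ∈ {z : ι → R | z ∈ {z | ρ z = q} ∧ ∀ c : {c : ι // c ∉ Set.range J}, z c.1 = y c}
    · rw [Set.indicator_of_mem hz]
      obtain ⟨B, ⟨hB, hzB⟩, huniq⟩ := hcover z hz.1
      rw [Finset.sum_eq_single_of_mem B hB, Set.indicator_of_mem]
      · exact ⟨(hz.1 : ρ z = q).trans (hxq B hB).symm, hzB, hz.2⟩
      · intro B' hB' hne
        rw [Set.indicator_of_notMem]
        intro h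
        exact hne (huniq B' ⟨hB', h.2.1⟩)
    · rw [Set.indicator_of_notMem hz]
      symm
      refine Finset.sum_eq_zero fun B hB => ?_
      rw [Set.indicator_of_notMem]
      intro h
      exact hz ⟨h.1.trans (hxq B hB), h.2.2⟩
  unfold fibreVolume
  have hint : ∀ J : σ ↪ ι, ∫⁻ y : ({c : ι // c ∉ Set.range J} → R),
      (∑' z : {z : ι → R // z ∈ {z | ρ z = q} ∧ ∀ c, z c.1 = y c}, chartDensity ρ J z.1)
        ∂(haarProb ({c : ι // c ∉ Set.range J} → R)) = ∑ B ∈ s, chartDensity ρ J (x B) *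
      (Nat.card (ResidueField R) : ℝ≥0∞)⁻¹ ^ (N * (Fintype.card ι - Fintype.card σ)) := by
    intro J
    simp_rw [hJ]
    have hmeas : ∀ B, @MeasurableSet _ (borel _) {y : {c : ι // c ∉ Set.range J} → R |
        y - (fun c => x B c.1) ∈ powSub ({c : ι // c ∉ Set.range J} → R) ϖ N} := by
      intro B
      let : MeasurableSpace ({c : ι // c ∉ Set.range J} → R) := borel _
      have : BorelSpace ({c : ι // c ∉ Set.range J} → R) := ⟨rfl⟩
      exact ((isOpen_powSub hϖ N).preimage (by fun_prop)).measurableSet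
    rw [lintegral_finsetSum _ fun B _ => (@measurable_const _ _ _ (borel _) _).indicator (hmeas B)]
    refine Finset.sum_congr rfl fun B _ => ?_
    rw [lintegral_indicator (hmeas B), setLIntegral_const, haarProb_coset hϖ]
    congr 3
    rw [Fintype.card_subtype_compl]
    congr 1
    exact (Set.card_range_of_injective J.injective)
  rw [Finset.sum_congr rfl fun J _ => hint J, Finset.sum_comm]
  refine Finset.sum_congr rfl fun B hB => ?_
  rw [← Finset.sum_mul, sum_chartDensity hϖ (hlevel B hB)]

/-- If the differential of `ρ` has sections, up to a constant factor, along a fibre, then the volume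
of the fibre is a normalized number of solutions of congruences. -/
theorem fibreVolume_eq_cardMod [IsAdicComplete (maximalIdeal R) R] (hϖ : Irreducible ϖ)
    (ρ : QuadraticMap R (ι → R) (σ → R)) (q : σ → R) (c : ℕ)
    (hsec : ∀ x, ρ x = q → ∃ s : (σ → R) →ₗ[R] (ι → R),
      ∀ g, QuadraticMap.polar ρ x (s g) = ϖ ^ c • g) :
    ∃ M₀, ∀ M, M₀ ≤ M → fibreVolume ρ {x | ρ x = q} *
        (Nat.card (ResidueField R) : ℝ≥0∞) ^ (M * Fintype.card ι) =
      (Nat.card (ResidueField R) : ℝ≥0∞) ^ (M * Fintype.card σ) *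
        cardMod (powSub (ι → R) ϖ M) {x | ρ x - q ∈ powSub (σ → R) ϖ M} := by
  classical
  -- balls of this radius are smaller than all the largest minors along the fibre
  set N := c * Fintype.card σ + 1 with hN
  have hlevel : ∀ x, ρ x = q → ∃ m < N, HasLevel ρ ϖ x m := by
    intro x hx
    obtain ⟨s, hs⟩ := hsec x hx
    obtain ⟨m, hm, h⟩ := exists_hasLevel ρ hϖ s hs
    exact ⟨m, by omega, h⟩
  obtain ⟨M₁, hM₁⟩ := exists_forall_near_fibre hϖ ρ q N
  have hfin : Finite ((ι → R) ⧸ powSub (ι → R) ϖ N) := finite_quotient_powSub (Pi.basisFun R ι) hϖ N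
  let s : Finset ((ι → R) ⧸ powSub (ι → R) ϖ N) :=
    (Set.toFinite (Submodule.Quotient.mk '' {x | ρ x = q})).toFinset
  have hs : ∀ B, B ∈ s ↔ ∃ x, ρ x = q ∧ Submodule.Quotient.mk x = B := by
    intro B; simp [s]
  choose! x hx using fun B hB => (hs B).1 hB
  choose! m hm using fun B (hB : B ∈ s) => hlevel (x B) (hx B hB).1
  have hcover' : ∀ z z₀, ρ z₀ = q → z - z₀ ∈ powSub (ι → R) ϖ N →
      ∃! B, B ∈ s ∧ z - x B ∈ powSub (ι → R) ϖ N := by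
    intro z z₀ hz₀ hz
    have hB : (Submodule.Quotient.mk z : (ι → R) ⧸ powSub (ι → R) ϖ N) ∈ s :=
      (hs _).2 ⟨z₀, hz₀, ((Submodule.Quotient.eq _).2 hz).symm⟩
    refine ⟨Submodule.Quotient.mk z, ⟨hB, (Submodule.Quotient.eq _).1 (hx _ hB).2.symm⟩, ?_⟩
    rintro B ⟨hB', hzB⟩
    rw [← (hx B hB').2, eq_comm, Submodule.Quotient.eq]
    exact hzB
  have hvol := fibreVolume_eq_sum hϖ ρ q N s x m (fun B hB => (hx B hB).1)
    (fun B hB => (hm B hB).1) (fun B hB => (hm B hB).2)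
    (fun z hz => hcover' z z hz (by simp))
  refine ⟨max M₁ (2 * N), fun M hM => ?_⟩
  have hMM := hM₁ M ((le_max_left _ _).trans hM)
  obtain ⟨l, hl⟩ : ∃ l, M = N + l := ⟨M - N, by have := (le_max_right M₁ (2 * N)).trans hM; omega⟩
  have hNl : N ≤ l := by have := (le_max_right M₁ (2 * N)).trans hM; omega
  have : Finite ((ι → R) ⧸ powSub (ι → R) ϖ M) := finite_quotient_powSub (Pi.basisFun R ι) hϖ M
  have hcount := cardMod_iUnion (powSub (ι → R) ϖ M) s
    (fun B => {z | ρ z - ρ (x B) ∈ powSub (σ → R) ϖ M ∧ z - x B ∈ powSub (ι → R) ϖ N})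
    (by
      rintro B hB z y ⟨h1, h2⟩ hzy
      constructor
      · have h3 : ρ z - ρ y ∈ powSub (σ → R) ϖ M := by
          obtain ⟨w, hw⟩ := mem_powSub.1 hzy
          rw [quadraticMap_sub_eq, ← hw]
          refine mem_powSub.2 ⟨QuadraticMap.polar ρ y w + ϖ ^ M • ρ w, ?_⟩
          rw [QuadraticMap.polar_smul_right, QuadraticMap.map_smul, smul_add, smul_smul]
        have := sub_mem h1 h3
        rwa [sub_sub_sub_cancel_left] at this
      · have := sub_mem h2 (powSub_anti ϖ (show N ≤ M by omega) hzy)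
        rwa [sub_sub_sub_cancel_left] at this)
    (by
      rintro B hB B' hB' z ⟨-, hz⟩ ⟨-, hz'⟩
      obtain ⟨C, -, hC⟩ := hcover' z (x B) (hx B hB).1 hz
      rw [hC B ⟨hB, hz⟩, hC B' ⟨hB', hz'⟩])
  have hT : {z | ∃ B ∈ s, z ∈ {z | ρ z - ρ (x B) ∈ powSub (σ → R) ϖ M ∧
      z - x B ∈ powSub (ι → R) ϖ N}} = {z | ρ z - q ∈ powSub (σ → R) ϖ M} := by
    ext z
    constructor
    · rintro ⟨B, hB, hz, -⟩
      rwa [(hx B hB).1] at hz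
    · intro hz
      obtain ⟨z₀, hz₀, hzz⟩ := hMM z hz
      obtain ⟨B, ⟨hB, hzB⟩, -⟩ := hcover' z z₀ hz₀ hzz
      refine ⟨B, hB, ?_, hzB⟩
      rw [(hx B hB).1]
      exact hz
  rw [hT] at hcount
  rw [hvol, hcount]
  push_cast
  rw [Finset.sum_mul, Finset.mul_sum]
  refine Finset.sum_congr rfl fun B hB => ?_
  -- both sides of the identity are sums over the same balls, and agree on each of them
  obtain ⟨J, hJ⟩ := (hm B hB).2.2
  have hcard : Fintype.card σ ≤ Fintype.card ι := Fintype.card_le_of_embedding J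
  obtain ⟨sec, hsec', -⟩ := exists_section_of_minor hϖ (hm B hB).2 hJ
  obtain ⟨e, he⟩ : ∃ e, N = m B + e + 1 := ⟨N - m B - 1, by have := (hm B hB).1; omega⟩
  have hball := cardMod_ball (Pi.basisFun R ι) (Pi.basisFun R σ) ρ sec hϖ (m B) e l (m B) (x B)
    (by omega) hsec' (card_quotient_range_polarBilin hϖ (hm B hB).2)
  rw [← he, ← hl] at hball
  have hf0 : (Nat.card (ResidueField R) : ℝ≥0∞) ≠ 0 := by exact_mod_cast Nat.card_pos.ne'
  have hft : (Nat.card (ResidueField R) : ℝ≥0∞) ≠ ∞ := ENNReal.natCast_ne_top _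
  have hball' : (cardMod (powSub (ι → R) ϖ M) {z | ρ z - ρ (x B) ∈ powSub (σ → R) ϖ M ∧
      z - x B ∈ powSub (ι → R) ϖ N} : ℝ≥0∞) *
      (Nat.card (ResidueField R) : ℝ≥0∞) ^ (l * Fintype.card σ) =
      (Nat.card (ResidueField R) : ℝ≥0∞) ^ (l * Fintype.card ι) *
      (Nat.card (ResidueField R) : ℝ≥0∞) ^ m B := by exact_mod_cast hball
  generalize (cardMod (powSub (ι → R) ϖ M) {z | ρ z - ρ (x B) ∈ powSub (σ → R) ϖ M ∧
      z - x B ∈ powSub (ι → R) ϖ N} : ℝ≥0∞) = K at hball' ⊢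
  generalize (Nat.card (ResidueField R) : ℝ≥0∞) = f at *
  obtain ⟨d, hd⟩ : ∃ d, Fintype.card ι = Fintype.card σ + d := ⟨_, (Nat.add_sub_cancel' hcard).symm⟩
  rw [hd, Nat.add_sub_cancel_left]
  rw [hd] at hball'
  have hinv : f⁻¹ ^ (N * d) * f ^ (N * d) = 1 := by
    rw [← mul_pow, ENNReal.inv_mul_cancel hf0 hft, one_pow]
  calc f ^ m B * f⁻¹ ^ (N * d) * f ^ (M * (Fintype.card σ + d))
      = (f⁻¹ ^ (N * d) * f ^ (N * d)) * (f ^ (l * (Fintype.card σ + d)) * f ^ m B) *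
          f ^ (N * Fintype.card σ) := by rw [hl]; ring
    _ = f ^ (M * Fintype.card σ) * K := by rw [hinv, ← hball', hl]; ring

end FibreVolume

/-! ### The local density as a limit of numbers of solutions of congruences -/

section Coordinates

variable {R : Type*} [CommRing R] {L : Type*} [AddCommGroup L] [Module R L] {n k : ℕ}

variable (R L k) in
/-- The quadratic map `φ ↦ q_k ∘ φ` from linear maps `L → H_k` to quadratic forms on `L`. -/
def pullbackMap : QuadraticMap R (L →ₗ[R] (Fin k ⊕ Fin k → R)) (QuadraticForm R L) where
  toFun φ := (hyperbolicForm R k).comp φ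
  toFun_smul a φ := by
    ext x
    simp [QuadraticMap.map_smul]
  exists_companion' := by
    refine ⟨LinearMap.mk₂ R
      (fun φ ψ => LinearMap.BilinMap.toQuadraticMap
        ((hyperbolicForm R k).polarBilin.compl₁₂ φ ψ)) ?_ ?_ ?_ ?_, ?_⟩
    · intro φ φ' ψ; ext x; simp
    · intro a φ ψ; ext x; simp
    · intro φ ψ ψ'; ext x; simp [QuadraticMap.polar_add_right]
    · intro a φ ψ; ext x; simp
    · intro φ ψ
      ext x
      simp only [QuadraticMap.comp_apply, LinearMap.add_apply, add_apply,
        LinearMap.mk₂_apply, LinearMap.BilinMap.toQuadraticMap_apply, LinearMap.compl₁₂_apply,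
        QuadraticMap.polarBilin_apply_apply]
      rw [QuadraticMap.map_add (hyperbolicForm R k)]

@[simp]
theorem pullbackMap_apply (φ : L →ₗ[R] (Fin k ⊕ Fin k → R)) (x : L) :
    pullbackMap R L k φ x = hyperbolicForm R k (φ x) := rfl

theorem polar_pullbackMap_apply (φ ψ : L →ₗ[R] (Fin k ⊕ Fin k → R)) (x : L) :
    QuadraticMap.polar (pullbackMap R L k) φ ψ x = diffRho φ ψ x := by
  simp [QuadraticMap.polar, diffRho]

theorem mem_isometrySet_iff (q : QuadraticForm R L) (φ : L →ₗ[R] (Fin k ⊕ Fin k → R)) :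
    φ ∈ isometrySet q k ↔ pullbackMap R L k φ = q := by
  rw [QuadraticMap.ext_iff]; rfl

/-- The coordinates of linear maps `L → H_k` belonging to a basis of `L`. -/
noncomputable def coordEquiv (b : Module.Basis (Fin n) R L) (k : ℕ) :
    (L →ₗ[R] (Fin k ⊕ Fin k → R)) ≃ₗ[R] (Coord n k → R) :=
  (b.constr R).symm ≪≫ₗ (LinearEquiv.curry R R (Fin n) (Fin k ⊕ Fin k)).symm

@[simp]
theorem coordEquiv_apply (b : Module.Basis (Fin n) R L) (φ : L →ₗ[R] (Fin k ⊕ Fin k → R))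
    (c : Coord n k) : coordEquiv b k φ c = mapCoord b φ c := by
  rfl

theorem coordEquiv_symm_single (b : Module.Basis (Fin n) R L) (c : Coord n k) :
    (coordEquiv b k).symm (Pi.single c 1) = elementaryMap b c := by
  rw [LinearEquiv.symm_apply_eq]
  ext d
  rw [coordEquiv_apply, mapCoord, elementaryMap, Module.Basis.constr_basis]
  obtain ⟨c1, c2⟩ := c
  obtain ⟨d1, d2⟩ := d
  by_cases h : d1 = c1
  · subst h
    by_cases h2 : d2 = c2
    · subst h2; simp
    · simp [h2]
  · simp [h]

/-- The coefficients of quadratic forms belonging to a basis of `L`, as a linear map. -/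
noncomputable def formCoeffHom (b : Module.Basis (Fin n) R L) : QuadraticForm R L →ₗ[R] (UpperPair n → R) where
  toFun g := formCoeff b g
  map_add' g h := by
    ext s
    simp only [formCoeff, Pi.add_apply]
    split_ifs
    · simp
    · rw [FunLike.coe_add, QuadraticMap.polar_add]
  map_smul' a g := by
    ext s
    simp only [formCoeff, Pi.smul_apply, RingHom.id_apply]
    split_ifs
    · simp
    · rw [FunLike.coe_smul, QuadraticMap.polar_smul]

theorem formCoeffHom_injective (b : Module.Basis (Fin n) R L) :
    Function.Injective (formCoeffHom b) := by
  intro g h hgh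
  have hc : ∀ s, formCoeff b g s = formCoeff b h s := congrFun hgh
  rw [← QuadraticMap.toQuadraticMap_toBilin g b, ← QuadraticMap.toQuadraticMap_toBilin h b]
  congr 1
  refine b.ext fun i => b.ext fun j => ?_
  rw [QuadraticMap.toBilin_apply, QuadraticMap.toBilin_apply]
  rcases lt_trichotomy i j with hij | hij | hij
  · simpa [formCoeff, hij.ne, hij] using hc ⟨(i, j), hij.le⟩
  · subst hij; simpa [formCoeff] using hc ⟨(i, i), le_rfl⟩
  · simp [hij.ne', hij.not_gt]

theorem formCoeffHom_linMulLin (b : Module.Basis (Fin n) R L) (s : UpperPair n) :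
    formCoeffHom b (QuadraticMap.linMulLin (b.coord s.1.1) (b.coord s.1.2)) = Pi.single s 1 := by
  obtain ⟨⟨i, j⟩, hij⟩ := s
  ext ⟨⟨i', j'⟩, hij'⟩
  simp only at hij hij'
  rw [Pi.single_apply]
  change formCoeff b _ _ = _
  simp only [formCoeff, QuadraticMap.polar, QuadraticMap.linMulLin_apply, Module.Basis.coord_apply,
    map_add, Module.Basis.repr_self, Finsupp.single_apply, Subtype.mk.injEq,
    Prod.mk.injEq]
  by_cases h1 : i' = j' <;> by_cases h2 : i' = i <;> by_cases h3 : j' = j <;>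
    by_cases h4 : i' = j <;> by_cases h5 : j' = i <;> (simp_all; try omega)

/-- The coefficients of quadratic forms belonging to a basis of `L`. -/
noncomputable def formEquiv (b : Module.Basis (Fin n) R L) :
    QuadraticForm R L ≃ₗ[R] (UpperPair n → R) :=
  LinearEquiv.ofBijective (formCoeffHom b) ⟨formCoeffHom_injective b, fun v =>
    ⟨∑ s : UpperPair n, v s • QuadraticMap.linMulLin (b.coord s.1.1) (b.coord s.1.2), by
      simp_rw [map_sum, map_smul, formCoeffHom_linMulLin]
      ext s
      simp [Finset.sum_apply, Pi.single_apply]⟩⟩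

@[simp]
theorem formEquiv_apply (b : Module.Basis (Fin n) R L) (g : QuadraticForm R L) :
    formEquiv b g = formCoeff b g := rfl

/-- The map `φ ↦ q_k ∘ φ` in coordinates. -/
noncomputable def pullbackCoord (b : Module.Basis (Fin n) R L) (k : ℕ) :
    QuadraticMap R (Coord n k → R) (UpperPair n → R) :=
  ((formEquiv b).toLinearMap.compQuadraticMap (pullbackMap R L k)).comp
    (coordEquiv b k).symm.toLinearMap

theorem pullbackCoord_coordEquiv (b : Module.Basis (Fin n) R L)
    (φ : L →ₗ[R] (Fin k ⊕ Fin k → R)) :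
    pullbackCoord b k (coordEquiv b k φ) = formEquiv b (pullbackMap R L k φ) := by
  simp [pullbackCoord]

theorem polar_pullbackCoord (b : Module.Basis (Fin n) R L) (φ ψ : L →ₗ[R] (Fin k ⊕ Fin k → R)) :
    QuadraticMap.polar (pullbackCoord b k) (coordEquiv b k φ) (coordEquiv b k ψ) =
      formEquiv b (QuadraticMap.polar (pullbackMap R L k) φ ψ) := by
  simp only [QuadraticMap.polar, ← map_add, pullbackCoord_coordEquiv, ← map_sub]

theorem minor_pullbackCoord (b : Module.Basis (Fin n) R L) (J : UpperPair n ↪ Coord n k)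
    (φ : L →ₗ[R] (Fin k ⊕ Fin k → R)) :
    minor (pullbackCoord b k) J (coordEquiv b k φ) = jacobianMinor b J φ := by
  unfold minor jacobianMinor
  congr 1
  ext s t
  simp only [jacobian, Matrix.submatrix_apply, id, Matrix.of_apply]
  rw [← (coordEquiv b k).apply_symm_apply (Pi.single (J t) 1), polar_pullbackCoord,
    coordEquiv_symm_single, formEquiv_apply]
  congr 1

theorem gaugeVolume_eq_fibreVolume [IsDomain R] [IsDiscreteValuationRing R] [TopologicalSpace R]
    [IsTopologicalRing R] [CompactSpace R] (b : Module.Basis (Fin n) R L)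
    (A : Set (L →ₗ[R] (Fin k ⊕ Fin k → R))) :
    gaugeVolume b k A = fibreVolume (pullbackCoord b k) (coordEquiv b k '' A) := by
  unfold gaugeVolume fibreVolume
  refine Finset.sum_congr rfl fun J _ => ?_
  congr 1
  ext y
  let e : {φ : L →ₗ[R] (Fin k ⊕ Fin k → R) // φ ∈ A ∧
      ∀ c : {c : Coord n k // c ∉ Set.range J}, mapCoord b φ c.1 = y c} ≃
      {x : Coord n k → R // x ∈ coordEquiv b k '' A ∧
        ∀ c : {c : Coord n k // c ∉ Set.range J}, x c.1 = y c} :=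
    (coordEquiv b k).toEquiv.subtypeEquiv fun φ => by simp
  refine Eq.trans ?_ (Equiv.tsum_eq e (fun x => chartDensity (pullbackCoord b k) J x.1))
  refine tsum_congr fun φ => ?_
  change _ = chartDensity (pullbackCoord b k) J (coordEquiv b k φ.1)
  have hmax : ∀ J', IsLargestMinor (pullbackCoord b k) J' (coordEquiv b k φ.1) ↔
      IsMaxMinor b J' φ.1 := fun J' => by
    simp only [IsLargestMinor, IsMaxMinor, minor_pullbackCoord]
  by_cases h : IsMaxMinor b J φ.1
  · rw [chartDensity, if_pos ((hmax J).2 h), chartWeight, if_pos h, minor_pullbackCoord,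
      Nat.card_congr (Equiv.subtypeEquivRight hmax)]
  · rw [chartDensity, if_neg (mt (hmax J).1 h), chartWeight, if_neg h, zero_mul, zero_mul]

/-- The classical description of local densities: for large `M`, `α(L, H_k)` is the number of solutions
modulo `ϖ ^ M` of `q_k ∘ φ ≡ q`, divided by `f ^ (M * (2 k n - n (n + 1) / 2))`. Moreover the
solutions of the congruences are close to isometries. -/
theorem localDensity_mul_eq [IsDomain R] [IsDiscreteValuationRing R] [Finite (ResidueField R)]
    [TopologicalSpace R] [IsTopologicalRing R] [CompactSpace R] [T2Space R]
    [IsAdicComplete (maximalIdeal R) R] [Module.Free R L] [Module.Finite R L]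
    {ϖ : R} (hϖ : Irreducible ϖ) (q : QuadraticForm R L) (k c : ℕ)
    (hsec : ∀ φ ∈ isometrySet q k, ∃ s : QuadraticForm R L →ₗ[R] (L →ₗ[R] (Fin k ⊕ Fin k → R)),
      ∀ g, QuadraticMap.polar (pullbackMap R L k) φ (s g) = ϖ ^ c • g) (N : ℕ) :
    ∃ M₀, ∀ M, M₀ ≤ M →
      (∀ φ, pullbackMap R L k φ - q ∈ powSub (QuadraticForm R L) ϖ M → ∃ φ₀ ∈ isometrySet q k,
        φ - φ₀ ∈ powSub (L →ₗ[R] (Fin k ⊕ Fin k → R)) ϖ N) ∧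
      localDensity q k * (Nat.card (ResidueField R) : ℝ≥0∞) ^
          (M * Fintype.card (Coord (Module.finrank R L) k)) =
        (Nat.card (ResidueField R) : ℝ≥0∞) ^ (M * Fintype.card (UpperPair (Module.finrank R L))) *
        cardMod (powSub (L →ₗ[R] (Fin k ⊕ Fin k → R)) ϖ M)
          {φ | pullbackMap R L k φ - q ∈ powSub (QuadraticForm R L) ϖ M} := by
  set b := Module.finBasis R L with hb
  set E := coordEquiv b k with hE
  set ρ := pullbackCoord b k with hρ
  have hX : E '' isometrySet q k = {x | ρ x = formEquiv b q} := by
    ext x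
    obtain ⟨φ, rfl⟩ := E.surjective x
    simp only [Set.mem_image, EmbeddingLike.apply_eq_iff_eq, exists_eq_right, Set.mem_ofPred_eq]
    rw [mem_isometrySet_iff, hρ, hE, pullbackCoord_coordEquiv, EmbeddingLike.apply_eq_iff_eq]
  have hpow : ∀ M φ, E φ ∈ powSub (Coord (Module.finrank R L) k → R) ϖ M ↔
      φ ∈ powSub (L →ₗ[R] (Fin k ⊕ Fin k → R)) ϖ M := fun M φ =>
    ⟨fun h => by simpa using map_mem_powSub E.symm.toLinearMap h,
      fun h => map_mem_powSub E.toLinearMap h⟩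
  have hpow' : ∀ M g, formEquiv b g ∈ powSub (UpperPair (Module.finrank R L) → R) ϖ M ↔
      g ∈ powSub (QuadraticForm R L) ϖ M := fun M g =>
    ⟨fun h => by
      have := map_mem_powSub (formEquiv b).symm.toLinearMap h
      rwa [LinearEquiv.coe_coe, LinearEquiv.symm_apply_apply] at this,
      fun h => map_mem_powSub (formEquiv b).toLinearMap h⟩
  have hT : ∀ M φ, ρ (E φ) - formEquiv b q ∈ powSub (UpperPair (Module.finrank R L) → R) ϖ M ↔
      pullbackMap R L k φ - q ∈ powSub (QuadraticForm R L) ϖ M := by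
    intro M φ
    rw [hρ, hE, pullbackCoord_coordEquiv, ← map_sub, hpow']
  obtain ⟨M₁, hM₁⟩ := exists_forall_near_fibre hϖ ρ (formEquiv b q) N
  obtain ⟨M₂, hM₂⟩ := fibreVolume_eq_cardMod hϖ ρ (formEquiv b q) c (by
    intro x hx
    obtain ⟨φ, rfl⟩ := E.surjective x
    have hφ : φ ∈ isometrySet q k := by
      rw [mem_isometrySet_iff, ← (formEquiv b).injective.eq_iff, ← pullbackCoord_coordEquiv]
      exact hx
    obtain ⟨s, hs⟩ := hsec φ hφ
    refine ⟨E.toLinearMap ∘ₗ s ∘ₗ (formEquiv b).symm.toLinearMap, fun g => ?_⟩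
    simp only [LinearMap.comp_apply, LinearEquiv.coe_coe]
    rw [hρ, hE, polar_pullbackCoord, hs, map_smul, LinearEquiv.apply_symm_apply])
  refine ⟨max M₁ M₂, fun M hM => ⟨fun φ hφ => ?_, ?_⟩⟩
  · obtain ⟨x₀, hx₀, hx⟩ := hM₁ M ((le_max_left _ _).trans hM) (E φ) ((hT M φ).2 hφ)
    obtain ⟨φ₀, hφ₀, rfl⟩ : x₀ ∈ E '' isometrySet q k := by rw [hX]; exact hx₀
    exact ⟨φ₀, hφ₀, by rwa [← map_sub, hpow] at hx⟩
  · have h := hM₂ M ((le_max_right _ _).trans hM)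
    rw [← hX, hE, hρ, ← gaugeVolume_eq_fibreVolume] at h
    refine h.trans ?_
    congr 2
    rw [← cardMod_bij (powSub (L →ₗ[R] (Fin k ⊕ Fin k → R)) ϖ M) _ E
      (fun φ ψ => by rw [← map_sub, hpow])]
    congr 1
    ext x
    obtain ⟨φ, rfl⟩ := E.surjective x
    simp only [Set.mem_image, EmbeddingLike.apply_eq_iff_eq, exists_eq_right, Set.mem_ofPred_eq]
    exact hT M φ

end Coordinates

/-! ### Primitive maps into `H_k` -/

/-- Counting residue classes modulo `P'` by fibring over the residue classes modulo `P`. -/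
theorem cardMod_eq_mul {R M : Type*} [CommRing R] [AddCommGroup M] [Module R M]
    {P' P : Submodule R M} (h : P' ≤ P) [Finite (M ⧸ P')] (T : Set M)
    (hsat : ∀ x y, x ∈ T → x - y ∈ P' → y ∈ T) (C : ℕ)
    (hC : ∀ x ∈ T, cardMod P' {y | y ∈ T ∧ y - x ∈ P} = C) :
    cardMod P' T = cardMod P T * C := by
  classical
  have : Finite (M ⧸ P) := Finite.of_surjective _ (Submodule.factor_surjective h)
  have : Fintype (M ⧸ P) := Fintype.ofFinite _
  have key := cardMod_iUnion P' ((Submodule.Quotient.mk (p := P) '' T).toFinset)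
    (fun a => {x | x ∈ T ∧ Submodule.Quotient.mk (p := P) x = a})
    (fun a _ x y hx hxy => ⟨hsat x y hx.1 hxy, by
      rw [← hx.2, eq_comm, Submodule.Quotient.eq]; exact h hxy⟩)
    (fun a _ a' _ x hx hx' => by rw [← hx.2, ← hx'.2])
  have hT : {x | ∃ a ∈ (Submodule.Quotient.mk (p := P) '' T).toFinset,
      x ∈ {x | x ∈ T ∧ Submodule.Quotient.mk (p := P) x = a}} = T := by
    ext x
    simp only [Set.mem_toFinset, Set.mem_image, Set.mem_ofPred_eq]
    constructor
    · rintro ⟨_, _, h, _⟩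
      exact h
    · intro hx
      exact ⟨_, ⟨x, hx, rfl⟩, hx, rfl⟩
  rw [hT] at key
  rw [key, Finset.sum_const_nat (m := C)]
  · rw [cardMod, Set.ncard_eq_toFinset_card']
  · intro a ha
    obtain ⟨x, hx, rfl⟩ : ∃ x ∈ T, Submodule.Quotient.mk x = a := by simpa using ha
    rw [← hC x hx]
    congr 1
    ext y
    simp only [Set.mem_ofPred_eq, Submodule.Quotient.eq]

section Hyperbolic

variable {R : Type*} [CommRing R] {k : ℕ}

theorem hyperbolicForm_apply (x : Fin k ⊕ Fin k → R) :
    hyperbolicForm R k x = ∑ i, x (Sum.inl i) * x (Sum.inr i) := by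
  simp [hyperbolicForm]

theorem polar_hyperbolicForm (x y : Fin k ⊕ Fin k → R) :
    QuadraticMap.polar (hyperbolicForm R k) x y =
      ∑ i, (x (Sum.inl i) * y (Sum.inr i) + y (Sum.inl i) * x (Sum.inr i)) := by
  simp only [QuadraticMap.polar, hyperbolicForm_apply, ← Finset.sum_sub_distrib, Pi.add_apply]
  exact Finset.sum_congr rfl fun i _ => by ring

variable (R k) in
/-- The isomorphism of the dual of `H_k` with `H_k` given by the unimodular polar form. -/
def dualVector : Module.Dual R (Fin k ⊕ Fin k → R) →ₗ[R] (Fin k ⊕ Fin k → R) where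
  toFun l c := l (Pi.single c.swap 1)
  map_add' _ _ := rfl
  map_smul' _ _ := rfl

theorem polar_dualVector (x : Fin k ⊕ Fin k → R) (l : Module.Dual R (Fin k ⊕ Fin k → R)) :
    QuadraticMap.polar (hyperbolicForm R k) x (dualVector R k l) = l x := by
  conv_rhs => rw [← Finset.univ_sum_single x, map_sum, Fintype.sum_sum_type,
    ← Finset.sum_add_distrib]
  rw [polar_hyperbolicForm]
  have h : ∀ c (a : R), l (Pi.single c a) = a * l (Pi.single c 1) := fun c a => by
    rw [← smul_eq_mul a, ← map_smul, ← Pi.single_smul, smul_eq_mul, mul_one]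
  refine Finset.sum_congr rfl fun i _ => ?_
  rw [h _ (x _), h _ (x (Sum.inr i))]
  simp [dualVector, mul_comm]

end Hyperbolic

section Primitive

variable {R : Type*} [CommRing R] {L : Type*} [AddCommGroup L] [Module R L] {k : ℕ}

/-- A linear map `φ : L → H_k` is primitive if it is injective modulo the uniformizer `ϖ`. -/
def IsPrimitive (ϖ : R) (φ : L →ₗ[R] (Fin k ⊕ Fin k → R)) : Prop :=
  ∀ x, φ x ∈ powSub (Fin k ⊕ Fin k → R) ϖ 1 → x ∈ powSub L ϖ 1

theorem IsPrimitive.congr {ϖ : R} {φ ψ : L →ₗ[R] (Fin k ⊕ Fin k → R)} (h : IsPrimitive ϖ φ)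
    (hφψ : φ - ψ ∈ powSub (L →ₗ[R] (Fin k ⊕ Fin k → R)) ϖ 1) : IsPrimitive ϖ ψ := by
  intro x hx
  refine h x ?_
  have := map_mem_powSub (LinearMap.applyₗ x) hφψ
  simpa using add_mem this hx

variable [IsDomain R] [IsDiscreteValuationRing R]

theorem IsPrimitive.mem_of_smul_mem {ϖ : R} (hϖ : Irreducible ϖ) {φ : L →ₗ[R] (Fin k ⊕ Fin k → R)}
    (h : IsPrimitive ϖ φ) {a : R} (ha : a ≠ 0) {z : Fin k ⊕ Fin k → R}
    (hz : a • z ∈ LinearMap.range φ) : z ∈ LinearMap.range φ := by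
  obtain ⟨j, u, rfl⟩ := IsDiscreteValuationRing.eq_unit_mul_pow_irreducible ha hϖ
  have hz' : ϖ ^ j • z ∈ LinearMap.range φ := by
    have := Submodule.smul_mem _ (↑u⁻¹ : R) hz
    rwa [smul_smul, ← mul_assoc, Units.inv_mul, one_mul] at this
  clear hz
  induction j with
  | zero => simpa using hz'
  | succ j ih =>
    refine ih (by simp [hϖ.ne_zero]) ?_
    obtain ⟨x, hx⟩ := hz'
    obtain ⟨y, rfl⟩ := mem_powSub.1 (h x (mem_powSub.2 ⟨ϖ ^ j • z, by rw [hx, smul_smul]; ring_nf⟩))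
    refine ⟨y, smul_right_injective _ hϖ.ne_zero ?_⟩
    simp only
    rw [smul_smul, ← pow_succ', ← hx, pow_one, map_smul]

theorem IsPrimitive.injective [IsAdicComplete (maximalIdeal R) R] {ϖ : R} (hϖ : Irreducible ϖ)
    {ι : Type*} [Finite ι] (b : Module.Basis ι R L)
    {φ : L →ₗ[R] (Fin k ⊕ Fin k → R)} (h : IsPrimitive ϖ φ) : Function.Injective φ := by
  rw [injective_iff_map_eq_zero]
  intro x hx
  refine eq_zero_of_forall_mem_powSub b hϖ fun j => ?_
  induction j with
  | zero => rw [powSub_zero]; trivial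
  | succ j ih =>
    obtain ⟨y, rfl⟩ := mem_powSub.1 ih
    rw [map_smul, smul_eq_zero] at hx
    have hy := hx.resolve_left (pow_ne_zero _ hϖ.ne_zero)
    exact smul_mem_powSub_add (h y (by rw [hy]; exact zero_mem _))

theorem IsPrimitive.exists_leftInverse [IsAdicComplete (maximalIdeal R) R] {ϖ : R}
    (hϖ : Irreducible ϖ) {ι : Type*} [Finite ι] (b : Module.Basis ι R L)
    {φ : L →ₗ[R] (Fin k ⊕ Fin k → R)} (h : IsPrimitive ϖ φ) :
    ∃ p : (Fin k ⊕ Fin k → R) →ₗ[R] L, p ∘ₗ φ = LinearMap.id := by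
  have : Module.IsTorsionFree R ((Fin k ⊕ Fin k → R) ⧸ LinearMap.range φ) := by
    refine ⟨fun a ha => ?_⟩
    refine isSMulRegular_iff_right_eq_zero_of_smul.2 fun z hz => ?_
    obtain ⟨z, rfl⟩ := Submodule.Quotient.mk_surjective _ z
    rw [← Submodule.Quotient.mk_smul, Submodule.Quotient.mk_eq_zero] at hz
    rw [Submodule.Quotient.mk_eq_zero]
    exact h.mem_of_smul_mem hϖ ha.ne_zero hz
  have : Module.Free R ((Fin k ⊕ Fin k → R) ⧸ LinearMap.range φ) := inferInstance
  have hex : Function.Exact φ (LinearMap.range φ).mkQ :=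
    LinearMap.exact_map_mkQ_range φ
  exact ((hex.split_tfae (h.injective hϖ b) (Submodule.mkQ_surjective _)).out 0 1).1
    (Module.projective_lifting_property _ _ (Submodule.mkQ_surjective _))

/-- The differential of `φ ↦ q_k ∘ φ` at a primitive map has a linear section. A quadratic form `g` is
the restriction to the diagonal of a bilinear form, depending linearly on `g`; a left inverse of `φ`
and the unimodularity of `H_k` represent it as `(x, y) ↦ B_k (φ x, ψ y)`. -/
theorem IsPrimitive.exists_section [IsAdicComplete (maximalIdeal R) R] {ϖ : R}
    (hϖ : Irreducible ϖ) {n : ℕ} (b : Module.Basis (Fin n) R L)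
    {φ : L →ₗ[R] (Fin k ⊕ Fin k → R)} (h : IsPrimitive ϖ φ) :
    ∃ s : QuadraticForm R L →ₗ[R] (L →ₗ[R] (Fin k ⊕ Fin k → R)),
      ∀ g, QuadraticMap.polar (pullbackMap R L k) φ (s g) = g := by
  obtain ⟨p, hp⟩ := h.exists_leftInverse hϖ b
  let s : QuadraticForm R L →ₗ[R] (L →ₗ[R] (Fin k ⊕ Fin k → R)) :=
    { toFun g := (dualVector R k ∘ₗ p.dualMap) ∘ₗ QuadraticMap.toBilinHom R b g
      map_add' g g' := by rw [map_add, LinearMap.comp_add]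
      map_smul' a g := by rw [map_smul, LinearMap.comp_smul]; rfl }
  refine ⟨s, fun g => ?_⟩
  ext x
  rw [polar_pullbackMap_apply, diffRho]
  change QuadraticMap.polar _ _ (dualVector R k (p.dualMap _)) = _
  rw [polar_dualVector, LinearMap.dualMap_apply, show p (φ x) = x from LinearMap.congr_fun hp x]
  exact QuadraticMap.congr_fun (QuadraticMap.toQuadraticMap_toBilin g b) x

end Primitive

/-! ### Approximate isometries that extend to primitive maps on an overlattice -/

section Restriction

variable {R : Type*} [CommRing R] {L L' : Type*} [AddCommGroup L] [Module R L]
  [AddCommGroup L'] [Module R L'] {n k : ℕ} {i : L →ₗ[R] L'} {b : Module.Basis (Fin n) R L}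
  {b' : Module.Basis (Fin n) R L'} {ϖ : R} {t : Fin n → ℕ}

theorem mapCoord_comp (hi : ∀ j, i (b j) = ϖ ^ t j • b' j) (φ : L' →ₗ[R] (Fin k ⊕ Fin k → R))
    (c : Coord n k) : mapCoord b (φ ∘ₗ i) c = ϖ ^ t c.1 * mapCoord b' φ c := by
  simp [mapCoord, hi]

theorem formCoeff_comp (hi : ∀ j, i (b j) = ϖ ^ t j • b' j) (g : QuadraticForm R L')
    (s : UpperPair n) :
    formCoeff b (g.comp i) s = ϖ ^ (t s.1.1 + t s.1.2) * formCoeff b' g s := by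
  unfold formCoeff
  split_ifs with h
  · rw [QuadraticMap.comp_apply, hi, QuadraticMap.map_smul, ← h, pow_add, smul_eq_mul]
  · change QuadraticMap.polar (g ∘ i) _ _ = _
    have h1 : QuadraticMap.polar (g ∘ i) (b s.1.1) (b s.1.2) =
        QuadraticMap.polar g (i (b s.1.1)) (i (b s.1.2)) := by
      simp [QuadraticMap.polar]
    rw [h1, hi, hi, QuadraticMap.polar_smul_left, QuadraticMap.polar_smul_right, smul_smul, pow_add,
      smul_eq_mul]

variable [IsDomain R]

theorem comp_mem_powSub_iff (hϖ : ϖ ≠ 0) (hi : ∀ j, i (b j) = ϖ ^ t j • b' j) {M : ℕ}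
    (hM : ∀ j, t j ≤ M) (φ : L' →ₗ[R] (Fin k ⊕ Fin k → R)) :
    φ ∘ₗ i ∈ powSub (L →ₗ[R] (Fin k ⊕ Fin k → R)) ϖ M ↔
      φ ∈ diagSub (Module.Basis.ofEquivFun (coordEquiv b' k)) ϖ (fun c => M - t c.1) := by
  rw [mem_powSub_iff_repr (Module.Basis.ofEquivFun (coordEquiv b k))]
  refine forall_congr' fun c => ?_
  simp only [Module.Basis.ofEquivFun_repr_apply, coordEquiv_apply]
  rw [mapCoord_comp hi]
  nth_rw 1 [← Nat.add_sub_cancel' (hM c.1)]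
  rw [pow_add, mul_dvd_mul_iff_left (pow_ne_zero _ hϖ)]

theorem comp_form_mem_powSub_iff (hϖ : ϖ ≠ 0) (hi : ∀ j, i (b j) = ϖ ^ t j • b' j) {M : ℕ}
    (hM : ∀ j, 2 * t j ≤ M) (g : QuadraticForm R L') :
    g.comp i ∈ powSub (QuadraticForm R L) ϖ M ↔
      g ∈ diagSub (Module.Basis.ofEquivFun (formEquiv b')) ϖ
        (fun s => M - (t s.1.1 + t s.1.2)) := by
  rw [mem_powSub_iff_repr (Module.Basis.ofEquivFun (formEquiv b))]
  refine forall_congr' fun s => ?_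
  simp only [Module.Basis.ofEquivFun_repr_apply, formEquiv_apply]
  rw [formCoeff_comp hi]
  have h1 := hM s.1.1
  have h2 := hM s.1.2
  nth_rw 1 [← Nat.add_sub_cancel' (show t s.1.1 + t s.1.2 ≤ M by omega)]
  rw [pow_add, mul_dvd_mul_iff_left (pow_ne_zero _ hϖ)]

theorem sum_upperPair (t : Fin n → ℕ) :
    ∑ s : UpperPair n, (t s.1.1 + t s.1.2) = (n + 1) * ∑ j, t j := by
  have h1 : ∑ s : UpperPair n, (t s.1.1 + t s.1.2) =
      ∑ p ∈ (Finset.univ : Finset (Fin n × Fin n)) with p.1 ≤ p.2, (t p.1 + t p.2) :=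
    (Finset.sum_subtype _ (by simp) (fun p : Fin n × Fin n => t p.1 + t p.2)).symm
  rw [h1, Finset.sum_filter, Fintype.sum_prod_type]
  have h2 : ∀ x y : Fin n, (if x ≤ y then t x + t y else 0) =
      (if x ≤ y then t x else 0) + (if x ≤ y then t y else 0) := fun x y => by split_ifs <;> simp
  simp_rw [h2, Finset.sum_add_distrib]
  rw [Finset.sum_comm (f := fun x y => if x ≤ y then t y else 0)]
  simp_rw [← Finset.sum_filter, Finset.sum_const, smul_eq_mul]
  rw [← Finset.sum_add_distrib, Finset.mul_sum]
  refine Finset.sum_congr rfl fun x _ => ?_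
  have e1 : (Finset.univ.filter fun y => x ≤ y) = Finset.Ici x := by ext; simp
  have e2 : (Finset.univ.filter fun y => y ≤ x) = Finset.Iic x := by ext; simp
  rw [e1, e2, Fin.card_Ici, Fin.card_Iic, ← add_mul]
  have := x.2
  congr 1
  omega

theorem sum_sub_upperPair {t : Fin n → ℕ} {M : ℕ} (hM : ∀ j, 2 * t j ≤ M) :
    ∑ s : UpperPair n, (M - (t s.1.1 + t s.1.2)) + (n + 1) * ∑ j, t j =
      M * Fintype.card (UpperPair n) := by
  rw [← sum_upperPair, ← Finset.sum_add_distrib, Finset.sum_congr rfl (g := fun _ => M)]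
  · simp [mul_comm]
  · intro s _
    have h1 := hM s.1.1
    have h2 := hM s.1.2
    omega

theorem sum_sub_coord {t : Fin n → ℕ} {M : ℕ} (hM : ∀ j, t j ≤ M) :
    ∑ c : Coord n k, (M - t c.1) + 2 * k * ∑ j, t j = M * Fintype.card (Coord n k) := by
  have : 2 * k * ∑ j, t j = ∑ c : Coord n k, t c.1 := by
    rw [Fintype.sum_prod_type, Finset.mul_sum]
    exact Finset.sum_congr rfl fun x _ => by simp [← two_mul]
  rw [this, ← Finset.sum_add_distrib, Finset.sum_congr rfl (g := fun _ => M)]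
  · simp [mul_comm]
  · intro c _
    exact Nat.sub_add_cancel (hM c.1)

variable [IsDiscreteValuationRing R]

omit [IsDomain R] [IsDiscreteValuationRing R] in
theorem comp_form_mem_of_comp_mem {q : QuadraticForm R L'} {M : ℕ}
    {φ ψ : L' →ₗ[R] (Fin k ⊕ Fin k → R)}
    (h : (pullbackMap R L' k φ - q).comp i ∈ powSub (QuadraticForm R L) ϖ M)
    (hφψ : (φ - ψ) ∘ₗ i ∈ powSub (L →ₗ[R] (Fin k ⊕ Fin k → R)) ϖ M) :
    (pullbackMap R L' k ψ - q).comp i ∈ powSub (QuadraticForm R L) ϖ M := by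
  have h1 : (pullbackMap R L' k φ - q).comp i - (pullbackMap R L' k ψ - q).comp i =
      pullbackMap R L k (φ ∘ₗ i) - pullbackMap R L k (ψ ∘ₗ i) := by
    ext x; simp
  have h2 : (pullbackMap R L' k φ - q).comp i - (pullbackMap R L' k ψ - q).comp i ∈
      powSub (QuadraticForm R L) ϖ M := by
    rw [h1, quadraticMap_sub_eq]
    rw [LinearMap.sub_comp] at hφψ
    obtain ⟨z, hz⟩ := mem_powSub.1 hφψ
    rw [← hz, QuadraticMap.polar_smul_right, QuadraticMap.map_smul, mul_smul, ← smul_add]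
    exact pow_smul_mem_powSub _ _ _
  simpa using sub_mem h h2

/-- Let `L'` be an overlattice of `L` with elementary divisors `ϖ ^ t j`. The approximate isometries
modulo `ϖ ^ M` of `L` that extend to primitive maps on `L'` are counted by the primitive isometries
of `L'` modulo `ϖ`. Restriction from `L'` to `L` has a determinant of valuation `2 k ∑ t j` on linear
maps and of valuation `(n + 1) ∑ t j` on quadratic forms; this accounts for the two factors with
these exponents. The differential at a primitive map is surjective, so each solution modulo `ϖ` lifts
to the same number of solutions modulo higher powers. -/
theorem cardMod_primitive [IsAdicComplete (maximalIdeal R) R] [Finite (ResidueField R)]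
    (hϖ : Irreducible ϖ) (hi : ∀ j, i (b j) = ϖ ^ t j • b' j) {M : ℕ}
    (hM0 : 0 < M) (hM : ∀ j, 2 * t j < M) (q : QuadraticForm R L') :
    cardMod (powSub (L →ₗ[R] (Fin k ⊕ Fin k → R)) ϖ M)
      {φ | pullbackMap R L k φ - q.comp i ∈ powSub (QuadraticForm R L) ϖ M ∧
        ∃ φ' : L' →ₗ[R] (Fin k ⊕ Fin k → R), IsPrimitive ϖ φ' ∧ φ' ∘ₗ i = φ} *
      Nat.card (ResidueField R) ^ (2 * k * ∑ j, t j) *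
      Nat.card (ResidueField R) ^ (M * Fintype.card (UpperPair n)) =
    cardMod (powSub (L' →ₗ[R] (Fin k ⊕ Fin k → R)) ϖ 1)
      {φ | IsPrimitive ϖ φ ∧ pullbackMap R L' k φ - q ∈ powSub (QuadraticForm R L') ϖ 1} *
      Nat.card (ResidueField R) ^ ((M - 1) * Fintype.card (Coord n k)) *
      Nat.card (ResidueField R) ^ ((n + 1) * ∑ j, t j) *
      Nat.card (ResidueField R) ^ Fintype.card (UpperPair n) := by
  set f := Nat.card (ResidueField R) with hf
  have hf0 : 0 < f := Nat.card_pos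
  have htM : ∀ j, t j ≤ M := fun j => by have := hM j; omega
  have htM2 : ∀ j, 2 * t j ≤ M := fun j => (hM j).le
  have htM3 : ∀ j, 2 * t j ≤ M - 1 := fun j => by have := hM j; omega
  set bE := Module.Basis.ofEquivFun (coordEquiv b' k) with hbE
  set bG := Module.Basis.ofEquivFun (formEquiv b') with hbG
  have : Module.Free R L' := Module.Free.of_basis b'
  have : Module.Finite R L' := Module.Finite.of_basis b'
  have : Module.Free R (QuadraticForm R L') := Module.Free.of_basis bG
  set P' := diagSub bE ϖ (fun c => M - t c.1) with hP'
  set A : Set (L' →ₗ[R] (Fin k ⊕ Fin k → R)) := {φ | IsPrimitive ϖ φ ∧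
    (pullbackMap R L' k φ - q).comp i ∈ powSub (QuadraticForm R L) ϖ M} with hA
  -- pass to maps on `L'`; `A` is the set of those whose restrictions are counted
  have h1 : {φ | pullbackMap R L k φ - q.comp i ∈ powSub (QuadraticForm R L) ϖ M ∧
        ∃ φ' : L' →ₗ[R] (Fin k ⊕ Fin k → R), IsPrimitive ϖ φ' ∧ φ' ∘ₗ i = φ} =
      (fun φ' => φ' ∘ₗ i) '' A := by
    ext φ
    constructor
    · rintro ⟨h, φ', hφ', rfl⟩
      exact ⟨φ', ⟨hφ', h⟩, rfl⟩
    · rintro ⟨φ', ⟨hφ', h⟩, rfl⟩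
      exact ⟨h, φ', hφ', rfl⟩
  rw [h1, cardMod_bij P' _ (fun φ' => φ' ∘ₗ i) (fun φ ψ => by
    rw [← LinearMap.sub_comp, comp_mem_powSub_iff hϖ.ne_zero hi htM])]
  have hP'1 : P' ≤ powSub _ ϖ 1 := by
    intro φ hφ
    rw [mem_powSub_iff_repr bE]
    exact fun c => (pow_dvd_pow _ (by have := hM c.1; dsimp only; omega)).trans (hφ c)
  have hMP' : powSub _ ϖ M ≤ P' := by
    intro φ hφ c
    exact (pow_dvd_pow _ (Nat.sub_le _ _)).trans ((mem_powSub_iff_repr bE).1 hφ c)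
  have hsat : ∀ φ ψ, φ ∈ A → φ - ψ ∈ P' → ψ ∈ A := by
    intro φ ψ h hφψ
    refine ⟨h.1.congr (hP'1 hφψ), comp_form_mem_of_comp_mem h.2 ?_⟩
    rwa [comp_mem_powSub_iff hϖ.ne_zero hi htM]
  have : Finite ((L' →ₗ[R] (Fin k ⊕ Fin k → R)) ⧸ powSub (L' →ₗ[R] (Fin k ⊕ Fin k → R)) ϖ M) :=
    finite_quotient_powSub bE hϖ M
  have h2 := cardMod_mul_relIndex hMP' A hsat
  have h3 : (powSub _ ϖ M).toAddSubgroup.relIndex P'.toAddSubgroup = f ^ (2 * k * ∑ j, t j) := by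
    have := AddSubgroup.relIndex_mul_index (show (powSub _ ϖ M).toAddSubgroup ≤ P'.toAddSubgroup from hMP')
    have e1 : P'.toAddSubgroup.index = _ := card_quotient_diagSub bE hϖ _
    have e2 : (powSub _ ϖ M).toAddSubgroup.index = _ := card_quotient_powSub bE hϖ M
    rw [e1, e2, ← sum_sub_coord htM, pow_add, mul_comm] at this
    exact Nat.eq_of_mul_eq_mul_left (pow_pos hf0 _) this
  rw [h3] at h2
  rw [← h2]
  set W := diagSub bG ϖ (fun s => M - 1 - (t s.1.1 + t s.1.2)) with hW
  have hWM : ∀ g, (ϖ • g).comp i ∈ powSub (QuadraticForm R L) ϖ M ↔ g ∈ W := by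
    intro g
    rw [comp_form_mem_powSub_iff hϖ.ne_zero hi htM2]
    refine forall_congr' fun s => ?_
    have h1 := hM s.1.1
    have h2 := hM s.1.2
    dsimp only
    rw [map_smul, Finsupp.smul_apply, smul_eq_mul,
      show M - (t s.1.1 + t s.1.2) = (M - 1 - (t s.1.1 + t s.1.2)) + 1 by omega, pow_succ',
      mul_dvd_mul_iff_left hϖ.ne_zero]
  have hA1 : ∀ g, g.comp i ∈ powSub (QuadraticForm R L) ϖ M → g ∈ powSub (QuadraticForm R L') ϖ 1 := by
    intro g hg
    rw [comp_form_mem_powSub_iff hϖ.ne_zero hi htM2] at hg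
    rw [mem_powSub_iff_repr bG]
    refine fun s => (pow_dvd_pow _ ?_).trans (hg s)
    have h1 := hM s.1.1
    have h2 := hM s.1.2
    dsimp only
    omega
  have hWi : W.toAddSubgroup.index = f ^ ∑ s : UpperPair n, (M - 1 - (t s.1.1 + t s.1.2)) :=
    card_quotient_diagSub bG hϖ _
  -- the ball around an approximate solution
  have hball : ∀ φ, IsPrimitive ϖ φ → pullbackMap R L' k φ - q ∈ powSub (QuadraticForm R L') ϖ 1 →
      (∃ ψ ∈ A, ψ - φ ∈ powSub _ ϖ 1) ∧
      cardMod (powSub _ ϖ M) {ψ | ψ ∈ A ∧ ψ - φ ∈ powSub _ ϖ 1} *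
        f ^ ∑ s : UpperPair n, (M - 1 - (t s.1.1 + t s.1.2)) =
        f ^ ((M - 1) * Fintype.card (Coord n k)) := by
    intro φ hφ hφq
    obtain ⟨s, hs⟩ := hφ.exists_section hϖ b'
    obtain ⟨g, hg⟩ := mem_powSub.1 hφq
    set D := (pullbackMap R L' k).polarBilin φ with hD
    have hDs : ∀ g, D (s g) = g := hs
    have hset : {ψ | ψ ∈ A ∧ ψ - φ ∈ powSub _ ϖ 1} = (fun δ => φ + ϖ ^ 1 • δ) ''
        {δ | g + D (straighten (pullbackMap R L' k) s ϖ 0 δ) ∈ W} := by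
      have key : ∀ δ, pullbackMap R L' k (φ + ϖ ^ 1 • δ) - q =
          ϖ • (g + D (straighten (pullbackMap R L' k) s ϖ 0 δ)) := by
        intro δ
        have := apply_add_smul_eq (pullbackMap R L' k) s ϖ 0 0 φ (fun g => by simpa using hs g) δ
        rw [zero_add, zero_add] at this
        rw [this, smul_add, add_sub_right_comm, ← hg, pow_one]
        rfl
      ext ψ
      simp only [Set.mem_ofPred_eq, Set.mem_image]
      constructor
      · rintro ⟨⟨h1, h2⟩, h3⟩
        obtain ⟨δ, hδ⟩ := mem_powSub.1 h3
        have hx : φ + ϖ ^ 1 • δ = ψ := by rw [hδ]; abel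
        refine ⟨δ, ?_, hx⟩
        rwa [← hWM, ← key, hx]
      · rintro ⟨δ, h, rfl⟩
        have h3 : φ + ϖ ^ 1 • δ - φ ∈ powSub _ ϖ 1 := by
          rw [add_sub_cancel_left]; exact pow_smul_mem_powSub _ _ _
        refine ⟨⟨hφ.congr ?_, ?_⟩, h3⟩
        · rw [← neg_sub]; exact neg_mem h3
        · rwa [key, hWM]
    have hex : ∃ y, g + D y ∈ W := ⟨s (-g), by rw [hDs, add_neg_cancel]; exact zero_mem _⟩
    constructor
    · obtain ⟨y, hy⟩ := hex
      obtain ⟨δ, rfl⟩ := (straighten_bijective bE (pullbackMap R L' k) s hϖ 0).2 y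
      have : φ + ϖ ^ 1 • δ ∈ {ψ | ψ ∈ A ∧ ψ - φ ∈ powSub _ ϖ 1} := by
        rw [hset]; exact ⟨δ, hy, rfl⟩
      exact ⟨_, this⟩
    · rw [hset, cardMod_bij (powSub _ ϖ (M - 1)) (powSub _ ϖ M) (fun δ => φ + ϖ ^ 1 • δ)
        (fun x y => by
          have : M = 1 + (M - 1) := by omega
          rw [add_sub_add_left_eq_sub, ← smul_sub (ϖ ^ 1) x y]
          nth_rw 1 [this]
          rw [smul_mem_powSub_iff hϖ.ne_zero]),
        cardMod_straighten bE _ s hϖ 0 D W g hex (M - 1)]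
      have h1 : (powSub _ ϖ (M - 1)).toAddSubgroup ≤ (W.comap D).toAddSubgroup := by
        intro x hx s
        exact (pow_dvd_pow _ (Nat.sub_le _ _)).trans
          ((mem_powSub_iff_repr bG).1 (map_mem_powSub D hx) s)
      have h2 := AddSubgroup.relIndex_mul_index h1
      have h3 : LinearMap.range D = ⊤ := LinearMap.range_eq_top.2 fun g => ⟨s g, hDs g⟩
      have h4 : (powSub _ ϖ (M - 1)).toAddSubgroup.index = _ := card_quotient_powSub bE hϖ (M - 1)
      rw [index_comap_eq_relIndex, h3, Submodule.top_toAddSubgroup, AddSubgroup.relIndex_top_right,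
        hWi, h4] at h2
      exact h2
  set w := f ^ ∑ s : UpperPair n, (M - 1 - (t s.1.1 + t s.1.2)) with hw
  have hw0 : 0 < w := pow_pos hf0 _
  have h4 := cardMod_eq_mul (powSub_anti ϖ hM0) A
    (fun φ ψ h hφψ => hsat φ ψ h (hMP' hφψ)) (f ^ ((M - 1) * Fintype.card (Coord n k)) / w)
    (fun φ hφ => (Nat.div_eq_of_eq_mul_left hw0 (hball φ hφ.1 (hA1 _ hφ.2)).2.symm).symm)
  have h5 : cardMod (powSub _ ϖ 1) A = cardMod (powSub _ ϖ 1)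
      {φ | IsPrimitive ϖ φ ∧ pullbackMap R L' k φ - q ∈ powSub (QuadraticForm R L') ϖ 1} := by
    unfold cardMod
    congr 1
    ext x
    constructor
    · rintro ⟨φ, hφ, rfl⟩
      exact ⟨φ, ⟨hφ.1, hA1 _ hφ.2⟩, rfl⟩
    · rintro ⟨φ, hφ, rfl⟩
      obtain ⟨ψ, hψ, h⟩ := (hball φ hφ.1 hφ.2).1
      exact ⟨ψ, hψ, (Submodule.Quotient.eq _).2 h⟩
  rw [h4, h5]
  have h6 := sum_sub_upperPair htM3
  have h7 : (n + 1) * ∑ j, t j + Fintype.card (UpperPair n) +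
      ∑ s : UpperPair n, (M - 1 - (t s.1.1 + t s.1.2)) = M * Fintype.card (UpperPair n) := by
    obtain ⟨M, rfl⟩ : ∃ M', M = M' + 1 := ⟨M - 1, by omega⟩
    rw [Nat.add_sub_cancel] at h6 ⊢
    rw [add_mul M 1, ← h6]
    ring
  rcases Set.eq_empty_or_nonempty {φ : L' →ₗ[R] (Fin k ⊕ Fin k → R) | IsPrimitive ϖ φ ∧
    pullbackMap R L' k φ - q ∈ powSub (QuadraticForm R L') ϖ 1} with he | ⟨φ, hφ⟩
  · rw [he]
    simp [cardMod]
  · obtain ⟨v, hv⟩ : w ∣ f ^ ((M - 1) * Fintype.card (Coord n k)) :=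
      ⟨_, (hball φ hφ.1 hφ.2).2.symm.trans (mul_comm _ _)⟩
    rw [← h7, pow_add, pow_add, ← hw, hv, Nat.mul_div_cancel_left _ hw0]
    ring

end Restriction

/-! ### Reduction of primitive maps modulo the maximal ideal -/

/-- The number of injective isometries of `(W, g)` into `H_k`. The coefficients are only assumed to form
a ring, as for the reduction of a lattice, which is a module over the quotient ring `R / 𝔪`. -/
noncomputable def isometryCount {K W : Type*} [CommRing K] [AddCommGroup W] [Module K W]
    (g : QuadraticForm K W) (k : ℕ) : ℕ :=
  Nat.card {ψ : W →ₗ[K] (Fin k ⊕ Fin k → K) //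
    Function.Injective ψ ∧ ∀ x, hyperbolicForm K k (ψ x) = g x}

theorem cardMod_eq_ncard_image {R M β : Type*} [CommRing R] [AddCommGroup M] [Module R M]
    (P : Submodule R M) (τ : M → β) (h : ∀ x y, τ x = τ y ↔ x - y ∈ P) (T : Set M) :
    cardMod P T = (τ '' T).ncard := by
  unfold cardMod
  refine Set.ncard_congr (fun a _ => τ (Quotient.out a)) ?_ ?_ ?_
  · rintro _ ⟨x, hx, rfl⟩
    refine ⟨x, hx, ?_⟩
    rw [h, ← Submodule.Quotient.eq]
    exact (Quotient.out_eq _).symm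
  · intro a a' _ _ e
    rw [h, ← Submodule.Quotient.eq] at e
    exact (Quotient.out_eq a).symm.trans (e.trans (Quotient.out_eq a'))
  · rintro _ ⟨x, hx, rfl⟩
    refine ⟨Submodule.Quotient.mk x, ⟨x, hx, rfl⟩, ?_⟩
    rw [h, ← Submodule.Quotient.eq]
    exact Quotient.out_eq _

section Reduction

variable {R : Type*} [CommRing R] [IsLocalRing R] {L : Type*} [AddCommGroup L] [Module R L]
  {n k : ℕ}

/-- The reduction of a linear map `L → H_k` modulo the maximal ideal. -/
noncomputable def redMap (φ : L →ₗ[R] (Fin k ⊕ Fin k → R)) :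
    (L ⧸ (maximalIdeal R • ⊤ : Submodule R L)) →ₗ[R ⧸ maximalIdeal R]
      (Fin k ⊕ Fin k → R ⧸ maximalIdeal R) :=
  LinearMap.extendScalarsOfSurjective (R := R) Ideal.Quotient.mk_surjective
    (Submodule.liftQ _ ((Algebra.linearMap R (R ⧸ maximalIdeal R)).compLeft _ ∘ₗ φ) (by
      rw [Submodule.smul_le]
      intro r hr x _
      rw [LinearMap.mem_ker, map_smul]
      ext c
      rw [Pi.smul_apply, Algebra.smul_def]
      exact mul_eq_zero_of_left (Ideal.Quotient.eq_zero_iff_mem.mpr hr) _))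

theorem redMap_mk (φ : L →ₗ[R] (Fin k ⊕ Fin k → R)) (x : L) (c : Fin k ⊕ Fin k) :
    redMap φ (Submodule.Quotient.mk x) c = Ideal.Quotient.mk (maximalIdeal R) (φ x c) :=
  rfl

theorem hyperbolicForm_redMap (φ : L →ₗ[R] (Fin k ⊕ Fin k → R)) (x : L) :
    hyperbolicForm (R ⧸ maximalIdeal R) k (redMap φ (Submodule.Quotient.mk x)) =
      Ideal.Quotient.mk (maximalIdeal R) (hyperbolicForm R k (φ x)) := by
  simp only [hyperbolicForm_apply, redMap_mk, map_sum, map_mul]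

end Reduction

section Reduction

variable {R : Type*} [CommRing R] [IsDomain R] [IsDiscreteValuationRing R] {L : Type*}
  [AddCommGroup L] [Module R L] {n k : ℕ} {ϖ : R}

theorem mk_eq_zero_iff_dvd (hϖ : Irreducible ϖ) (a : R) :
    Ideal.Quotient.mk (maximalIdeal R) a = 0 ↔ ϖ ∣ a := by
  rw [Ideal.Quotient.eq_zero_iff_mem, hϖ.maximalIdeal_eq, Ideal.mem_span_singleton]

theorem mem_maximalIdeal_smul_top_iff (hϖ : Irreducible ϖ) (x : L) :
    x ∈ (maximalIdeal R • ⊤ : Submodule R L) ↔ x ∈ powSub L ϖ 1 := by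
  rw [hϖ.maximalIdeal_eq, Submodule.ideal_span_singleton_smul, mem_powSub,
    Submodule.mem_smul_pointwise_iff_exists]
  simp

theorem redMap_eq_iff (hϖ : Irreducible ϖ) (b : Module.Basis (Fin n) R L)
    (φ ψ : L →ₗ[R] (Fin k ⊕ Fin k → R)) :
    redMap φ = redMap ψ ↔ φ - ψ ∈ powSub (L →ₗ[R] (Fin k ⊕ Fin k → R)) ϖ 1 := by
  constructor
  · intro h
    rw [mem_powSub_iff_repr (Module.Basis.ofEquivFun (coordEquiv b k))]
    intro c
    have := congrFun (LinearMap.congr_fun h (Submodule.Quotient.mk (b c.1))) c.2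
    rw [redMap_mk, redMap_mk, ← sub_eq_zero, ← map_sub, mk_eq_zero_iff_dvd hϖ] at this
    rw [pow_one]
    exact this
  · intro h
    obtain ⟨z, hz⟩ := mem_powSub.1 h
    refine LinearMap.ext fun x => ?_
    obtain ⟨x, rfl⟩ := Submodule.Quotient.mk_surjective _ x
    refine funext fun c => ?_
    rw [redMap_mk, redMap_mk, ← sub_eq_zero, ← map_sub, mk_eq_zero_iff_dvd hϖ]
    refine ⟨z x c, ?_⟩
    have := congrFun (LinearMap.congr_fun hz x) c
    simpa using this.symm

theorem redMap_surjective (b : Module.Basis (Fin n) R L) :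
    Function.Surjective (redMap : (L →ₗ[R] (Fin k ⊕ Fin k → R)) → _) := by
  intro ψ
  choose v hv using fun (j : Fin n) (c : Fin k ⊕ Fin k) =>
    Ideal.Quotient.mk_surjective (ψ (Submodule.Quotient.mk (b j)) c)
  refine ⟨b.constr R v, ?_⟩
  have h : ((redMap (b.constr R v)).restrictScalars R) ∘ₗ (Submodule.mkQ _) =
      (ψ.restrictScalars R) ∘ₗ (Submodule.mkQ _) := by
    refine b.ext fun j => ?_
    refine funext fun c => ?_
    change Ideal.Quotient.mk (maximalIdeal R) (b.constr R v (b j) c) = _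
    rw [b.constr_basis]
    exact hv j c
  refine LinearMap.ext fun x => ?_
  obtain ⟨x, rfl⟩ := Submodule.Quotient.mk_surjective _ x
  exact LinearMap.congr_fun h x

theorem isPrimitive_iff (hϖ : Irreducible ϖ) (φ : L →ₗ[R] (Fin k ⊕ Fin k → R)) :
    IsPrimitive ϖ φ ↔ Function.Injective (redMap φ) := by
  rw [injective_iff_map_eq_zero]
  have key : ∀ x : L, redMap φ (Submodule.Quotient.mk x) = 0 ↔
      φ x ∈ powSub (Fin k ⊕ Fin k → R) ϖ 1 := by
    intro x
    rw [mem_powSub_pi, funext_iff]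
    refine forall_congr' fun c => ?_
    rw [redMap_mk, Pi.zero_apply, mk_eq_zero_iff_dvd hϖ, pow_one]
  constructor
  · intro h x hx
    obtain ⟨x, rfl⟩ := Submodule.Quotient.mk_surjective _ x
    rw [Submodule.Quotient.mk_eq_zero, mem_maximalIdeal_smul_top_iff hϖ]
    exact h x ((key x).1 hx)
  · intro h x hx
    have := h _ ((key x).2 hx)
    rwa [Submodule.Quotient.mk_eq_zero, mem_maximalIdeal_smul_top_iff hϖ] at this

theorem pullbackMap_sub_mem_iff (hϖ : Irreducible ϖ) (b : Module.Basis (Fin n) R L)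
    (q : QuadraticForm R L) (φ : L →ₗ[R] (Fin k ⊕ Fin k → R)) :
    pullbackMap R L k φ - q ∈ powSub (QuadraticForm R L) ϖ 1 ↔
      ∀ x, hyperbolicForm (R ⧸ maximalIdeal R) k (redMap φ x) = reducedForm q x := by
  have h1 : (∀ x, hyperbolicForm (R ⧸ maximalIdeal R) k (redMap φ x) = reducedForm q x) ↔
      ∀ x, ϖ ∣ (pullbackMap R L k φ - q) x := by
    rw [(Submodule.Quotient.mk_surjective _).forall]
    refine forall_congr' fun x => ?_
    rw [hyperbolicForm_redMap, reducedForm_mk, ← sub_eq_zero, ← map_sub, mk_eq_zero_iff_dvd hϖ]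
    rfl
  rw [h1]
  constructor
  · intro h x
    obtain ⟨g, hg⟩ := mem_powSub.1 h
    rw [← hg]
    exact ⟨g x, by simp⟩
  · intro h
    rw [mem_powSub_iff_repr (Module.Basis.ofEquivFun (formEquiv b))]
    intro s
    simp only [Module.Basis.ofEquivFun_repr_apply, formEquiv_apply, formCoeff, pow_one]
    split_ifs
    · exact h _
    · exact dvd_sub (dvd_sub (h _) (h _)) (h _)

theorem cardMod_primitive_one (hϖ : Irreducible ϖ) (b : Module.Basis (Fin n) R L)
    (q : QuadraticForm R L) :
    cardMod (powSub (L →ₗ[R] (Fin k ⊕ Fin k → R)) ϖ 1)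
      {φ | IsPrimitive ϖ φ ∧ pullbackMap R L k φ - q ∈ powSub (QuadraticForm R L) ϖ 1} =
    isometryCount (reducedForm q) k := by
  rw [cardMod_eq_ncard_image _ redMap (redMap_eq_iff hϖ b)]
  unfold isometryCount
  rw [← Set.coe_ofPred, Nat.card_coe_set_eq]
  congr 1
  ext ψ
  obtain ⟨φ, rfl⟩ := redMap_surjective b ψ
  simp only [Set.mem_image, Set.mem_ofPred_eq]
  constructor
  · rintro ⟨φ', h, e⟩
    rw [← e, ← isPrimitive_iff hϖ, ← pullbackMap_sub_mem_iff hϖ b]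
    exact h
  · intro h
    refine ⟨φ, ?_, rfl⟩
    rwa [isPrimitive_iff hϖ, pullbackMap_sub_mem_iff hϖ b]

end Reduction

section Extension

variable {R : Type*} [CommRing R] {L L' : Type*} [AddCommGroup L] [Module R L]
    [AddCommGroup L'] [Module R L'] {n k : ℕ} {i : L →ₗ[R] L'} {b : Module.Basis (Fin n) R L}
    {b' : Module.Basis (Fin n) R L'} {ϖ : R} {t : Fin n → ℕ}

theorem exists_comp_eq_smul (hi : ∀ j, i (b j) = ϖ ^ t j • b' j) {c : ℕ} (hc : ∀ j, t j ≤ c) :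
    ∃ j : L' →ₗ[R] L, j ∘ₗ i = ϖ ^ c • LinearMap.id := by
  refine ⟨b'.constr R fun l => ϖ ^ (c - t l) • b l, b.ext fun l => ?_⟩
  simp only [LinearMap.comp_apply, hi, map_smul, Module.Basis.constr_basis, smul_smul,
    LinearMap.smul_apply, LinearMap.id_apply]
  rw [← pow_add, Nat.add_sub_cancel' (hc l)]

/-- Extending to a primitive map on a given overlattice is an open condition. -/
theorem exists_isPrimitive_of_sub_mem (hi : ∀ j, i (b j) = ϖ ^ t j • b' j) {c : ℕ}
    (hc : ∀ j, t j ≤ c) {φ ψ : L →ₗ[R] (Fin k ⊕ Fin k → R)}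
    (hφ : ∃ φ' : L' →ₗ[R] (Fin k ⊕ Fin k → R), IsPrimitive ϖ φ' ∧ φ' ∘ₗ i = φ)
    (h : φ - ψ ∈ powSub (L →ₗ[R] (Fin k ⊕ Fin k → R)) ϖ (c + 1)) :
    ∃ ψ' : L' →ₗ[R] (Fin k ⊕ Fin k → R), IsPrimitive ϖ ψ' ∧ ψ' ∘ₗ i = ψ := by
  obtain ⟨φ', hφ', rfl⟩ := hφ
  obtain ⟨j, hj⟩ := exists_comp_eq_smul hi hc
  obtain ⟨z, hz⟩ := mem_powSub.1 h
  refine ⟨φ' - ϖ ^ 1 • (z ∘ₗ j), hφ'.congr ?_, ?_⟩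
  · rw [sub_sub_cancel]
    exact pow_smul_mem_powSub _ _ _
  · rw [LinearMap.sub_comp, LinearMap.smul_comp, LinearMap.comp_assoc, hj, LinearMap.comp_smul,
      LinearMap.comp_id, smul_smul, ← pow_add, add_comm 1, hz, sub_sub_cancel]

/-- On a map `L → H_k` that extends to a primitive map on an overlattice, the differential of
`φ ↦ q_k ∘ φ` has a linear section up to a power of the uniformizer depending only on the
overlattice. -/
theorem exists_section_of_comp [IsDomain R] [IsDiscreteValuationRing R]
    [IsAdicComplete (maximalIdeal R) R] (hϖ : Irreducible ϖ)
    (hi : ∀ j, i (b j) = ϖ ^ t j • b' j) {c : ℕ} (hc : ∀ j, t j ≤ c)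
    {φ : L' →ₗ[R] (Fin k ⊕ Fin k → R)} (hφ : IsPrimitive ϖ φ) :
    ∃ s : QuadraticForm R L →ₗ[R] (L →ₗ[R] (Fin k ⊕ Fin k → R)),
      ∀ g, QuadraticMap.polar (pullbackMap R L k) (φ ∘ₗ i) (s g) = ϖ ^ (2 * c) • g := by
  obtain ⟨s, hs⟩ := hφ.exists_section hϖ b'
  obtain ⟨j, hj⟩ := exists_comp_eq_smul hi hc
  let r : QuadraticForm R L →ₗ[R] (L →ₗ[R] (Fin k ⊕ Fin k → R)) :=
    { toFun g := s (g.comp j) ∘ₗ i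
      map_add' g g' := by
        rw [← LinearMap.add_comp, ← map_add]; rfl
      map_smul' a g := by
        rw [RingHom.id_apply, ← LinearMap.smul_comp, ← map_smul]; rfl }
  refine ⟨r, fun g => ?_⟩
  ext x
  rw [polar_pullbackMap_apply]
  have h1 := QuadraticMap.congr_fun (hs (g.comp j)) (i x)
  rw [polar_pullbackMap_apply] at h1
  have h2 : j (i x) = ϖ ^ c • x := LinearMap.congr_fun hj x
  refine h1.trans ?_
  rw [QuadraticMap.comp_apply, h2, QuadraticMap.map_smul, smul_apply, two_mul, pow_add]

end Extension

/-! ### The integral overlattices of a lattice -/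

section LocalField

variable (F : Type*) [Field F] [ValuativeRel F] [TopologicalSpace F] [IsNonarchimedeanLocalField F]

theorem isAdicComplete_integer : IsAdicComplete 𝓂[F] 𝒪[F] := by
  let := IsTopologicalAddGroup.rightUniformSpace F
  have := isUniformAddGroup_of_addCommGroup (G := F)
  infer_instance

theorem t2Space_integer : T2Space 𝒪[F] := by
  let := IsTopologicalAddGroup.rightUniformSpace F
  have := isUniformAddGroup_of_addCommGroup (G := F)
  have : T2Space F := inferInstance
  infer_instance

end LocalField

section Lattices

variable {F : Type*} [Field F] [ValuativeRel F] {V : Type*} [AddCommGroup V] [Module F V]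

/-- The lattices containing `L` on which `Q` is integral. -/
def integralOverlattices (Q : QuadraticForm F V) (L : Submodule 𝒪[F] V) :
    Set (Submodule 𝒪[F] V) :=
  {L' | L ≤ L' ∧ L'.FG ∧ IsIntegralOn Q L'}

theorem latticeForm_apply (Q : QuadraticForm F V) (L : Submodule 𝒪[F] V) (h : IsIntegralOn Q L)
    (x : L) : (latticeForm Q L h x : F) = Q x := rfl

theorem polar_latticeForm (Q : QuadraticForm F V) (L : Submodule 𝒪[F] V) (h : IsIntegralOn Q L)
    (x y : L) : ((QuadraticMap.polar (latticeForm Q L h) x y : 𝒪[F]) : F) = QuadraticMap.polar Q x y := rfl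

variable [TopologicalSpace F] [IsNonarchimedeanLocalField F]

theorem exists_pow_smul_mem {ϖ : 𝒪[F]} (hϖ : Irreducible ϖ) (L : Submodule 𝒪[F] V)
    [Submodule.IsLattice F L] (x : V) : ∃ m : ℕ, ϖ ^ m • x ∈ L := by
  have hx : x ∈ Submodule.span F (L : Set V) := by
    rw [Submodule.IsLattice.span_eq_top]; trivial
  induction hx using Submodule.span_induction with
  | mem x h => exact ⟨0, by simpa using h⟩
  | zero => exact ⟨0, by simp⟩
  | add x y _ _ hx hy =>
    obtain ⟨m, hm⟩ := hx
    obtain ⟨m', hm'⟩ := hy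
    refine ⟨m + m', ?_⟩
    rw [smul_add]
    refine add_mem ?_ ?_
    · rw [add_comm, pow_add, ← smul_smul]; exact L.smul_mem _ hm
    · rw [pow_add, ← smul_smul]; exact L.smul_mem _ hm'
  | smul a x _ hx =>
    obtain ⟨m, hm⟩ := hx
    obtain ⟨r, s, hs, rfl⟩ := IsFractionRing.div_surjective (A := 𝒪[F]) a
    have hs0 : s ≠ 0 := nonZeroDivisors.ne_zero hs
    obtain ⟨j, u, hu⟩ := IsDiscreteValuationRing.eq_unit_mul_pow_irreducible hs0 hϖ
    refine ⟨j + m, ?_⟩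
    have : ϖ ^ (j + m) • (algebraMap 𝒪[F] F r / algebraMap 𝒪[F] F s) • x =
        (r * (↑u⁻¹ : 𝒪[F])) • ϖ ^ m • x := by
      change ((ϖ ^ (j + m) : 𝒪[F]) : F) • ((r : F) / (s : F)) • x =
        ((r * (↑u⁻¹ : 𝒪[F]) : 𝒪[F]) : F) • ((ϖ ^ m : 𝒪[F]) : F) • x
      rw [smul_smul, smul_smul]
      congr 1
      have hsF : (s : F) ≠ 0 := by simpa using hs0
      rw [mul_div_assoc', div_eq_iff hsF, ← Subring.coe_mul, ← Subring.coe_mul, ← Subring.coe_mul,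
        hu]
      congr 1
      linear_combination (-(r * ϖ ^ j * ϖ ^ m)) * u.inv_mul
    rw [this]
    exact L.smul_mem _ hm

omit [TopologicalSpace F] [IsNonarchimedeanLocalField F] in
theorem le_dual_of_mem (Q : QuadraticForm F V) (L : Submodule 𝒪[F] V) {L' : Submodule 𝒪[F] V}
    (h : L' ∈ integralOverlattices Q L) : L' ≤ LinearMap.BilinForm.dualSubmodule Q.polarBilin L := by
  intro x hx y hy
  rw [Submodule.mem_one]
  exact ⟨QuadraticMap.polar (latticeForm Q L' h.2.2) ⟨x, hx⟩ ⟨y, h.1 hy⟩, rfl⟩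

theorem fg_dual (Q : QuadraticForm F V) (hQ : Q.polarBilin.Nondegenerate)
    (L : Submodule 𝒪[F] V) [Submodule.IsLattice F L] :
    (LinearMap.BilinForm.dualSubmodule Q.polarBilin L).FG := by
  classical
  obtain ⟨r, b, hb⟩ : ∃ (r : ℕ) (b : Module.Basis (Fin r) F V),
      Submodule.span 𝒪[F] (Set.range b) = L := by
    refine ⟨_, (Module.finBasis 𝒪[F] L).extendOfIsLattice F, ?_⟩
    have := congrArg (Submodule.map L.subtype) (Module.finBasis 𝒪[F] L).span_eq
    rw [Submodule.map_top, Submodule.range_subtype, Submodule.map_span, ← Set.range_comp] at this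
    refine Eq.trans ?_ this
    congr 2
    ext j
    simp
  rw [← hb, LinearMap.BilinForm.dualSubmodule_span_of_basis _ hQ]
  exact Submodule.fg_span (Set.finite_range _)

theorem exists_pow_smul_le {ϖ : 𝒪[F]} (hϖ : Irreducible ϖ) (L N : Submodule 𝒪[F] V)
    [Submodule.IsLattice F L] (hN : N.FG) : ∃ c : ℕ, ∀ x ∈ N, ϖ ^ c • x ∈ L := by
  obtain ⟨S, rfl⟩ := hN
  choose m hm using exists_pow_smul_mem hϖ L
  refine ⟨S.sup m, fun x hx => ?_⟩
  have : Submodule.span 𝒪[F] (S : Set V) ≤ L.comap (ϖ ^ (S.sup m) • LinearMap.id) := by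
    rw [Submodule.span_le]
    intro y hy
    change ϖ ^ (S.sup m) • y ∈ L
    rw [← Nat.sub_add_cancel (Finset.le_sup (f := m) hy), pow_add, ← smul_smul]
    exact L.smul_mem _ (hm y)
  exact this hx

/-- The integral overlattices of `L` lie between `L` and its dual lattice, which is finitely generated. -/
theorem finite_integralOverlattices (Q : QuadraticForm F V) (hQ : Q.polarBilin.Nondegenerate)
    (L : Submodule 𝒪[F] V) [Submodule.IsLattice F L] : (integralOverlattices Q L).Finite := by
  set N := LinearMap.BilinForm.dualSubmodule Q.polarBilin L with hN
  by_cases hLN : L ≤ N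
  swap
  · convert Set.finite_empty
    rw [Set.eq_empty_iff_forall_notMem]
    exact fun L' h => hLN (h.1.trans (le_dual_of_mem Q L h))
  obtain ⟨ϖ, hϖ⟩ := IsDiscreteValuationRing.exists_irreducible 𝒪[F]
  have hfg := fg_dual Q hQ L
  have : Submodule.IsLattice F N := Submodule.IsLattice.of_le_of_isLattice_of_fg F hLN hfg
  obtain ⟨c, hc⟩ := exists_pow_smul_le hϖ L N hfg
  have : Finite (N ⧸ powSub N ϖ c) := finite_quotient_powSub (Module.finBasis 𝒪[F] N) hϖ c
  have : Finite (Submodule 𝒪[F] (N ⧸ powSub N ϖ c)) := Finite.of_injective _ SetLike.coe_injective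
  refine Set.Finite.of_finite_image (f := fun L' => (L'.submoduleOf N).map (powSub N ϖ c).mkQ)
    (Set.toFinite _) ?_
  intro L₁ h₁ L₂ h₂ e
  have key : ∀ L' ∈ integralOverlattices Q L,
      (((L'.submoduleOf N).map (powSub N ϖ c).mkQ).comap (powSub N ϖ c).mkQ).map N.subtype = L' := by
    intro L' h'
    rw [Submodule.comap_map_mkQ, sup_eq_right.2, Submodule.submoduleOf, Submodule.map_comap_subtype,
      inf_eq_right.2 (le_dual_of_mem Q L h')]
    intro x hx
    obtain ⟨z, rfl⟩ := mem_powSub.1 hx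
    exact h'.1 (hc z z.2)
  rw [← key L₁ h₁, ← key L₂ h₂]
  simp only at e
  rw [e]

/-- Bases of `L` and of an overlattice adapted to the inclusion; the sum of the exponents is the length
of the quotient. -/
theorem exists_adapted_bases {ϖ : 𝒪[F]} (hϖ : Irreducible ϖ) {L L' : Submodule 𝒪[F] V}
    [Submodule.IsLattice F L] (hle : L ≤ L') (hfg : L'.FG) :
    ∃ (b : Module.Basis (Fin (Module.finrank 𝒪[F] L)) 𝒪[F] L)
      (b' : Module.Basis (Fin (Module.finrank 𝒪[F] L)) 𝒪[F] L')
      (t : Fin (Module.finrank 𝒪[F] L) → ℕ),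
      (∀ j, Submodule.inclusion hle (b j) = ϖ ^ t j • b' j) ∧
      Module.length 𝒪[F] (L' ⧸ L.submoduleOf L') = (∑ j, t j : ℕ) := by
  have : Submodule.IsLattice F L' := Submodule.IsLattice.of_le_of_isLattice_of_fg F hle hfg
  have hr : Module.finrank 𝒪[F] L' = Module.finrank 𝒪[F] L := by
    rw [Module.finrank, Module.finrank, Submodule.IsLattice.rank' F L, Submodule.IsLattice.rank' F L']
  let e := Submodule.submoduleOfEquivOfLe hle
  obtain ⟨b', t, bN, h1, h2⟩ := exists_eq_diagSub
    ((Module.finBasis 𝒪[F] L').reindex (finCongr hr)) hϖ (L.submoduleOf L')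
    (by rw [e.finrank_eq, hr])
  refine ⟨bN.map e, b', t, fun j => ?_, ?_⟩
  · rw [← h2]; rfl
  · rw [h1, length_quotient_diagSub b' hϖ]

end Lattices

section Saturation

variable {F : Type*} [Field F] [ValuativeRel F] [TopologicalSpace F] [IsNonarchimedeanLocalField F]
  {V : Type*} [AddCommGroup V] [Module F V] {L : Submodule 𝒪[F] V} [Submodule.IsLattice F L] {k : ℕ}

/-- The `F`-linear extension of a linear map `L → H_k`. -/
noncomputable def extendMap (φ : L →ₗ[𝒪[F]] (Fin k ⊕ Fin k → 𝒪[F])) :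
    V →ₗ[F] (Fin k ⊕ Fin k → F) :=
  ((Module.finBasis 𝒪[F] L).extendOfIsLattice F).constr F
    fun j c => (φ (Module.finBasis 𝒪[F] L j) c : F)

theorem extendMap_apply (φ : L →ₗ[𝒪[F]] (Fin k ⊕ Fin k → 𝒪[F])) (x : L) (c : Fin k ⊕ Fin k) :
    extendMap φ x c = (φ x c : F) := by
  have h : ((extendMap φ).restrictScalars 𝒪[F]) ∘ₗ L.subtype =
      ((Algebra.linearMap 𝒪[F] F).compLeft _) ∘ₗ φ := by
    refine (Module.finBasis 𝒪[F] L).ext fun j => ?_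
    have h1 := ((Module.finBasis 𝒪[F] L).extendOfIsLattice F).constr_basis F
      (fun j c => (φ (Module.finBasis 𝒪[F] L j) c : F)) j
    rw [Module.Basis.extendOfIsLattice_apply] at h1
    exact h1
  exact congrFun (LinearMap.congr_fun h x) c

theorem extendMap_smul (φ : L →ₗ[𝒪[F]] (Fin k ⊕ Fin k → 𝒪[F])) (a : 𝒪[F]) (x : V)
    (c : Fin k ⊕ Fin k) : extendMap φ (a • x) c = (a : F) * extendMap φ x c :=
  congrFun ((extendMap φ).map_smul (a : F) x) c

/-- The lattice of the vectors that the `F`-linear extension of `φ` maps into `H_k`. -/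
noncomputable def saturation (φ : L →ₗ[𝒪[F]] (Fin k ⊕ Fin k → 𝒪[F])) : Submodule 𝒪[F] V where
  carrier := {x | ∀ c, extendMap φ x c ∈ 𝒪[F]}
  zero_mem' c := by simp
  add_mem' hx hy c := by
    rw [map_add, Pi.add_apply]; exact add_mem (hx c) (hy c)
  smul_mem' a x hx c := by
    rw [extendMap_smul]; exact mul_mem a.2 (hx c)

theorem le_saturation (φ : L →ₗ[𝒪[F]] (Fin k ⊕ Fin k → 𝒪[F])) : L ≤ saturation φ := by
  intro x hx c
  rw [extendMap_apply φ ⟨x, hx⟩]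
  exact (φ ⟨x, hx⟩ c).2

/-- The extension of `φ` to its saturation. -/
noncomputable def saturationMap (φ : L →ₗ[𝒪[F]] (Fin k ⊕ Fin k → 𝒪[F])) :
    saturation φ →ₗ[𝒪[F]] (Fin k ⊕ Fin k → 𝒪[F]) where
  toFun x c := ⟨_, x.2 c⟩
  map_add' x y := by
    refine funext fun c => Subtype.ext ?_
    exact congrFun ((extendMap φ).map_add x y) c
  map_smul' a x := by
    refine funext fun c => Subtype.ext ?_
    exact extendMap_smul φ a x c

/-- The overlattice to which `φ` extends as a primitive map is determined by `φ`. -/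
theorem eq_saturation {ϖ : 𝒪[F]} (hϖ : Irreducible ϖ) {L' : Submodule 𝒪[F] V} (hle : L ≤ L')
    {φ' : L' →ₗ[𝒪[F]] (Fin k ⊕ Fin k → 𝒪[F])} (hφ' : IsPrimitive ϖ φ') :
    L' = saturation (φ' ∘ₗ Submodule.inclusion hle) := by
  have hϖ0 : (ϖ : F) ≠ 0 := by simpa using hϖ.ne_zero
  have key : ∀ (x : L') c, extendMap (φ' ∘ₗ Submodule.inclusion hle) x c = (φ' x c : F) := by
    intro x c
    obtain ⟨m, hm⟩ := exists_pow_smul_mem hϖ L (x : V)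
    have h1 := extendMap_apply (φ' ∘ₗ Submodule.inclusion hle) ⟨_, hm⟩ c
    have h2 : Submodule.inclusion hle ⟨_, hm⟩ = ϖ ^ m • x := rfl
    rw [LinearMap.comp_apply, h2, φ'.map_smul, extendMap_smul] at h1
    refine mul_left_cancel₀ (pow_ne_zero m hϖ0) ?_
    simpa using h1
  refine le_antisymm (fun x hx c => ?_) fun x hx => ?_
  · rw [key ⟨x, hx⟩]
    exact (φ' ⟨x, hx⟩ c).2
  · obtain ⟨m, hm⟩ := exists_pow_smul_mem hϖ L x
    replace hm := hle hm
    induction m with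
    | zero => simpa using hm
    | succ m ih =>
      refine ih ?_
      have h1 : φ' ⟨_, hm⟩ ∈ powSub (Fin k ⊕ Fin k → 𝒪[F]) ϖ 1 := by
        rw [mem_powSub_pi]
        intro c
        rw [pow_one]
        refine ⟨ϖ ^ m * ⟨_, hx c⟩, Subtype.ext ?_⟩
        rw [← key, extendMap_smul]
        push_cast
        ring
      obtain ⟨z, hz⟩ := mem_powSub.1 (hφ' _ h1)
      have h2 : (ϖ : F) • (z : V) = (ϖ : F) • ((ϖ ^ m : 𝒪[F]) : F) • x := by
        have := congrArg Subtype.val hz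
        rw [pow_one] at this
        refine this.trans ?_
        change ((ϖ ^ (m + 1) : 𝒪[F]) : F) • x = _
        rw [smul_smul]
        push_cast
        rw [pow_succ']
      have h3 := smul_right_injective V hϖ0 h2
      change ((ϖ ^ m : 𝒪[F]) : F) • x ∈ L'
      rw [← h3]
      exact z.2

theorem hyperbolicForm_extendMap {Q : QuadraticForm F V} {hL : IsIntegralOn Q L}
    {φ : L →ₗ[𝒪[F]] (Fin k ⊕ Fin k → 𝒪[F])} (hφ : φ ∈ isometrySet (latticeForm Q L hL) k) (x : V) :
    hyperbolicForm F k (extendMap φ x) = Q x := by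
  obtain ⟨ϖ, hϖ⟩ := IsDiscreteValuationRing.exists_irreducible 𝒪[F]
  have hϖ0 : (ϖ : F) ≠ 0 := by simpa using hϖ.ne_zero
  obtain ⟨m, hm⟩ := exists_pow_smul_mem hϖ L x
  have h1 : ∀ y : L, hyperbolicForm F k (extendMap φ y) = Q y := by
    intro y
    rw [← latticeForm_apply Q L hL, ← hφ y, hyperbolicForm_apply, hyperbolicForm_apply]
    simp [extendMap_apply]
  have h2 := h1 ⟨_, hm⟩
  change hyperbolicForm F k (extendMap φ (((ϖ ^ m : 𝒪[F]) : F) • x)) =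
    Q (((ϖ ^ m : 𝒪[F]) : F) • x) at h2
  rw [map_smul, QuadraticMap.map_smul, QuadraticMap.map_smul] at h2
  have h3 : ((ϖ ^ m : 𝒪[F]) : F) ≠ 0 := by
    push_cast
    exact pow_ne_zero m hϖ0
  exact smul_right_injective F (mul_ne_zero h3 h3) h2

/-- An isometry on `L` extends to an isometry on its saturation, which is therefore an integral lattice;
it is finitely generated because isometries of a nondegenerate space are injective. -/
theorem saturation_mem {Q : QuadraticForm F V} (hQ : Q.polarBilin.Nondegenerate)
    {hL : IsIntegralOn Q L} {φ : L →ₗ[𝒪[F]] (Fin k ⊕ Fin k → 𝒪[F])}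
    (hφ : φ ∈ isometrySet (latticeForm Q L hL) k) :
    saturation φ ∈ integralOverlattices Q L := by
  refine ⟨le_saturation φ, ?_, fun x hx => ?_⟩
  · have hg : Function.Injective (saturationMap φ) := by
      rw [injective_iff_map_eq_zero]
      intro x hx
      have h0 : extendMap φ (x : V) = 0 := by
        refine funext fun c => ?_
        exact congrArg Subtype.val (congrFun hx c)
      refine Subtype.ext (hQ.1 x fun y => ?_)
      change Q (x + y) - Q x - Q y = 0
      rw [← hyperbolicForm_extendMap hφ, ← hyperbolicForm_extendMap hφ,
        ← hyperbolicForm_extendMap hφ, map_add, h0]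
      simp
    have := Module.Finite.of_injective _ hg
    exact Module.Finite.iff_fg.1 this
  · rw [← hyperbolicForm_extendMap hφ, hyperbolicForm_apply]
    exact sum_mem fun i _ => mul_mem (hx _) (hx _)

/-- A map on `L` extends to a primitive map on its saturation. -/
theorem exists_primitive_extension {ϖ : 𝒪[F]} (hϖ : Irreducible ϖ)
    (φ : L →ₗ[𝒪[F]] (Fin k ⊕ Fin k → 𝒪[F])) :
    ∃ φ' : saturation φ →ₗ[𝒪[F]] (Fin k ⊕ Fin k → 𝒪[F]), IsPrimitive ϖ φ' ∧
      φ' ∘ₗ Submodule.inclusion (le_saturation φ) = φ := by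
  have hϖ0 : (ϖ : F) ≠ 0 := by simpa using hϖ.ne_zero
  refine ⟨saturationMap φ, fun x hx => ?_, ?_⟩
  · rw [mem_powSub_pi] at hx
    have hy : (ϖ : F)⁻¹ • (x : V) ∈ saturation φ := by
      intro c
      obtain ⟨z, hz⟩ := hx c
      have h1 : extendMap φ (x : V) c = (ϖ : F) * z := by
        have := congrArg Subtype.val hz
        exact this.trans (by simp)
      rw [map_smul, Pi.smul_apply, h1, smul_eq_mul, inv_mul_cancel_left₀ hϖ0]
      exact z.2
    refine mem_powSub.2 ⟨⟨_, hy⟩, Subtype.ext ?_⟩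
    rw [pow_one]
    exact smul_inv_smul₀ hϖ0 (x : V)
  · refine LinearMap.ext fun x => funext fun c => Subtype.ext ?_
    exact extendMap_apply φ x c

end Saturation

/-! ### The local density as a sum over overlattices -/

section Sum

variable {F : Type*} [Field F] [ValuativeRel F] [TopologicalSpace F] [IsNonarchimedeanLocalField F]
  {V : Type*} [AddCommGroup V] [Module F V]

/-- The local density of `L` is a sum over the integral overlattices `L'` of contributions that
depend only on the reduction of `L'` and on its index over `L`: every approximate isometry of `L`
extends to a primitive map on exactly one `L'`. -/
theorem localDensity_eq_sum (Q : QuadraticForm F V) (hQ : Q.polarBilin.Nondegenerate)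
    (L : Submodule 𝒪[F] V) [Submodule.IsLattice F L] (hL : IsIntegralOn Q L)
    [Fintype (integralOverlattices Q L)] (k : ℕ) :
    localDensity (latticeForm Q L hL) k ≠ ∞ ∧
    (localDensity (latticeForm Q L hL) k).toReal =
      (Nat.card (ResidueField 𝒪[F]) : ℝ) ^
        ((Fintype.card (UpperPair (Module.finrank 𝒪[F] L)) : ℤ) -
          Fintype.card (Coord (Module.finrank 𝒪[F] L) k)) *
      ∑ L' : integralOverlattices Q L,
        (isometryCount (reducedForm (latticeForm Q L'.1 L'.2.2.2)) k : ℝ) *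
        (Nat.card (ResidueField 𝒪[F]) : ℝ) ^
          (((Module.length 𝒪[F] (L'.1 ⧸ L.submoduleOf L'.1)).toNat : ℤ) *
            (Module.finrank 𝒪[F] L + 1 - 2 * k)) := by
  have := isAdicComplete_integer F
  have := t2Space_integer F
  obtain ⟨ϖ, hϖ⟩ := IsDiscreteValuationRing.exists_irreducible 𝒪[F]
  set n := Module.finrank 𝒪[F] L with hn
  choose b b' t hi hlen using fun L' : integralOverlattices Q L =>
    exists_adapted_bases hϖ L'.2.1 L'.2.2.1
  set q := latticeForm Q L hL with hq
  set f := Nat.card (ResidueField 𝒪[F]) with hf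
  have hf0 : (f : ℝ) ≠ 0 := by exact_mod_cast (Nat.card_pos (α := ResidueField 𝒪[F])).ne'
  -- a bound for all exponents, which gives uniform sections of the differentials along the fibre
  set c := ∑ L', ∑ j, t L' j with hc
  have htc : ∀ L' j, t L' j ≤ c := fun L' j =>
    (Finset.single_le_sum (f := t L') (fun _ _ => Nat.zero_le _) (Finset.mem_univ j)).trans
      (Finset.single_le_sum (f := fun L' => ∑ j, t L' j) (fun _ _ => Nat.zero_le _)
        (Finset.mem_univ L'))
  have hext : ∀ φ ∈ isometrySet q k, ∃ L' : integralOverlattices Q L,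
      ∃ φ' : L'.1 →ₗ[𝒪[F]] (Fin k ⊕ Fin k → 𝒪[F]), IsPrimitive ϖ φ' ∧
        φ' ∘ₗ Submodule.inclusion L'.2.1 = φ := fun φ hφ =>
    ⟨⟨saturation φ, saturation_mem hQ hφ⟩, exists_primitive_extension hϖ φ⟩
  obtain ⟨M₀, hM₀⟩ := localDensity_mul_eq hϖ q k (2 * c) (by
    intro φ hφ
    obtain ⟨L', φ', hφ', rfl⟩ := hext φ hφ
    exact exists_section_of_comp hϖ (hi L') (htc L') hφ') (c + 1)
  set M := max M₀ (2 * c + 1) with hM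
  obtain ⟨hnear, hα⟩ := hM₀ M (le_max_left _ _)
  have hMc : 2 * c + 1 ≤ M := le_max_right _ _
  let U : integralOverlattices Q L → Set (L →ₗ[𝒪[F]] (Fin k ⊕ Fin k → 𝒪[F])) := fun L' =>
    {φ | pullbackMap 𝒪[F] L k φ - q ∈ powSub (QuadraticForm 𝒪[F] L) ϖ M ∧
      ∃ φ' : L'.1 →ₗ[𝒪[F]] (Fin k ⊕ Fin k → 𝒪[F]), IsPrimitive ϖ φ' ∧
        φ' ∘ₗ Submodule.inclusion L'.2.1 = φ}
  -- an approximate isometry is close to an isometry, so it extends to the same overlattice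
  have hT : {φ | pullbackMap 𝒪[F] L k φ - q ∈ powSub (QuadraticForm 𝒪[F] L) ϖ M} =
      {φ | ∃ L' ∈ Finset.univ, φ ∈ U L'} := by
    ext φ
    constructor
    · intro h
      obtain ⟨φ₀, hφ₀, hd⟩ := hnear φ h
      obtain ⟨L', hL'⟩ := hext φ₀ hφ₀
      refine ⟨L', Finset.mem_univ _, h, exists_isPrimitive_of_sub_mem (hi L') (htc L') hL' ?_⟩
      rw [← neg_sub]
      exact neg_mem hd
    · rintro ⟨L', _, h⟩
      exact h.1
  have : Finite ((L →ₗ[𝒪[F]] (Fin k ⊕ Fin k → 𝒪[F])) ⧸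
      powSub (L →ₗ[𝒪[F]] (Fin k ⊕ Fin k → 𝒪[F])) ϖ M) :=
    finite_quotient_powSub (Module.Basis.ofEquivFun (coordEquiv (Module.finBasis 𝒪[F] L) k)) hϖ M
  have hsum := cardMod_iUnion (powSub (L →ₗ[𝒪[F]] (Fin k ⊕ Fin k → 𝒪[F])) ϖ M) Finset.univ U
    (by
      intro L' _ φ ψ hφ hd
      refine ⟨?_, exists_isPrimitive_of_sub_mem (hi L') (htc L') hφ.2
        (powSub_anti ϖ (show c + 1 ≤ M by omega) hd)⟩
      exact comp_form_mem_of_comp_mem (i := LinearMap.id) hφ.1 hd)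
    (by
      rintro L₁ _ L₂ _ φ ⟨_, φ₁, h₁, e₁⟩ ⟨_, φ₂, h₂, e₂⟩
      refine Subtype.ext ?_
      rw [eq_saturation hϖ L₁.2.1 h₁, eq_saturation hϖ L₂.2.1 h₂, e₁, e₂])
  have hU : ∀ L', (cardMod (powSub (L →ₗ[𝒪[F]] (Fin k ⊕ Fin k → 𝒪[F])) ϖ M) (U L') : ℝ) *
      (f : ℝ) ^ (M * Fintype.card (UpperPair n)) =
      (f : ℝ) ^ ((M - 1) * Fintype.card (Coord n k)) * (f : ℝ) ^ Fintype.card (UpperPair n) *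
      ((isometryCount (reducedForm (latticeForm Q L'.1 L'.2.2.2)) k : ℝ) *
        (f : ℝ) ^ (((Module.length 𝒪[F] (L'.1 ⧸ L.submoduleOf L'.1)).toNat : ℤ) *
            (n + 1 - 2 * k))) := by
    intro L'
    have h1 := cardMod_primitive (k := k) hϖ (hi L') (M := M) (by omega)
      (fun j => by have := htc L' j; omega) (latticeForm Q L'.1 L'.2.2.2)
    rw [cardMod_primitive_one hϖ (b' L')] at h1
    rw [hlen L', ENat.toNat_natCast]
    have h2 : (f : ℝ) ^ (((∑ j, t L' j : ℕ) : ℤ) * (n + 1 - 2 * k)) *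
        (f : ℝ) ^ (2 * k * ∑ j, t L' j) = (f : ℝ) ^ ((n + 1) * ∑ j, t L' j) := by
      rw [← zpow_natCast, ← zpow_natCast, ← zpow_add₀ hf0]
      congr 1
      push_cast
      ring
    refine mul_right_cancel₀ (pow_ne_zero (2 * k * ∑ j, t L' j) hf0) ?_
    have h3 : (_ : ℝ) = _ := congrArg (Nat.cast (R := ℝ)) h1
    push_cast at h3
    rw [mul_right_comm]
    refine h3.trans ?_
    rw [← h2]
    ring
  rw [hT, hsum] at hα
  have hfin : localDensity q k ≠ ∞ := by
    intro h
    rw [h, ENNReal.top_mul (pow_ne_zero _ (by exact_mod_cast hf0))] at hα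
    exact ENNReal.mul_ne_top (ENNReal.pow_ne_top (ENNReal.natCast_ne_top _))
      (ENNReal.natCast_ne_top _) hα.symm
  refine ⟨hfin, ?_⟩
  have h4 := congrArg ENNReal.toReal hα
  rw [ENNReal.toReal_mul, ENNReal.toReal_mul] at h4
  simp only [ENNReal.toReal_pow, ENNReal.toReal_natCast] at h4
  refine mul_right_cancel₀ (pow_ne_zero (M * Fintype.card (Coord n k)) hf0) ?_
  rw [h4, Nat.cast_sum, Finset.mul_sum]
  rw [mul_assoc, Finset.sum_mul, Finset.mul_sum]
  refine Finset.sum_congr rfl fun L' _ => ?_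
  rw [mul_comm, hU, zpow_sub₀ hf0, zpow_natCast, zpow_natCast]
  have h5 : (f : ℝ) ^ (M * Fintype.card (Coord n k)) =
      (f : ℝ) ^ ((M - 1) * Fintype.card (Coord n k)) * (f : ℝ) ^ Fintype.card (Coord n k) := by
    rw [← pow_add, ← Nat.succ_mul, Nat.succ_eq_add_one, Nat.sub_add_cancel (by omega)]
  rw [h5]
  have := pow_ne_zero (Fintype.card (Coord n k)) hf0
  field_simp

end Sum

/-! ### Counting embeddings of quadratic spaces over a finite field -/

section Embeddings

variable {K W W' U U' : Type*} [Field K] [AddCommGroup W] [Module K W] [AddCommGroup W']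
  [Module K W'] [AddCommGroup U] [Module K U] [AddCommGroup U'] [Module K U']

/-- The number of injective isometries from `(W, g)` to `(U, h)`. -/
noncomputable def embCount (g : QuadraticForm K W) (h : QuadraticForm K U) : ℕ :=
  Nat.card {ψ : W →ₗ[K] U // Function.Injective ψ ∧ ∀ x, h (ψ x) = g x}

theorem embCount_congr {g : QuadraticForm K W} {g' : QuadraticForm K W'} {h : QuadraticForm K U}
    {h' : QuadraticForm K U'} (e : g.IsometryEquiv g') (e' : h.IsometryEquiv h') :
    embCount g h = embCount g' h' := by
  refine Nat.card_congr
    { toFun ψ := ⟨e'.toLinearEquiv.toLinearMap ∘ₗ ψ.1 ∘ₗ e.symm.toLinearEquiv.toLinearMap,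
        e'.injective.comp (ψ.2.1.comp e.symm.injective), fun x => ?_⟩
      invFun ψ := ⟨e'.symm.toLinearEquiv.toLinearMap ∘ₗ ψ.1 ∘ₗ e.toLinearEquiv.toLinearMap,
        e'.symm.injective.comp (ψ.2.1.comp e.injective), fun x => ?_⟩
      left_inv ψ := ?_
      right_inv ψ := ?_ }
  · exact (e'.map_app _).trans ((ψ.2.2 _).trans (e.symm.map_app _))
  · exact (e'.symm.map_app _).trans ((ψ.2.2 _).trans (e.map_app _))
  · refine Subtype.ext (LinearMap.ext fun x => ?_)
    change e'.symm (e' (ψ.1 (e.symm (e x)))) = _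
    rw [QuadraticMap.IsometryEquiv.symm_apply_apply, QuadraticMap.IsometryEquiv.symm_apply_apply]
  · refine Subtype.ext (LinearMap.ext fun x => ?_)
    change e' (e'.symm (ψ.1 (e (e.symm x)))) = _
    rw [QuadraticMap.IsometryEquiv.apply_symm_apply, QuadraticMap.IsometryEquiv.apply_symm_apply]

/-- If the orthogonal group of `(U, h)` acts transitively on the vectors of a given norm, embeddings
may be counted with the image of one vector prescribed. -/
theorem embCount_eq_mul (g : QuadraticForm K W) (h : QuadraticForm K U) {e : W} (he : e ≠ 0)
    (u₀ : U) (htrans : ∀ u, u ≠ 0 → h u = g e → ∃ σ : h.IsometryEquiv h, σ u₀ = u) :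
    embCount g h = Nat.card {u : U // u ≠ 0 ∧ h u = g e} *
      Nat.card {ψ : W →ₗ[K] U // (Function.Injective ψ ∧ ∀ x, h (ψ x) = g x) ∧ ψ e = u₀} := by
  have : Nonempty (h.IsometryEquiv h) := ⟨QuadraticMap.IsometryEquiv.refl h⟩
  choose! σ hσ using htrans
  rw [← Nat.card_prod]
  refine Nat.card_congr
    { toFun ψ := (⟨ψ.1 e, fun h0 => he (ψ.2.1 (h0.trans (map_zero _).symm)), ψ.2.2 e⟩,
        ⟨(σ (ψ.1 e)).symm.toLinearEquiv.toLinearMap ∘ₗ ψ.1,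
          ⟨(σ (ψ.1 e)).symm.injective.comp ψ.2.1,
          fun x => ((σ (ψ.1 e)).symm.map_app _).trans (ψ.2.2 _)⟩, ?_⟩)
      invFun p := ⟨(σ p.1.1).toLinearEquiv.toLinearMap ∘ₗ p.2.1,
        (σ p.1.1).injective.comp p.2.2.1.1, fun x => ((σ p.1.1).map_app _).trans (p.2.2.1.2 _)⟩
      left_inv ψ := ?_
      right_inv p := ?_ }
  · have := hσ (ψ.1 e) (fun h0 => he (ψ.2.1 (h0.trans (map_zero _).symm))) (ψ.2.2 e)
    change (σ (ψ.1 e)).symm (ψ.1 e) = u₀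
    nth_rw 2 [← this]
    exact (σ (ψ.1 e)).symm_apply_apply u₀
  · refine Subtype.ext (LinearMap.ext fun x => ?_)
    exact (σ (ψ.1 e)).apply_symm_apply _
  · obtain ⟨⟨u, hu⟩, ⟨ψ, hψ, hψe⟩⟩ := p
    have h1 : σ u (ψ e) = u := by rw [hψe]; exact hσ u hu.1 hu.2
    refine Prod.ext (Subtype.ext h1) (Subtype.ext (LinearMap.ext fun x => ?_))
    change (σ (σ u (ψ e))).symm (σ u (ψ x)) = ψ x
    rw [h1]
    exact (σ u).symm_apply_apply _

/-- The orthogonal sum of a hyperbolic plane and `(U, h)`. -/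
def hypExt (h : QuadraticForm K U) : QuadraticForm K (K × K × U) :=
  QuadraticMap.linMulLin (LinearMap.fst K K (K × U)) (LinearMap.fst K K U ∘ₗ LinearMap.snd K K (K × U)) +
    h.comp (LinearMap.snd K K U ∘ₗ LinearMap.snd K K (K × U))

@[simp]
theorem hypExt_apply (h : QuadraticForm K U) (a b : K) (z : U) :
    hypExt h (a, b, z) = a * b + h z := by
  simp [hypExt]

theorem polar_hypExt (h : QuadraticForm K U) (a b a' b' : K) (z z' : U) :
    QuadraticMap.polar (hypExt h) (a, b, z) (a', b', z') =
      a * b' + a' * b + QuadraticMap.polar h z z' := by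
  simp only [QuadraticMap.polar, Prod.mk_add_mk, hypExt_apply]
  ring

/-- `H_{k + 1}` is the orthogonal sum of a hyperbolic plane and `H_k`. -/
def hyperbolicSucc (K : Type*) [Field K] (k : ℕ) :
    (hyperbolicForm K (k + 1)).IsometryEquiv (hypExt (hyperbolicForm K k)) where
  toFun x := (x (Sum.inl 0), x (Sum.inr 0),
    Sum.elim (fun i => x (Sum.inl i.succ)) (fun i => x (Sum.inr i.succ)))
  invFun p := Sum.elim (Fin.cons p.1 fun i => p.2.2 (Sum.inl i))
    (Fin.cons p.2.1 fun i => p.2.2 (Sum.inr i))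
  map_add' x y := by
    refine Prod.ext rfl (Prod.ext rfl ?_)
    ext (i | i) <;> rfl
  map_smul' a x := by
    refine Prod.ext rfl (Prod.ext rfl ?_)
    ext (i | i) <;> rfl
  left_inv x := by
    ext (i | i) <;> refine Fin.cases ?_ (fun i => ?_) i <;> rfl
  right_inv p := by
    refine Prod.ext rfl (Prod.ext rfl ?_)
    ext (i | i) <;> rfl
  map_app' x := by
    simp [hyperbolicForm_apply, Fin.sum_univ_succ]

/-- The orthogonal transformation that scales the two isotropic lines. -/
def hypScale (h : QuadraticForm K U) (c : Kˣ) : (hypExt h).IsometryEquiv (hypExt h) where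
  toFun p := (c * p.1, (↑c⁻¹ : K) * p.2.1, p.2.2)
  invFun p := ((↑c⁻¹ : K) * p.1, c * p.2.1, p.2.2)
  map_add' p p' := by simp [mul_add]
  map_smul' a p := by simp [mul_left_comm]
  left_inv p := by simp
  right_inv p := by simp
  map_app' := by
    rintro ⟨a, b, z⟩
    have := c.mul_inv
    change hypExt h (c * a, (↑c⁻¹ : K) * b, z) = _
    rw [hypExt_apply, hypExt_apply]
    linear_combination (a * b) * this

/-- The orthogonal transformation that exchanges the two isotropic lines. -/
def hypSwap (h : QuadraticForm K U) : (hypExt h).IsometryEquiv (hypExt h) where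
  toFun p := (p.2.1, p.1, p.2.2)
  invFun p := (p.2.1, p.1, p.2.2)
  map_add' p p' := rfl
  map_smul' a p := rfl
  left_inv p := rfl
  right_inv p := rfl
  map_app' := by
    rintro ⟨a, b, z⟩
    change hypExt h (b, a, z) = _
    rw [hypExt_apply, hypExt_apply, mul_comm]

/-- The Eichler transformation belonging to `w`; it fixes the vector `(1, 0, 0)`. -/
def eichler (h : QuadraticForm K U) (w : U) : (hypExt h).IsometryEquiv (hypExt h) where
  toFun p := (p.1 - QuadraticMap.polar h p.2.2 w - p.2.1 * h w, p.2.1, p.2.2 + p.2.1 • w)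
  invFun p := (p.1 + QuadraticMap.polar h p.2.2 w - p.2.1 * h w, p.2.1, p.2.2 - p.2.1 • w)
  map_add' p p' := by
    refine Prod.ext ?_ (Prod.ext rfl ?_)
    · simp only [Prod.fst_add, Prod.snd_add, QuadraticMap.polar_add_left]
      ring
    · simp only [Prod.snd_add, Prod.fst_add, add_smul]
      abel
  map_smul' a p := by
    refine Prod.ext ?_ (Prod.ext rfl ?_)
    · simp only [Prod.smul_fst, Prod.smul_snd, QuadraticMap.polar_smul_left, smul_eq_mul,
        RingHom.id_apply]
      ring
    · simp only [Prod.smul_snd, Prod.smul_fst, smul_eq_mul, RingHom.id_apply, mul_smul, smul_add]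
  left_inv p := by
    refine Prod.ext ?_ (Prod.ext rfl ?_)
    · simp only [QuadraticMap.polar_add_left, QuadraticMap.polar_smul_left, QuadraticMap.polar_self,
        smul_eq_mul]
      ring
    · simp
  right_inv p := by
    refine Prod.ext ?_ (Prod.ext rfl ?_)
    · simp only [sub_eq_add_neg, QuadraticMap.polar_add_left, QuadraticMap.polar_neg_left,
        QuadraticMap.polar_smul_left, QuadraticMap.polar_self, smul_eq_mul]
      ring
    · simp
  map_app' := by
    rintro ⟨a, b, z⟩
    change hypExt h (a - QuadraticMap.polar h z w - b * h w, b, z + b • w) = _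
    rw [hypExt_apply, hypExt_apply, QuadraticMap.map_add (⇑h), QuadraticMap.map_smul,
      QuadraticMap.polar_smul_right, smul_eq_mul, smul_eq_mul]
    ring

theorem eichler_apply (h : QuadraticForm K U) (w : U) (a b : K) (z : U) :
    eichler h w (a, b, z) = (a - QuadraticMap.polar h z w - b * h w, b, z + b • w) := rfl

/-- By Eichler transformations, the orthogonal group acts transitively on the nonzero vectors of a given
norm `c`, isotropic ones included. -/
theorem hypExt_transitive (h : QuadraticForm K U)
    (hU : ∀ z, (∀ w, QuadraticMap.polar h z w = 0) → z = 0) (c : K) (u : K × K × U) (hu : u ≠ 0)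
    (huc : hypExt h u = c) : ∃ σ : (hypExt h).IsometryEquiv (hypExt h), σ (1, c, 0) = u := by
  suffices H : ∃ σ : (hypExt h).IsometryEquiv (hypExt h), σ u = (c, 1, 0) by
    obtain ⟨σ, hσ⟩ := H
    refine ⟨(hypSwap h).trans σ.symm, ?_⟩
    change σ.symm (c, 1, 0) = u
    rw [← hσ]
    exact σ.symm_apply_apply u
  -- it suffices to make the second coordinate nonzero
  have h1 : ∀ u : K × K × U, hypExt h u = c → u.2.1 ≠ 0 →
      ∃ σ : (hypExt h).IsometryEquiv (hypExt h), σ u = (c, 1, 0) := by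
    rintro ⟨a, b, z⟩ hc hb
    refine ⟨(hypScale h (Units.mk0 b hb)).trans (eichler h (-z)), ?_⟩
    have h2 : hypScale h (Units.mk0 b hb) (a, b, z) = (b * a, 1, z) := by
      change (b * a, b⁻¹ * b, z) = _
      rw [inv_mul_cancel₀ hb]
    change eichler h (-z) (hypScale h (Units.mk0 b hb) (a, b, z)) = _
    rw [h2, eichler_apply, QuadraticMap.polar_neg_right, QuadraticMap.polar_self,
      QuadraticMap.map_neg, one_smul, add_neg_cancel, ← hc, hypExt_apply, two_smul]
    refine Prod.ext ?_ rfl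
    simp only
    ring
  obtain ⟨a, b, z⟩ := u
  by_cases hb : b = 0
  swap
  · exact h1 _ huc hb
  by_cases ha : a = 0
  swap
  · obtain ⟨σ, hσ⟩ := h1 (b, a, z) (by rw [← huc, hypExt_apply, hypExt_apply, mul_comm]) ha
    exact ⟨(hypSwap h).trans σ, hσ⟩
  have hz : z ≠ 0 := by
    rintro rfl
    exact hu (by rw [ha, hb]; rfl)
  obtain ⟨w, hw⟩ : ∃ w, QuadraticMap.polar h z w ≠ 0 := by
    by_contra! H
    exact hz (hU z H)
  subst ha hb
  obtain ⟨σ, hσ⟩ := h1 (hypSwap h (eichler h w (0, 0, z))) (by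
      rw [QuadraticMap.IsometryEquiv.map_app, QuadraticMap.IsometryEquiv.map_app, huc]) (by
    rw [eichler_apply]
    change 0 - QuadraticMap.polar h z w - 0 * h w ≠ 0
    simpa using hw)
  exact ⟨((eichler h w).trans (hypSwap h)).trans σ, hσ⟩

/-- The number of vectors of norm `c` in the orthogonal sum of a hyperbolic plane and `U`: according to
whether the first coordinate is nonzero or zero, the second one is determined or free. -/
theorem card_hypExt_eq [Finite K] [Finite U] (h : QuadraticForm K U) (c : K) :
    Nat.card {u : K × K × U // hypExt h u = c} =
      (Nat.card K - 1) * Nat.card U + Nat.card K * Nat.card {z : U // h z = c} := by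
  classical
  have e : {u : K × K × U // hypExt h u = c} ≃ (Kˣ × U) ⊕ (K × {z : U // h z = c}) :=
    { toFun u := if ha : u.1.1 = 0 then
          Sum.inr (u.1.2.1, ⟨u.1.2.2, by
            have := u.2
            rw [show u.1 = (u.1.1, u.1.2.1, u.1.2.2) from rfl, hypExt_apply, ha] at this
            simpa using this⟩)
        else Sum.inl (Units.mk0 _ ha, u.1.2.2)
      invFun := Sum.elim (fun p => ⟨(p.1, (↑p.1⁻¹ : K) * (c - h p.2), p.2), by simp⟩)
        (fun p => ⟨(0, p.1, p.2.1), by simp [p.2.2]⟩)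
      left_inv := by
        rintro ⟨⟨a, b, z⟩, hu⟩
        rw [hypExt_apply] at hu
        by_cases ha : a = 0
        · simp [ha]
        · simp only [ha, dite_false, Sum.elim_inl]
          refine Subtype.ext (Prod.ext rfl (Prod.ext ?_ rfl))
          simp only [← hu, add_sub_cancel_right]
          simp [ha]
      right_inv := by
        rintro (⟨a, z⟩ | ⟨b, z, hz⟩)
        · simp
        · simp }
  rw [Nat.card_congr e, Nat.card_sum, Nat.card_prod, Nat.card_prod, Nat.card_units]

end Embeddings

section Recursion

variable {K W U : Type*} [Field K] [AddCommGroup W] [Module K W] [AddCommGroup U] [Module K U]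

theorem polar_eq_of_isometry {W : Type*} [AddCommGroup W] [Module K W] {g : QuadraticForm K W}
    {h : QuadraticForm K U} {ψ : W →ₗ[K] U}
    (hψ : ∀ x, h (ψ x) = g x) (x y : W) :
    QuadraticMap.polar h (ψ x) (ψ y) = QuadraticMap.polar g x y := by
  simp only [QuadraticMap.polar, ← map_add, hψ]

/-- Embeddings of the orthogonal sum of a totally singular line and `W`. If the line goes to the first
isotropic line of the hyperbolic plane, the second coordinate vanishes on the image of `W`, the first
one is an arbitrary linear form on `W`, and the third one is an embedding of `W`. -/
theorem embCount_zeroExt (g : QuadraticForm K W) (h : QuadraticForm K U)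
    (hU : ∀ z, (∀ w, QuadraticMap.polar h z w = 0) → z = 0) :
    embCount (g.comp (LinearMap.snd K K W)) (hypExt h) =
      Nat.card {u : K × K × U // u ≠ 0 ∧ hypExt h u = 0} *
        (Nat.card (W →ₗ[K] K) * embCount g h) := by
  have he : ((1, 0) : K × W) ≠ 0 := fun h0 => one_ne_zero (congrArg Prod.fst h0)
  have hge : g.comp (LinearMap.snd K K W) (1, 0) = 0 := by simp
  rw [embCount_eq_mul _ _ he (1, 0, 0) (by rw [hge]; exact hypExt_transitive h hU 0), hge]
  congr 1
  rw [embCount, ← Nat.card_prod]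
  let X := {ψ : K × W →ₗ[K] K × K × U // (Function.Injective ψ ∧
      ∀ x, hypExt h (ψ x) = g.comp (LinearMap.snd K K W) x) ∧ ψ (1, 0) = (1, 0, 0)}
  let Y := {ψ : W →ₗ[K] U // Function.Injective ψ ∧ ∀ x, h (ψ x) = g x}
  have h0 : ∀ (ψ : X) w, (ψ.1 (0, w)).2.1 = 0 := by
    rintro ⟨ψ, ⟨h1, h2⟩, h3⟩ w
    have h4 := polar_eq_of_isometry h2 (1, 0) (0, w)
    rw [h3, show ψ (0, w) = ((ψ (0, w)).1, (ψ (0, w)).2.1, (ψ (0, w)).2.2) from rfl,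
      polar_hypExt] at h4
    simpa [QuadraticMap.polar] using h4
  refine Nat.card_congr
    { toFun := fun ψ : X => (LinearMap.fst K K (K × U) ∘ₗ ψ.1 ∘ₗ LinearMap.inr K K W,
        ⟨LinearMap.snd K K U ∘ₗ LinearMap.snd K K (K × U) ∘ₗ ψ.1 ∘ₗ LinearMap.inr K K W, ?_, ?_⟩)
      invFun := fun p : (W →ₗ[K] K) × Y => ⟨(LinearMap.fst K K W + p.1 ∘ₗ LinearMap.snd K K W).prod
        ((0 : K × W →ₗ[K] K).prod (p.2.1 ∘ₗ LinearMap.snd K K W)), ⟨?_, ?_⟩, ?_⟩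
      left_inv ψ := ?_
      right_inv p := ?_ }
  · rw [injective_iff_map_eq_zero]
    intro w hw
    have h1 : ψ.1 (0, w) = ψ.1 ((ψ.1 (0, w)).1, 0) := by
      have h2 : ψ.1 ((ψ.1 (0, w)).1, 0) = (ψ.1 (0, w)).1 • ψ.1 (1, 0) := by
        rw [← map_smul]; simp
      rw [h2, ψ.2.2]
      refine Prod.ext (by simp) (Prod.ext ?_ ?_)
      · rw [h0]; simp
      · rw [show (ψ.1 (0, w)).2.2 = 0 from hw]; simp
    exact congrArg Prod.snd (ψ.2.1.1 h1)
  · intro w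
    have h1 := ψ.2.1.2 (0, w)
    rw [show ψ.1 (0, w) = ((ψ.1 (0, w)).1, (ψ.1 (0, w)).2.1, (ψ.1 (0, w)).2.2) from rfl,
      hypExt_apply, h0] at h1
    simpa using h1
  · rw [injective_iff_map_eq_zero]
    rintro ⟨t, w⟩ hw
    have h1 : p.2.1 w = 0 := congrArg (fun x => x.2.2) hw
    have h2 : w = 0 := p.2.2.1 (h1.trans (map_zero _).symm)
    subst h2
    have h3 : t + p.1 0 = 0 := congrArg Prod.fst hw
    rw [map_zero, add_zero] at h3
    rw [h3]; rfl
  · rintro ⟨t, w⟩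
    change hypExt h (t + p.1 w, 0, p.2.1 w) = g w
    rw [hypExt_apply, p.2.2.2, mul_zero, zero_add]
  · change ((1 : K) + p.1 0, (0 : K), p.2.1 0) = _
    simp
  · refine Subtype.ext (LinearMap.ext ?_)
    rintro ⟨t, w⟩
    have h2 : ψ.1 (t, w) = t • ψ.1 (1, 0) + ψ.1 (0, w) := by
      rw [← map_smul, ← map_add]; simp
    rw [h2, ψ.2.2]
    refine Prod.ext ?_ (Prod.ext ?_ ?_)
    · change t + (ψ.1 (0, w)).1 = _
      simp
    · change (0 : K) = _
      simp [h0]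
    · change (ψ.1 (0, w)).2.2 = _
      simp
  · refine Prod.ext ?_ (Subtype.ext ?_)
    · refine LinearMap.ext fun w => ?_
      change 0 + p.1 w = _
      rw [zero_add]
    · rfl

/-- Embeddings of the orthogonal sum of a hyperbolic plane and `W`. The image of a hyperbolic pair is
brought into standard position by an Eichler transformation, and the rest is an embedding of `W`. -/
theorem embCount_hypExt (g : QuadraticForm K W) (h : QuadraticForm K U)
    (hU : ∀ z, (∀ w, QuadraticMap.polar h z w = 0) → z = 0) :
    embCount (hypExt g) (hypExt h) =
      Nat.card {u : K × K × U // u ≠ 0 ∧ hypExt h u = 0} * (Nat.card U * embCount g h) := by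
  have he : ((1, 0, 0) : K × K × W) ≠ 0 := fun h0 => one_ne_zero (congrArg Prod.fst h0)
  have hge : hypExt g (1, 0, 0) = 0 := by simp
  rw [embCount_eq_mul _ _ he (1, 0, 0) (by rw [hge]; exact hypExt_transitive h hU 0), hge]
  congr 1
  rw [embCount, ← Nat.card_prod]
  let X := {ψ : K × K × W →ₗ[K] K × K × U // (Function.Injective ψ ∧
      ∀ x, hypExt h (ψ x) = hypExt g x) ∧ ψ (1, 0, 0) = (1, 0, 0)}
  let Y := {ψ : W →ₗ[K] U // Function.Injective ψ ∧ ∀ x, h (ψ x) = g x}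
  let χ : X → (K × K × W →ₗ[K] K × K × U) := fun ψ =>
    (eichler h (ψ.1 (0, 1, 0)).2.2).symm.toLinearEquiv.toLinearMap ∘ₗ ψ.1
  have hχ : ∀ ψ x, hypExt h (χ ψ x) = hypExt g x := fun ψ x =>
    ((eichler h (ψ.1 (0, 1, 0)).2.2).symm.map_app (ψ.1 x)).trans (ψ.2.1.2 x)
  have hχi : ∀ ψ, Function.Injective (χ ψ) := fun ψ =>
    (eichler h (ψ.1 (0, 1, 0)).2.2).symm.injective.comp ψ.2.1.1
  have hχ1 : ∀ ψ, χ ψ (1, 0, 0) = (1, 0, 0) := by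
    intro ψ
    change (eichler h _).symm (ψ.1 (1, 0, 0)) = _
    rw [QuadraticMap.IsometryEquiv.symm_apply_eq, ψ.2.2, eichler_apply]
    simp [QuadraticMap.polar]
  have hψ2 : ∀ ψ : X, eichler h (ψ.1 (0, 1, 0)).2.2 (0, 1, 0) = ψ.1 (0, 1, 0) := by
    intro ψ
    have h1 := polar_eq_of_isometry ψ.2.1.2 (1, 0, 0) (0, 1, 0)
    rw [ψ.2.2, show ψ.1 (0, 1, 0) = ((ψ.1 (0, 1, 0)).1, (ψ.1 (0, 1, 0)).2.1, (ψ.1 (0, 1, 0)).2.2)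
      from rfl, polar_hypExt, polar_hypExt] at h1
    have h2 := ψ.2.1.2 (0, 1, 0)
    rw [show ψ.1 (0, 1, 0) = ((ψ.1 (0, 1, 0)).1, (ψ.1 (0, 1, 0)).2.1, (ψ.1 (0, 1, 0)).2.2)
      from rfl, hypExt_apply, hypExt_apply] at h2
    have h3 : (ψ.1 (0, 1, 0)).2.1 = 1 := by simpa [QuadraticMap.polar] using h1
    rw [h3, map_zero] at h2
    rw [eichler_apply]
    refine Prod.ext ?_ (Prod.ext h3.symm ?_)
    · simp only [QuadraticMap.polar_zero_left]
      linear_combination -h2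
    · simp
  have hχ2 : ∀ ψ, χ ψ (0, 1, 0) = (0, 1, 0) := by
    intro ψ
    change (eichler h _).symm (ψ.1 (0, 1, 0)) = _
    rw [QuadraticMap.IsometryEquiv.symm_apply_eq, hψ2]
  have hχ3 : ∀ ψ w, χ ψ (0, 0, w) = (0, 0, (χ ψ (0, 0, w)).2.2) := by
    intro ψ w
    have h1 := polar_eq_of_isometry (hχ ψ) (1, 0, 0) (0, 0, w)
    have h2 := polar_eq_of_isometry (hχ ψ) (0, 1, 0) (0, 0, w)
    rw [hχ1, show χ ψ (0, 0, w) = ((χ ψ (0, 0, w)).1, (χ ψ (0, 0, w)).2.1, (χ ψ (0, 0, w)).2.2)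
      from rfl, polar_hypExt, polar_hypExt] at h1
    rw [hχ2, show χ ψ (0, 0, w) = ((χ ψ (0, 0, w)).1, (χ ψ (0, 0, w)).2.1, (χ ψ (0, 0, w)).2.2)
      from rfl, polar_hypExt, polar_hypExt] at h2
    refine Prod.ext ?_ (Prod.ext ?_ rfl)
    · simpa [QuadraticMap.polar] using h2
    · simpa [QuadraticMap.polar] using h1
  let ι : W →ₗ[K] K × K × W := LinearMap.inr K K (K × W) ∘ₗ LinearMap.inr K K W
  have hι : ∀ w, ι w = (0, 0, w) := fun w => rfl
  let p₃ : K × K × U →ₗ[K] U := LinearMap.snd K K U ∘ₗ LinearMap.snd K K (K × U)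
  let ext : (W →ₗ[K] U) → (K × K × W →ₗ[K] K × K × U) := fun ψ =>
    LinearMap.prodMap LinearMap.id (LinearMap.prodMap LinearMap.id ψ)
  have hext : ∀ ψ a b w, ext ψ (a, b, w) = (a, b, ψ w) := fun _ _ _ _ => rfl
  refine Nat.card_congr
    { toFun := fun ψ : X => ((ψ.1 (0, 1, 0)).2.2, ⟨p₃ ∘ₗ χ ψ ∘ₗ ι, ?_, ?_⟩)
      invFun := fun p : U × Y => ⟨(eichler h p.1).toLinearEquiv.toLinearMap ∘ₗ ext p.2.1, ⟨?_, ?_⟩, ?_⟩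
      left_inv ψ := ?_
      right_inv p := ?_ }
  · rw [injective_iff_map_eq_zero]
    intro w hw
    have h1 : χ ψ (0, 0, w) = 0 := by
      rw [hχ3, show (χ ψ (0, 0, w)).2.2 = 0 from hw]; rfl
    have h2 := hχi ψ (h1.trans (map_zero _).symm)
    exact congrArg (fun x => x.2.2) h2
  · intro w
    have h1 := hχ ψ (0, 0, w)
    rw [hχ3, hypExt_apply, hypExt_apply, mul_zero, zero_add, zero_add] at h1
    exact h1
  · refine (eichler h p.1).injective.comp ?_
    rintro ⟨a, b, w⟩ ⟨a', b', w'⟩ hab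
    rw [hext, hext] at hab
    simp only [Prod.mk.injEq] at hab
    rw [hab.1, hab.2.1, p.2.2.1 hab.2.2]
  · rintro ⟨a, b, w⟩
    refine ((eichler h p.1).map_app _).trans ?_
    rw [hext, hypExt_apply, hypExt_apply, p.2.2.2]
  · change eichler h p.1 (ext p.2.1 (1, 0, 0)) = _
    rw [hext, eichler_apply]
    simp [QuadraticMap.polar]
  · refine Subtype.ext (LinearMap.ext ?_)
    rintro ⟨a, b, w⟩
    change eichler h (ψ.1 (0, 1, 0)).2.2 (a, b, (χ ψ (0, 0, w)).2.2) = ψ.1 (a, b, w)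
    have h1 : (a, b, (χ ψ (0, 0, w)).2.2) = χ ψ (a, b, w) := by
      have h2 : χ ψ (a, b, w) = a • χ ψ (1, 0, 0) + b • χ ψ (0, 1, 0) + χ ψ (0, 0, w) := by
        rw [← map_smul, ← map_smul, ← map_add, ← map_add]; simp
      rw [h2, hχ1, hχ2, hχ3]
      simp
    rw [h1]
    exact QuadraticMap.IsometryEquiv.apply_symm_apply _ _
  · have h1 : (eichler h p.1 (ext p.2.1 (0, 1, 0))).2.2 = p.1 := by
      rw [hext, eichler_apply]; simp
    refine Prod.ext h1 (Subtype.ext (LinearMap.ext fun w => ?_))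
    change ((eichler h (eichler h p.1 (ext p.2.1 (0, 1, 0))).2.2).symm
      (eichler h p.1 (ext p.2.1 (0, 0, w)))).2.2 = _
    rw [h1, QuadraticMap.IsometryEquiv.symm_apply_apply]
    rfl

end Recursion

section Anisotropic

variable {K W U : Type*} [Field K] [AddCommGroup W] [Module K W] [AddCommGroup U] [Module K U]

theorem injective_of_anisotropic {g : QuadraticForm K W} (hg : ∀ x, g x = 0 → x = 0)
    {h : QuadraticForm K U} {ψ : W →ₗ[K] U} (hψ : ∀ x, h (ψ x) = g x) : Function.Injective ψ := by
  rw [injective_iff_map_eq_zero]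
  intro x hx
  exact hg x (by rw [← hψ, hx, QuadraticMap.map_zero])

theorem embCount_of_subsingleton [Subsingleton W] (g : QuadraticForm K W) (h : QuadraticForm K U) :
    embCount g h = 1 := by
  unfold embCount
  rw [Nat.card_eq_one_iff_unique]
  refine ⟨⟨fun ψ ψ' => Subtype.ext (LinearMap.ext fun x => ?_)⟩,
    ⟨0, Function.injective_of_subsingleton _, fun x => ?_⟩⟩
  · rw [Subsingleton.elim x 0, map_zero, map_zero]
  · rw [Subsingleton.elim x 0]; simp

theorem embCount_line {g : QuadraticForm K W} (hg : ∀ x, g x = 0 → x = 0)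
    (b : Module.Basis (Fin 1) K W) (h : QuadraticForm K U) :
    embCount g h = Nat.card {u : U // h u = g (b 0)} := by
  refine Nat.card_congr
    { toFun ψ := ⟨ψ.1 (b 0), ψ.2.2 _⟩
      invFun u := ⟨b.constr K fun _ => u.1, ?_⟩
      left_inv ψ := Subtype.ext (b.ext fun i => ?_)
      right_inv u := Subtype.ext (b.constr_basis K _ 0) }
  · have h1 : ∀ x, h (b.constr K (fun _ => u.1) x) = g x := by
      intro x
      rw [← b.sum_repr x]
      simp only [Fin.sum_univ_one, map_smul, Module.Basis.constr_basis, QuadraticMap.map_smul, u.2]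
    exact ⟨injective_of_anisotropic hg h1, h1⟩
  · rw [Module.Basis.constr_basis, Subsingleton.elim i 0]

/-- Embeddings of an anisotropic plane: the image of the first basis vector is brought into the position
`(1, c, 0)`; then the second coordinate of the image of the second one is determined by its first
coordinate `a`, and its third one has prescribed norm. -/
theorem embCount_plane {g : QuadraticForm K W} (hg : ∀ x, g x = 0 → x = 0)
    (b : Module.Basis (Fin 2) K W) (h : QuadraticForm K U)
    (hU : ∀ z, (∀ w, QuadraticMap.polar h z w = 0) → z = 0) :
    embCount g (hypExt h) = Nat.card {u : K × K × U // u ≠ 0 ∧ hypExt h u = g (b 0)} *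
      Nat.card ((a : K) × {z : U // h z = g (b 1 - a • b 0)}) := by
  rw [embCount_eq_mul _ _ (b.ne_zero 0) (1, g (b 0), 0) (hypExt_transitive h hU _)]
  congr 1
  let X := {ψ : W →ₗ[K] K × K × U // (Function.Injective ψ ∧ ∀ x, hypExt h (ψ x) = g x) ∧
    ψ (b 0) = (1, g (b 0), 0)}
  let Y := (a : K) × {z : U // h z = g (b 1 - a • b 0)}
  have hsub : ∀ a : K, g (b 1 - a • b 0) =
      g (b 1) - a * QuadraticMap.polar g (b 0) (b 1) + a * a * g (b 0) := by
    intro a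
    rw [sub_eq_add_neg, ← neg_smul, QuadraticMap.map_add (⇑g), QuadraticMap.polar_smul_right,
      QuadraticMap.map_smul, QuadraticMap.polar_comm, smul_eq_mul, smul_eq_mul]
    ring
  let v : Y → Fin 2 → K × K × U := fun p =>
    ![(1, g (b 0), 0), (p.1, QuadraticMap.polar g (b 0) (b 1) - p.1 * g (b 0), p.2.1)]
  have hψ1 : ∀ ψ : X, (ψ.1 (b 1)).2.1 =
      QuadraticMap.polar g (b 0) (b 1) - (ψ.1 (b 1)).1 * g (b 0) := by
    intro ψ
    have h1 := polar_eq_of_isometry ψ.2.1.2 (b 0) (b 1)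
    rw [ψ.2.2, show ψ.1 (b 1) = ((ψ.1 (b 1)).1, (ψ.1 (b 1)).2.1, (ψ.1 (b 1)).2.2) from rfl,
      polar_hypExt, QuadraticMap.polar_zero_left] at h1
    linear_combination h1
  refine Nat.card_congr
    { toFun := fun ψ : X => (⟨(ψ.1 (b 1)).1, (ψ.1 (b 1)).2.2, ?_⟩ : Y)
      invFun := fun p : Y => ⟨b.constr K (v p), ?_, ?_⟩
      left_inv ψ := Subtype.ext (b.ext fun i => ?_)
      right_inv p := ?_ }
  · have h1 := ψ.2.1.2 (b 1)
    rw [show ψ.1 (b 1) = ((ψ.1 (b 1)).1, (ψ.1 (b 1)).2.1, (ψ.1 (b 1)).2.2) from rfl,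
      hypExt_apply, hψ1] at h1
    rw [hsub]
    linear_combination h1
  · have h1 : ∀ x, hypExt h (b.constr K (v p) x) = g x := by
      intro x
      have h2 := p.2.2.trans (hsub _)
      rw [← b.sum_repr x]
      simp only [Fin.sum_univ_two, map_add, map_smul, Module.Basis.constr_basis, v,
        Matrix.cons_val_zero, Matrix.cons_val_one, Prod.smul_mk, Prod.mk_add_mk, hypExt_apply,
        smul_zero, zero_add, smul_eq_mul]
      rw [QuadraticMap.map_add (⇑g), QuadraticMap.map_smul, QuadraticMap.map_smul,
        QuadraticMap.map_smul, QuadraticMap.polar_smul_left, QuadraticMap.polar_smul_right, h2]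
      simp only [smul_eq_mul]
      ring
    exact ⟨injective_of_anisotropic hg h1, h1⟩
  · rw [Module.Basis.constr_basis]; rfl
  · rw [Module.Basis.constr_basis]
    fin_cases i
    · exact ψ.2.2.symm
    · refine Prod.ext rfl (Prod.ext ?_ rfl)
      exact (hψ1 ψ).symm
  · obtain ⟨a, z, hz⟩ := p
    have h1 : b.constr K (v ⟨a, z, hz⟩) (b 1) =
        (a, QuadraticMap.polar g (b 0) (b 1) - a * g (b 0), z) := by
      rw [Module.Basis.constr_basis]; rfl
    exact Sigma.subtype_ext (congrArg Prod.fst h1) (congrArg (fun x => x.2.2) h1)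

end Anisotropic

section Counting

variable {K : Type*} [Field K]

theorem hyperbolicForm_nondegenerate {k : ℕ} (z : Fin k ⊕ Fin k → K)
    (hz : ∀ w, QuadraticMap.polar (hyperbolicForm K k) z w = 0) : z = 0 := by
  ext c
  have := hz (dualVector K k (LinearMap.proj c))
  rwa [polar_dualVector] at this

variable [Finite K]

theorem card_hyperbolicForm_eq (k : ℕ) (c : K) :
    (Nat.card K : ℝ) * Nat.card {z : Fin k ⊕ Fin k → K // hyperbolicForm K k z = c} =
      (Nat.card K : ℝ) ^ (2 * k) - (Nat.card K : ℝ) ^ k +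
        open Classical in if c = 0 then (Nat.card K : ℝ) ^ (k + 1) else 0 := by
  classical
  induction k with
  | zero =>
    have h0 : ∀ z : Fin 0 ⊕ Fin 0 → K, hyperbolicForm K 0 z = 0 := fun z => by
      simp [hyperbolicForm_apply]
    simp only [h0]
    by_cases hc : c = 0
    · subst hc
      simp
    · simp [hc, Ne.symm hc]
  | succ k ih =>
    have h1 : Nat.card {z : Fin (k + 1) ⊕ Fin (k + 1) → K // hyperbolicForm K (k + 1) z = c} =
        Nat.card {u : K × K × (Fin k ⊕ Fin k → K) // hypExt (hyperbolicForm K k) u = c} :=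
      Nat.card_congr ((hyperbolicSucc K k).toEquiv.subtypeEquiv fun z => by
        rw [← (hyperbolicSucc K k).map_app]; rfl)
    have hK : 1 ≤ Nat.card K := Nat.card_pos
    have h2 : (Nat.card (Fin k ⊕ Fin k → K) : ℝ) = (Nat.card K : ℝ) ^ (2 * k) := by
      rw [Nat.card_fun]
      simp [two_mul]
    rw [h1, card_hypExt_eq]
    push_cast [hK]
    rw [ih, h2]
    split_ifs <;> ring

theorem card_hypExt_isotropic (k : ℕ) :
    (Nat.card {u : K × K × (Fin k ⊕ Fin k → K) // u ≠ 0 ∧ hypExt (hyperbolicForm K k) u = 0} : ℝ) =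
      ((Nat.card K : ℝ) ^ (k + 1) - 1) * ((Nat.card K : ℝ) ^ k + 1) := by
  classical
  have hf : (Nat.card K : ℝ) ≠ 0 := by exact_mod_cast (Nat.card_pos (α := K)).ne'
  have h1 := card_hyperbolicForm_eq (K := K) (k + 1) 0
  have h2 : Nat.card {z : Fin (k + 1) ⊕ Fin (k + 1) → K // hyperbolicForm K (k + 1) z = 0} =
      Nat.card {u : K × K × (Fin k ⊕ Fin k → K) // hypExt (hyperbolicForm K k) u = 0} :=
    Nat.card_congr ((hyperbolicSucc K k).toEquiv.subtypeEquiv fun z => by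
      rw [← (hyperbolicSucc K k).map_app]; rfl)
  have h3 : Nat.card {u : K × K × (Fin k ⊕ Fin k → K) // hypExt (hyperbolicForm K k) u = 0} =
      Nat.card {u : K × K × (Fin k ⊕ Fin k → K) // u ≠ 0 ∧ hypExt (hyperbolicForm K k) u = 0} + 1 := by
    have h4 := Set.ncard_sdiff_singleton_add_one (s := {u : K × K × (Fin k ⊕ Fin k → K) |
      hypExt (hyperbolicForm K k) u = 0}) (a := 0) (map_zero _)
    rw [← Nat.card_coe_set_eq, ← Nat.card_coe_set_eq] at h4
    refine h4.symm.trans ?_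
    congr 1
    exact Nat.card_congr (Equiv.subtypeEquivRight fun u => and_comm)
  rw [h2, h3, if_pos rfl] at h1
  refine mul_left_cancel₀ hf ?_
  push_cast at h1
  linear_combination h1

theorem card_hypExt_eq_of_ne_zero (k : ℕ) {c : K} (hc : c ≠ 0) :
    (Nat.card {u : K × K × (Fin k ⊕ Fin k → K) // u ≠ 0 ∧ hypExt (hyperbolicForm K k) u = c} : ℝ) =
      (Nat.card K : ℝ) ^ k * ((Nat.card K : ℝ) ^ (k + 1) - 1) := by
  classical
  have hf : (Nat.card K : ℝ) ≠ 0 := by exact_mod_cast (Nat.card_pos (α := K)).ne'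
  have h1 := card_hyperbolicForm_eq (K := K) (k + 1) c
  have h2 : Nat.card {z : Fin (k + 1) ⊕ Fin (k + 1) → K // hyperbolicForm K (k + 1) z = c} =
      Nat.card {u : K × K × (Fin k ⊕ Fin k → K) // u ≠ 0 ∧ hypExt (hyperbolicForm K k) u = c} :=
    Nat.card_congr ((hyperbolicSucc K k).toEquiv.subtypeEquiv fun z => by
      rw [← (hyperbolicSucc K k).map_app]
      refine ⟨fun h => ⟨fun h0 => hc ?_, h⟩, fun h => h.2⟩
      rw [← h]
      exact (congrArg _ h0).trans (map_zero _))
  rw [h2, if_neg hc] at h1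
  refine mul_left_cancel₀ hf ?_
  linear_combination h1

end Counting

/-! ### The number of embeddings of a quadratic space into `H_k` -/

section Formula

variable {K W W' : Type*} [Field K] [AddCommGroup W] [Module K W] [AddCommGroup W'] [Module K W']

theorem two_mul_card_upperPair (n : ℕ) :
    2 * Fintype.card (UpperPair n) = n * (n + 1) := by
  have := sum_upperPair (fun _ : Fin n => 1)
  simp only [Finset.sum_const, Finset.card_univ, Fintype.card_fin, smul_eq_mul, mul_one] at this
  linarith

/-- The explicit formula for the number of injective isometries of `(W, g)` into `H_k`, where `a` is
the dimension of a nonsingular part of `W` and `χ` its sign. The product starts at `i = 0`, whose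
factor `1 - f ^ (-2 k)` is `(1 - f ^ (-k)) * (1 + f ^ (-k))`; the factor on the left compensates for
it. In this form the formula also holds for `W = 0`, where the product is empty, `a = 0` and
`χ = 1`, so that inductions can start there. -/
def EmbFormula (g : QuadraticForm K W) (a : ℕ) (χ : SignType) : Prop :=
  ∀ k, Module.finrank K W ≤ k →
    (1 + (Nat.card K : ℝ) ^ (-(k : ℤ))) * embCount g (hyperbolicForm K k) =
      (Nat.card K : ℝ) ^ (2 * (k : ℤ) * Module.finrank K W -
        Fintype.card (UpperPair (Module.finrank K W))) *
      (1 + (χ : ℝ) * (Nat.card K : ℝ) ^ ((Module.finrank K W : ℤ) - (a / 2 : ℕ) - k)) *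
      ∏ i ∈ (Finset.range (Module.finrank K W)).filter fun i => 2 * i + a < 2 * Module.finrank K W,
        (1 - (Nat.card K : ℝ) ^ (2 * (i : ℤ) - 2 * k))

theorem EmbFormula.congr {g : QuadraticForm K W} {g' : QuadraticForm K W'}
    (e : g.IsometryEquiv g') {a : ℕ} {χ : SignType} (h : EmbFormula g a χ) : EmbFormula g' a χ := by
  intro k hk
  have h1 : Module.finrank K W = Module.finrank K W' := e.toLinearEquiv.finrank_eq
  have h2 := h k (h1.trans_le hk)
  rwa [h1, embCount_congr e (QuadraticMap.IsometryEquiv.refl (hyperbolicForm K k))] at h2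

variable [Finite K]

theorem prod_shift (f : ℝ) {n a : ℕ} (ha : a ≤ n) (k : ℕ) :
    ∏ i ∈ (Finset.range (n + 1)).filter (fun i => 2 * i + a < 2 * (n + 1)),
        (1 - f ^ (2 * (i : ℤ) - 2 * ((k + 1 : ℕ) : ℤ))) =
      (∏ i ∈ (Finset.range n).filter (fun i => 2 * i + a < 2 * n),
        (1 - f ^ (2 * (i : ℤ) - 2 * (k : ℤ)))) * (1 - f ^ (-2 * ((k + 1 : ℕ) : ℤ))) := by
  rw [Finset.prod_filter, Finset.prod_filter, Finset.prod_range_succ', if_pos (by omega)]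
  congr 1
  · refine Finset.prod_congr rfl fun i _ => ?_
    have : 2 * (i + 1) + a < 2 * (n + 1) ↔ 2 * i + a < 2 * n := by omega
    simp only [this]
    split_ifs
    · congr 2
      push_cast
      ring
    · rfl

/-- The arithmetic common to the two recursions, splitting off a singular line (`j = dim W`) or a
hyperbolic plane (`j = 2 k`). -/
theorem recursion_step {f : ℝ} (hf : 1 < f) {k : ℕ} {N X : ℝ}
    (h : (1 + f ^ (-(k : ℤ))) * N = X) (j : ℕ) :
    (1 + f ^ (-((k + 1 : ℕ) : ℤ))) * ((f ^ (k + 1) - 1) * (f ^ k + 1) * (f ^ j * N)) =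
      f ^ (2 * (k : ℤ) + 1 + j) * (1 - f ^ (-2 * ((k + 1 : ℕ) : ℤ))) * X := by
  have hf0 : f ≠ 0 := by positivity
  rw [← h]
  have e1 : f ^ (-(k : ℤ)) = (f ^ k)⁻¹ := by rw [zpow_neg, zpow_natCast]
  have e2 : f ^ (-((k + 1 : ℕ) : ℤ)) = (f ^ (k + 1))⁻¹ := by rw [zpow_neg, zpow_natCast]
  have e3 : f ^ (-2 * ((k + 1 : ℕ) : ℤ)) = ((f ^ (k + 1)) ^ 2)⁻¹ := by
    rw [← pow_mul, ← zpow_natCast, ← zpow_neg]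
    congr 1
    push_cast
    ring
  have e4 : f ^ (2 * (k : ℤ) + 1 + j) = f ^ k * f ^ (k + 1) * f ^ j := by
    rw [← pow_add, ← pow_add, ← zpow_natCast]
    congr 1
    push_cast
    ring
  rw [e1, e2, e3, e4]
  have h1 : f ^ k ≠ 0 := pow_ne_zero _ hf0
  have h2 : f ^ (k + 1) ≠ 0 := pow_ne_zero _ hf0
  field_simp
  ring

theorem one_lt_card_real (K : Type*) [Field K] [Finite K] : (1 : ℝ) < Nat.card K := by
  exact_mod_cast Finite.one_lt_card

theorem mul_mul_mul_rearrange (x d y u P : ℝ) :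
    x * d * (y * u * P) = x * y * u * (P * d) := by ring

theorem EmbFormula.zeroExt [FiniteDimensional K W] {g : QuadraticForm K W} {a : ℕ} {χ : SignType}
    (h : EmbFormula g a χ) (ha : a ≤ Module.finrank K W) :
    EmbFormula (g.comp (LinearMap.snd K K W)) a χ := by
  intro k hk
  have hr : Module.finrank K (K × W) = Module.finrank K W + 1 := by
    rw [Module.finrank_prod, Module.finrank_self, add_comm]
  rw [hr] at hk ⊢
  obtain ⟨k, rfl⟩ : ∃ k', k = k' + 1 := ⟨k - 1, by omega⟩
  have hf := one_lt_card_real K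
  have hf0 : (Nat.card K : ℝ) ≠ 0 := by positivity
  have hdual : (Nat.card (W →ₗ[K] K) : ℝ) = (Nat.card K : ℝ) ^ Module.finrank K W := by
    have := Module.natCard_eq_pow_finrank (K := K) (V := W →ₗ[K] K)
    rw [this, Module.finrank_linearMap_self]
    push_cast
    rfl
  rw [embCount_congr (QuadraticMap.IsometryEquiv.refl _) (hyperbolicSucc K k),
    embCount_zeroExt g _ hyperbolicForm_nondegenerate]
  push_cast [card_hypExt_isotropic, hdual]
  have h1 := recursion_step hf (h k (by omega)) (Module.finrank K W)
  push_cast at h1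
  rw [h1]
  have h2 := prod_shift (Nat.card K : ℝ) ha k
  push_cast at h2
  rw [h2]
  have h3 := two_mul_card_upperPair (Module.finrank K W)
  have h4 := two_mul_card_upperPair (Module.finrank K W + 1)
  have h5 : (Fintype.card (UpperPair (Module.finrank K W + 1)) : ℤ) =
      Fintype.card (UpperPair (Module.finrank K W)) + Module.finrank K W + 1 := by
    have : Fintype.card (UpperPair (Module.finrank K W + 1)) =
      Fintype.card (UpperPair (Module.finrank K W)) + Module.finrank K W + 1 := by linarith
    exact_mod_cast this
  have h6 : (2 * ((k : ℤ) + 1) * ((Module.finrank K W : ℤ) + 1) -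
      Fintype.card (UpperPair (Module.finrank K W + 1))) = (2 * (k : ℤ) + 1 + Module.finrank K W) +
      (2 * (k : ℤ) * Module.finrank K W - Fintype.card (UpperPair (Module.finrank K W))) := by
    rw [h5]; ring
  have h7 : ((Module.finrank K W : ℤ) + 1 - ((a / 2 : ℕ) : ℤ) - (k + 1)) =
      (Module.finrank K W : ℤ) - ((a / 2 : ℕ) : ℤ) - k := by ring
  push_cast at h7
  rw [h6, h7, zpow_add₀ hf0 (2 * (k : ℤ) + 1 + Module.finrank K W)]
  generalize (Finset.prod _ _ : ℝ) = P
  exact mul_mul_mul_rearrange _ _ _ _ _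

theorem EmbFormula.hypExt [FiniteDimensional K W] {g : QuadraticForm K W} {a : ℕ} {χ : SignType}
    (h : EmbFormula g a χ) (ha : a ≤ Module.finrank K W) :
    EmbFormula (hypExt g) (a + 2) χ := by
  intro k hk
  have hr : Module.finrank K (K × K × W) = Module.finrank K W + 2 := by
    rw [Module.finrank_prod, Module.finrank_prod, Module.finrank_self]
    ring
  rw [hr] at hk ⊢
  obtain ⟨k, rfl⟩ : ∃ k', k = k' + 1 := ⟨k - 1, by omega⟩
  have hf := one_lt_card_real K
  have hf0 : (Nat.card K : ℝ) ≠ 0 := by positivity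
  have hcard : (Nat.card (Fin k ⊕ Fin k → K) : ℝ) = (Nat.card K : ℝ) ^ (2 * k) := by
    rw [Nat.card_fun]
    simp [two_mul]
  rw [embCount_congr (QuadraticMap.IsometryEquiv.refl _) (hyperbolicSucc K k),
    embCount_hypExt g _ hyperbolicForm_nondegenerate]
  push_cast [card_hypExt_isotropic, hcard]
  have h1 := recursion_step hf (h k (by omega)) (2 * k)
  push_cast at h1
  rw [h1]
  have h2 : ∏ i ∈ (Finset.range (Module.finrank K W + 2)).filter
        (fun i => 2 * i + (a + 2) < 2 * (Module.finrank K W + 2)),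
        (1 - (Nat.card K : ℝ) ^ (2 * (i : ℤ) - 2 * (k + 1))) =
      ∏ i ∈ (Finset.range (Module.finrank K W + 1)).filter
        (fun i => 2 * i + a < 2 * (Module.finrank K W + 1)),
        (1 - (Nat.card K : ℝ) ^ (2 * (i : ℤ) - 2 * (k + 1))) := by
    refine Finset.prod_congr ?_ fun _ _ => rfl
    ext i
    simp only [Finset.mem_filter, Finset.mem_range]
    omega
  have h2' := prod_shift (Nat.card K : ℝ) ha k
  push_cast at h2'
  rw [h2, h2']
  have h3 := two_mul_card_upperPair (Module.finrank K W)
  have h4 := two_mul_card_upperPair (Module.finrank K W + 2)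
  have h5 : (Fintype.card (UpperPair (Module.finrank K W + 2)) : ℤ) =
      Fintype.card (UpperPair (Module.finrank K W)) + 2 * Module.finrank K W + 3 := by
    have : Fintype.card (UpperPair (Module.finrank K W + 2)) =
      Fintype.card (UpperPair (Module.finrank K W)) + 2 * Module.finrank K W + 3 := by linarith
    exact_mod_cast this
  have h6 : (2 * ((k : ℤ) + 1) * ((Module.finrank K W : ℤ) + 2) -
      Fintype.card (UpperPair (Module.finrank K W + 2))) = (2 * (k : ℤ) + 1 + 2 * k) +
      (2 * (k : ℤ) * Module.finrank K W - Fintype.card (UpperPair (Module.finrank K W))) := by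
    rw [h5]; ring
  have h7 : ((Module.finrank K W : ℤ) + 2 - (((a + 2) / 2 : ℕ) : ℤ) - (k + 1)) =
      (Module.finrank K W : ℤ) - ((a / 2 : ℕ) : ℤ) - k := by
    rw [Nat.add_div_right _ two_pos]
    push_cast
    ring
  push_cast at h7
  rw [h6, h7, zpow_add₀ hf0 (2 * (k : ℤ) + 1 + 2 * k)]
  generalize (Finset.prod _ _ : ℝ) = P
  exact mul_mul_mul_rearrange _ _ _ _ _

omit [Finite K] in
theorem embFormula_of_subsingleton [Subsingleton W] (g : QuadraticForm K W) : EmbFormula g 0 1 := by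
  intro k _
  have h0 : Module.finrank K W = 0 := Module.finrank_zero_of_subsingleton
  have h1 := two_mul_card_upperPair 0
  rw [embCount_of_subsingleton, h0, show Fintype.card (UpperPair 0) = 0 by omega]
  simp

theorem embFormula_line {g : QuadraticForm K W} (hg : ∀ x, g x = 0 → x = 0)
    (b : Module.Basis (Fin 1) K W) : EmbFormula g 1 0 := by
  intro k hk
  have h0 : Module.finrank K W = 1 := by rw [Module.finrank_eq_card_basis b]; simp
  have h1 := two_mul_card_upperPair 1
  have hf := one_lt_card_real K
  have hf0 : (Nat.card K : ℝ) ≠ 0 := by positivity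
  have h2 := card_hyperbolicForm_eq k (g (b 0))
  rw [if_neg fun h => b.ne_zero 0 (hg _ h)] at h2
  rw [h0, show Fintype.card (UpperPair 1) = 1 by omega, embCount_line hg b]
  have h3 : (Finset.range 1).filter (fun i => 2 * i + 1 < 2 * 1) = {0} := by decide
  rw [h3, Finset.prod_singleton]
  refine mul_left_cancel₀ hf0 ?_
  rw [mul_left_comm, h2]
  have e1 : (Nat.card K : ℝ) ^ (2 * (k : ℤ) * ((1 : ℕ) : ℤ) - ((1 : ℕ) : ℤ)) =
      ((Nat.card K : ℝ) ^ k) ^ 2 / Nat.card K := by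
    rw [zpow_sub₀ hf0, ← pow_mul, ← zpow_natCast]
    push_cast
    rw [zpow_one, mul_one, mul_comm (k : ℤ)]
  have e2 : (Nat.card K : ℝ) ^ (2 * ((0 : ℕ) : ℤ) - 2 * (k : ℤ)) = (((Nat.card K : ℝ) ^ k) ^ 2)⁻¹ := by
    rw [← pow_mul, ← zpow_natCast, ← zpow_neg]
    congr 1
    push_cast
    ring
  rw [e1, e2, zpow_neg, zpow_natCast, mul_comm 2 k, pow_mul]
  have h4 : (Nat.card K : ℝ) ^ k ≠ 0 := pow_ne_zero _ hf0
  simp only [SignType.coe_zero]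
  field_simp
  ring

theorem embFormula_plane {g : QuadraticForm K W} (hg : ∀ x, g x = 0 → x = 0)
    (b : Module.Basis (Fin 2) K W) : EmbFormula g 2 (-1) := by
  intro k hk
  have h0 : Module.finrank K W = 2 := by rw [Module.finrank_eq_card_basis b]; simp
  have h1 := two_mul_card_upperPair 2
  have hf := one_lt_card_real K
  have hf0 : (Nat.card K : ℝ) ≠ 0 := by positivity
  obtain ⟨k, rfl⟩ : ∃ k', k = k' + 1 := ⟨k - 1, by omega⟩
  rw [h0, show Fintype.card (UpperPair 2) = 3 by omega,
    embCount_congr (QuadraticMap.IsometryEquiv.refl _) (hyperbolicSucc K k),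
    embCount_plane hg b _ hyperbolicForm_nondegenerate]
  have h3 : (Finset.range 2).filter (fun i => 2 * i + 2 < 2 * 2) = {0} := by decide
  rw [h3, Finset.prod_singleton]
  have : Fintype K := Fintype.ofFinite K
  have h2 : (Nat.card ((a : K) × {z : Fin k ⊕ Fin k → K //
      hyperbolicForm K k z = g (b 1 - a • b 0)}) : ℝ) =
      ((Nat.card K : ℝ) ^ k) ^ 2 - (Nat.card K : ℝ) ^ k := by
    rw [Nat.card_sigma]
    push_cast
    refine mul_left_cancel₀ hf0 ?_
    have h4 : ∀ a : K, (Nat.card K : ℝ) * (Nat.card {z : Fin k ⊕ Fin k → K //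
        hyperbolicForm K k z = g (b 1 - a • b 0)} : ℝ) =
        (Nat.card K : ℝ) ^ (2 * k) - (Nat.card K : ℝ) ^ k := fun a => by
      rw [card_hyperbolicForm_eq k (g (b 1 - a • b 0)), if_neg fun h => ?_, add_zero]
      have h3 := congrArg (fun x => b.repr x 1) (hg _ h)
      simp at h3
    rw [Finset.mul_sum, Finset.sum_congr rfl fun a _ => h4 a]
    rw [Finset.sum_const, Finset.card_univ, nsmul_eq_mul, Nat.card_eq_fintype_card]
    ring
  push_cast [h2]
  rw [card_hypExt_eq_of_ne_zero k fun h => b.ne_zero 0 (hg _ h)]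
  have e1 : (Nat.card K : ℝ) ^ (2 * ((k : ℤ) + 1) * 2 - 3) =
      ((Nat.card K : ℝ) ^ k) ^ 4 * Nat.card K := by
    rw [← pow_mul, ← pow_succ, ← zpow_natCast]
    congr 1
    push_cast
    ring
  have e2 : (Nat.card K : ℝ) ^ (0 - 2 * ((k : ℤ) + 1)) =
      (((Nat.card K : ℝ) ^ k * Nat.card K) ^ 2)⁻¹ := by
    rw [← pow_succ, ← pow_mul, ← zpow_natCast, ← zpow_neg]
    congr 1
    push_cast
    ring
  have e3 : (Nat.card K : ℝ) ^ (1 - ((k : ℤ) + 1)) = ((Nat.card K : ℝ) ^ k)⁻¹ := by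
    rw [← zpow_natCast, ← zpow_neg]
    congr 1
    ring
  have e4 : (Nat.card K : ℝ) ^ (-1 + -(k : ℤ)) = ((Nat.card K : ℝ) ^ k * Nat.card K)⁻¹ := by
    rw [← pow_succ, ← zpow_natCast, ← zpow_neg]
    congr 1
    push_cast
    ring
  rw [e1, e2, e3, neg_add_rev, e4]
  have h4 : (Nat.card K : ℝ) ^ k ≠ 0 := pow_ne_zero _ hf0
  simp only [SignType.coe_one]
  field_simp
  ring

end Formula

/-! ### The structure of quadratic spaces over a finite field -/

section Structure

variable {K W W' : Type*} [Field K] [AddCommGroup W] [Module K W] [AddCommGroup W'] [Module K W']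

theorem embFormula_hyperbolicForm [Finite K] (m : ℕ) :
    EmbFormula (hyperbolicForm K m) (2 * m) 1 := by
  induction m with
  | zero => exact embFormula_of_subsingleton _
  | succ m ih =>
    refine (ih.hypExt ?_).congr (hyperbolicSucc K m).symm
    simp [two_mul]

/-- An isometry extends to the orthogonal sums with a hyperbolic plane. -/
noncomputable def hypExtCongr {g : QuadraticForm K W} {g' : QuadraticForm K W'}
    (e : g.IsometryEquiv g') : (hypExt g).IsometryEquiv (hypExt g') where
  toLinearEquiv := (LinearEquiv.refl K K).prodCongr ((LinearEquiv.refl K K).prodCongr e.toLinearEquiv)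
  map_app' := fun ⟨a, b, z⟩ => by
    change hypExt g' (a, b, e z) = _
    rw [hypExt_apply, hypExt_apply, e.map_app]

/-- By the Chevalley-Warning theorem, anisotropic quadratic forms over a finite field have rank at most
`2`. -/
theorem finrank_le_two_of_anisotropic [Finite K] [FiniteDimensional K W] {g : QuadraticForm K W}
    (hg : ∀ x, g x = 0 → x = 0) : Module.finrank K W ≤ 2 := by
  classical
  by_contra! hn
  have : Fintype K := Fintype.ofFinite K
  set b := Module.finBasis K W
  obtain ⟨p, hp⟩ := CharP.exists K
  have hpp : p ≠ 1 := CharP.char_ne_one K p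
  let P : MvPolynomial (Fin (Module.finrank K W)) K :=
    ∑ i, ∑ j, MvPolynomial.C (g.toBilin b (b i) (b j)) * (MvPolynomial.X i * MvPolynomial.X j)
  have hdeg : P.totalDegree ≤ 2 := by
    refine MvPolynomial.totalDegree_finsetSum_le fun i _ =>
      MvPolynomial.totalDegree_finsetSum_le fun j _ => ?_
    refine (MvPolynomial.totalDegree_mul _ _).trans ?_
    rw [MvPolynomial.totalDegree_C, zero_add]
    refine (MvPolynomial.totalDegree_mul _ _).trans ?_
    rw [MvPolynomial.totalDegree_X, MvPolynomial.totalDegree_X]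
  have heval : ∀ x : Fin (Module.finrank K W) → K,
      MvPolynomial.eval x P = g (∑ i, x i • b i) := by
    intro x
    conv_rhs => rw [← g.toQuadraticMap_toBilin b]
    rw [LinearMap.BilinMap.toQuadraticMap_apply]
    simp only [P, map_sum, map_mul, MvPolynomial.eval_C, MvPolynomial.eval_X, LinearMap.sum_apply,
      map_smul, LinearMap.smul_apply, smul_eq_mul]
    rw [Finset.sum_comm]
    refine Finset.sum_congr rfl fun i _ => ?_
    rw [Finset.mul_sum]
    refine Finset.sum_congr rfl fun j _ => ?_
    ring
  have h1 := char_dvd_card_solutions p (f := P) (hdeg.trans_lt (by simpa using hn))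
  have h2 : Fintype.card {x // MvPolynomial.eval x P = 0} = 1 := by
    rw [Fintype.card_eq_one_iff]
    refine ⟨⟨0, by rw [heval]; simp⟩, fun ⟨x, hx⟩ => Subtype.ext ?_⟩
    rw [heval] at hx
    have h3 := hg _ hx
    funext i
    exact Fintype.linearIndependent_iff.mp b.linearIndependent x h3 i
  rw [h2, Nat.dvd_one] at h1
  exact hpp h1

/-- The orthogonal complement of the plane spanned by `e` and `e'`. -/
def orthPlane (g : QuadraticForm K W) (e e' : W) : Submodule K W :=
  LinearMap.ker (g.polarBilin e) ⊓ LinearMap.ker (g.polarBilin e')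

/-- A hyperbolic pair `e, e'` splits off a hyperbolic plane. -/
noncomputable def splitPlane (g : QuadraticForm K W) {e e' : W} (he : g e = 0) (he' : g e' = 0)
    (hee : QuadraticMap.polar g e e' = 1) :
    (hypExt (g.comp (orthPlane g e e').subtype)).IsometryEquiv g := by
  have hee' : QuadraticMap.polar g e' e = 1 := by rw [QuadraticMap.polar_comm, hee]
  have h0 : QuadraticMap.polar g e e = 0 := by rw [QuadraticMap.polar_self, he, smul_zero]
  have h0' : QuadraticMap.polar g e' e' = 0 := by rw [QuadraticMap.polar_self, he', smul_zero]
  have hmem : ∀ z : orthPlane g e e', QuadraticMap.polar g e z = 0 ∧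
      QuadraticMap.polar g e' z = 0 := fun z => z.2
  refine
    { toFun := fun u => u.1 • e + u.2.1 • e' + (u.2.2 : W)
      map_add' := fun u v => ?_
      map_smul' := fun c u => ?_
      invFun := fun x => (QuadraticMap.polar g e' x, QuadraticMap.polar g e x,
        ⟨x - (QuadraticMap.polar g e' x) • e - (QuadraticMap.polar g e x) • e', ?_, ?_⟩)
      left_inv := fun ⟨a, b, z⟩ => ?_
      right_inv := fun x => ?_
      map_app' := fun ⟨a, b, z⟩ => ?_ }
  · simp only [Prod.fst_add, Prod.snd_add, add_smul, Submodule.coe_add]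
    abel
  · simp only [Prod.smul_fst, Prod.smul_snd, smul_eq_mul, mul_smul, Submodule.coe_smul, smul_add,
      RingHom.id_apply]
  · change QuadraticMap.polar g e _ = 0
    rw [sub_eq_add_neg, sub_eq_add_neg, ← neg_smul, ← neg_smul, QuadraticMap.polar_add_right,
      QuadraticMap.polar_add_right, QuadraticMap.polar_smul_right, QuadraticMap.polar_smul_right,
      h0, hee]
    simp
  · change QuadraticMap.polar g e' _ = 0
    rw [sub_eq_add_neg, sub_eq_add_neg, ← neg_smul, ← neg_smul, QuadraticMap.polar_add_right,
      QuadraticMap.polar_add_right, QuadraticMap.polar_smul_right, QuadraticMap.polar_smul_right,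
      h0', hee']
    simp
  · have h1 : QuadraticMap.polar g e (a • e + b • e' + z) = b := by
      rw [QuadraticMap.polar_add_right, QuadraticMap.polar_add_right,
        QuadraticMap.polar_smul_right, QuadraticMap.polar_smul_right, h0, hee, (hmem z).1]
      simp
    have h2 : QuadraticMap.polar g e' (a • e + b • e' + z) = a := by
      rw [QuadraticMap.polar_add_right, QuadraticMap.polar_add_right,
        QuadraticMap.polar_smul_right, QuadraticMap.polar_smul_right, h0', hee', (hmem z).2]
      simp
    refine Prod.ext h2 (Prod.ext h1 (Subtype.ext ?_))
    change _ - QuadraticMap.polar g e' (a • e + b • e' + z) • e -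
      QuadraticMap.polar g e (a • e + b • e' + z) • e' = (z : W)
    rw [h1, h2]
    module
  · change _ • e + _ • e' + (x - _ - _) = x
    abel
  · change g (a • e + b • e' + z) = hypExt _ (a, b, z)
    rw [hypExt_apply, QuadraticMap.map_add g, QuadraticMap.map_add g, QuadraticMap.polar_add_left,
      QuadraticMap.polar_smul_left, QuadraticMap.polar_smul_left, QuadraticMap.polar_smul_left,
      QuadraticMap.polar_smul_right, (hmem z).1, (hmem z).2, QuadraticMap.map_smul,
      QuadraticMap.map_smul, he, he', hee]
    simp

/-- The quadratic form `g` is nonsingular: its radical vanishes. -/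
def IsNonsingular (g : QuadraticForm K W) : Prop :=
  ∀ x, g x = 0 → (∀ y, QuadraticMap.polar g x y = 0) → x = 0

theorem IsNonsingular.congr {g : QuadraticForm K W} {g' : QuadraticForm K W'}
    (e : g.IsometryEquiv g') (h : IsNonsingular g) : IsNonsingular g' := by
  intro x hx hy
  obtain ⟨u, rfl⟩ := e.surjective x
  have h1 : u = 0 := by
    refine h u ((e.map_app u).symm.trans hx) fun y => ?_
    rw [← polar_eq_of_isometry (ψ := e.toLinearEquiv.toLinearMap) fun z => e.map_app z]
    exact hy (e y)
  rw [h1]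
  exact map_zero e.toLinearEquiv

theorem IsNonsingular.of_hypExt {g : QuadraticForm K W} (h : IsNonsingular (hypExt g)) :
    IsNonsingular g := by
  intro z hz hy
  have h1 := h (0, 0, z) (by rw [hypExt_apply, hz]; simp) fun ⟨a, b, y⟩ => by
    rw [polar_hypExt, hy]
    simp
  exact (Prod.ext_iff.mp (Prod.ext_iff.mp h1).2).2

theorem IsNonsingular.exists_pair {g : QuadraticForm K W} (h : IsNonsingular g) {e : W}
    (he : g e = 0) (he0 : e ≠ 0) : ∃ e', g e' = 0 ∧ QuadraticMap.polar g e e' = 1 := by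
  obtain ⟨y, hy⟩ : ∃ y, QuadraticMap.polar g e y ≠ 0 := by
    by_contra! hy
    exact he0 (h e he hy)
  set c := QuadraticMap.polar g e y
  have h0 : QuadraticMap.polar g e e = 0 := by rw [QuadraticMap.polar_self, he, smul_zero]
  have h1 : QuadraticMap.polar g e (c⁻¹ • y) = 1 := by
    rw [QuadraticMap.polar_smul_right, smul_eq_mul, inv_mul_cancel₀ hy]
  refine ⟨c⁻¹ • y + (-g (c⁻¹ • y)) • e, ?_, ?_⟩
  · rw [QuadraticMap.map_add g, QuadraticMap.map_smul _ _ e, he, QuadraticMap.polar_smul_right,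
      QuadraticMap.polar_comm, h1]
    simp
  · rw [QuadraticMap.polar_add_right, QuadraticMap.polar_smul_right _ _ _ e, h0, h1]
    simp

/-- A nonsingular quadratic space over a finite field is an orthogonal sum of hyperbolic planes and
an anisotropic space of dimension at most `2`; this gives the number of its embeddings. -/
theorem IsNonsingular.embFormula [Finite K] (n : ℕ) : ∀ {W : Type*} [AddCommGroup W] [Module K W]
    [FiniteDimensional K W] {g : QuadraticForm K W}, Module.finrank K W = n → IsNonsingular g →
    ∃ χ : SignType, EmbFormula g n χ ∧ ((Odd n ∧ χ = 0) ∨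
      (Even n ∧ χ = 1 ∧ ∃ m, Nonempty (g.IsometryEquiv (hyperbolicForm K m))) ∨
      (Even n ∧ χ = -1)) := by
  induction n using Nat.strong_induction_on with
  | h n ih =>
  intro W _ _ _ g hn hg
  by_cases han : ∀ x, g x = 0 → x = 0
  · have h2 := finrank_le_two_of_anisotropic han
    rw [hn] at h2
    interval_cases n
    · have : Subsingleton W := Module.finrank_zero_iff.mp hn
      exact ⟨1, embFormula_of_subsingleton g, Or.inr (Or.inl ⟨Even.zero, rfl, 0,
        ⟨⟨(0 : W ≃ₗ[K] (Fin 0 ⊕ Fin 0 → K)), fun x => by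
          rw [Subsingleton.elim x 0]; simp⟩⟩⟩)⟩
    · exact ⟨0, embFormula_line han (Module.finBasisOfFinrankEq K W hn), Or.inl ⟨odd_one, rfl⟩⟩
    · exact ⟨-1, embFormula_plane han (Module.finBasisOfFinrankEq K W hn),
        Or.inr (Or.inr ⟨even_two, rfl⟩)⟩
  · push Not at han
    obtain ⟨e, he, he0⟩ := han
    obtain ⟨e', he', hee⟩ := hg.exists_pair he he0
    have s := splitPlane g he he' hee
    have hr : Module.finrank K (orthPlane g e e') + 2 = n := by
      rw [← hn, ← s.toLinearEquiv.finrank_eq, Module.finrank_prod, Module.finrank_prod,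
        Module.finrank_self]
      ring
    obtain ⟨χ, hχ, hcase⟩ := ih _ (by omega) rfl (hg.congr s.symm).of_hypExt
    refine ⟨χ, hr ▸ (hχ.hypExt le_rfl).congr s, ?_⟩
    rw [← hr]
    rcases hcase with ⟨h1, h2⟩ | ⟨h1, h2, m, ⟨i⟩⟩ | ⟨h1, h2⟩
    · exact Or.inl ⟨h1.add_even even_two, h2⟩
    · exact Or.inr (Or.inl ⟨h1.add even_two, h2, m + 1,
        ⟨(s.symm.trans (hypExtCongr i)).trans (hyperbolicSucc K m).symm⟩⟩)
    · exact Or.inr (Or.inr ⟨h1.add even_two, h2⟩)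

/-- Adding a totally isotropic radical. -/
theorem EmbFormula.zeroPiExt [Finite K] [FiniteDimensional K W] {g : QuadraticForm K W} {a : ℕ}
    {χ : SignType} (h : EmbFormula g a χ) (ha : a ≤ Module.finrank K W) (r : ℕ) :
    EmbFormula (g.comp (LinearMap.snd K (Fin r → K) W)) a χ := by
  induction r with
  | zero =>
    refine h.congr ⟨LinearEquiv.symm (LinearEquiv.uniqueProd), fun x => ?_⟩
    rfl
  | succ r ih =>
    refine (ih.zeroExt ?_).congr ⟨(LinearEquiv.prodAssoc K K (Fin r → K) W).symm.trans
      ((Fin.consLinearEquiv K fun _ => K).prodCongr (LinearEquiv.refl K W)), fun x => ?_⟩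
    · rw [Module.finrank_prod]
      omega
    · rfl

/-- The nonsingular part of `(W, g)`, a complement of the radical, is an orthogonal sum of hyperbolic
planes. -/
def HasSplitPart (g : QuadraticForm K W) : Prop :=
  ∃ L₀ : Submodule K W, IsCompl L₀ g.radical ∧
    ∃ m : ℕ, Nonempty ((g.comp L₀.subtype).IsometryEquiv (hyperbolicForm K m))

theorem isNonsingular_of_isCompl {g : QuadraticForm K W} {L₀ : Submodule K W}
    (h : IsCompl L₀ g.radical) : IsNonsingular (g.comp L₀.subtype) := by
  intro x hx hy
  have h1 : (x : W) ∈ g.radical := by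
    refine QuadraticMap.mem_radical_iff'.mpr ⟨hx, fun y => ?_⟩
    obtain ⟨u, hu, v, hv, rfl⟩ := Submodule.mem_sup.mp
      ((h.codisjoint.eq_top ▸ Submodule.mem_top : y ∈ L₀ ⊔ g.radical))
    have h2 := (QuadraticMap.mem_radical_iff'.mp hv).2
    have h3 := hy ⟨u, hu⟩
    have h4 : g (x + u) - g x - g u = 0 := h3
    have h5 : g x = 0 := hx
    rw [← add_assoc, add_comm _ v, h2, add_comm u v, h2]
    rw [h5] at h4
    linear_combination h4
  exact Subtype.ext (Submodule.disjoint_def.mp h.disjoint _ x.2 h1)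

theorem EmbFormula.of_isCompl [Finite K] [FiniteDimensional K W] {g : QuadraticForm K W}
    {L₀ : Submodule K W} (hL : IsCompl L₀ g.radical) {a : ℕ} {χ : SignType}
    (h : EmbFormula (g.comp L₀.subtype) a χ) (ha : a ≤ Module.finrank K L₀) :
    EmbFormula g a χ := by
  let e : g.radical ≃ₗ[K] (Fin (Module.finrank K g.radical) → K) :=
    (Module.finBasis K g.radical).equivFun
  refine (h.zeroPiExt ha (Module.finrank K g.radical)).congr
    ⟨(e.symm.prodCongr (LinearEquiv.refl K L₀)).trans
      (Submodule.prodEquivOfIsCompl _ _ hL.symm), fun x => ?_⟩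
  change g ((e.symm x.1 : W) + (x.2 : W)) = g (x.2 : W)
  exact (QuadraticMap.mem_radical_iff'.mp (e.symm x.1).2).2 _

open Classical in
/-- The number of embeddings of an arbitrary quadratic space over a finite field. If some complement of
the radical is split, the formula with sign `1` holds, whichever complement is used. -/
theorem embFormula [Finite K] [FiniteDimensional K W] (g : QuadraticForm K W) :
    EmbFormula g (Module.finrank K (W ⧸ g.radical))
      (if Odd (Module.finrank K (W ⧸ g.radical)) then 0 else if HasSplitPart g then 1 else -1) := by
  have hdim : ∀ L₀ : Submodule K W, IsCompl L₀ g.radical →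
      Module.finrank K (W ⧸ g.radical) = Module.finrank K L₀ := fun L₀ h =>
    (Submodule.quotientEquivOfIsCompl _ _ h.symm).finrank_eq
  obtain ⟨L₀, hL'⟩ := Submodule.exists_isCompl g.radical
  have hL := hL'.symm
  obtain ⟨χ, hχ, hcase⟩ := (isNonsingular_of_isCompl hL).embFormula _ (hdim L₀ hL).symm
  have h1 := hχ.of_isCompl hL (hdim L₀ hL).le
  rcases hcase with ⟨h2, rfl⟩ | ⟨h2, rfl, m, hm⟩ | ⟨h2, rfl⟩
  · rwa [if_pos h2]
  · rw [if_neg (Nat.not_odd_iff_even.mpr h2), if_pos ⟨L₀, hL, m, hm⟩]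
    exact h1
  · rw [if_neg (Nat.not_odd_iff_even.mpr h2)]
    split_ifs with h3
    · obtain ⟨L₁, hL₁, m, ⟨e⟩⟩ := h3
      have h4 : Module.finrank K L₁ = 2 * m := by
        rw [e.toLinearEquiv.finrank_eq]
        simp [two_mul]
      rw [hdim L₁ hL₁, h4]
      exact ((embFormula_hyperbolicForm m).congr e.symm).of_isCompl hL₁ h4.ge
    · exact h1

end Structure

/-! ### The Gross-Keating invariant -/

section GrossKeating

variable {R : Type*} [CommRing R] [IsDomain R] [IsDiscreteValuationRing R]
  {L : Type*} [AddCommGroup L] [Module R L] {n : ℕ} {ϖ : R}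

theorem natCast_le_addVal_iff (hϖ : Irreducible ϖ) (m : ℕ) (x : R) :
    (m : ℕ∞) ≤ IsDiscreteValuationRing.addVal R x ↔ ϖ ^ m ∣ x := by
  rw [← IsDiscreteValuationRing.addVal_le_iff_dvd, hϖ.addVal_pow]

/-- The inequality `m ≤ 2 ord x` of half-integral bounds as a divisibility. -/
theorem natCast_le_two_mul_addVal_iff (hϖ : Irreducible ϖ) (m : ℕ) (x : R) :
    (m : ℕ∞) ≤ 2 * IsDiscreteValuationRing.addVal R x ↔ ϖ ^ ((m + 1) / 2) ∣ x := by
  rw [← natCast_le_addVal_iff hϖ]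
  induction IsDiscreteValuationRing.addVal R x with
  | top => simp
  | coe v =>
    rw [show (2 * (v : ℕ∞)) = ((2 * v : ℕ) : ℕ∞) by push_cast; rfl, Nat.cast_le, Nat.cast_le]
    omega

theorem mem_gkSet_iff (hϖ : Irreducible ϖ) (q : QuadraticForm R L) (b : Module.Basis (Fin n) R L)
    (a : Fin n → ℕ) : a ∈ gkSet q b ↔ Monotone a ∧ (∀ i, ϖ ^ a i ∣ q (b i)) ∧
      ∀ i j, ϖ ^ ((a i + a j + 1) / 2) ∣ QuadraticMap.polar q (b i) (b j) := by
  have h : ∀ i j, (a i + a j : ℕ∞) ≤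
      2 * IsDiscreteValuationRing.addVal R (QuadraticMap.polar q (b i) (b j)) ↔
      ϖ ^ ((a i + a j + 1) / 2) ∣ QuadraticMap.polar q (b i) (b j) := fun i j => by
    rw [← natCast_le_two_mul_addVal_iff hϖ]
    push_cast
    rfl
  simp only [gkSet, Set.mem_ofPred_eq, natCast_le_addVal_iff hϖ, h]
  refine and_congr_right fun _ => and_congr_right fun _ => ⟨fun H i j => ?_, fun H i j _ => H i j⟩
  rcases le_total i j with hij | hij
  · exact H i j hij
  · rw [QuadraticMap.polar_comm, add_comm (a i)]
    exact H j i hij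

/-- The set whose greatest element is the Gross-Keating invariant. -/
def gkUnion (q : QuadraticForm R L) (n : ℕ) : Set (Lex (Fin n → ℕ)) :=
  {a | ∃ b : Module.Basis (Fin n) R L, ofLex a ∈ gkSet q b}

/-- If the polar form does not vanish modulo `ϖ ^ C` against any primitive vector, the entries of the
members of the sets `S(B)` are less than `2 C`. -/
theorem lt_of_mem_gkUnion (hϖ : Irreducible ϖ) {q : QuadraticForm R L} {C : ℕ}
    (hC : ∀ x, (∀ y, ϖ ^ C ∣ QuadraticMap.polar q x y) → ∃ z, x = ϖ • z)
    {a : Lex (Fin n → ℕ)} (ha : a ∈ gkUnion q n) (i : Fin n) : ofLex a i < 2 * C := by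
  obtain ⟨b, hb⟩ := ha
  obtain ⟨_, _, h3⟩ := (mem_gkSet_iff hϖ q b _).mp hb
  by_contra! hi
  obtain ⟨z, hz⟩ := hC (b i) fun y => by
    rw [← b.sum_repr y, ← QuadraticMap.polarBilin_apply_apply, map_sum]
    refine Finset.dvd_sum fun j _ => ?_
    rw [map_smul, smul_eq_mul, QuadraticMap.polarBilin_apply_apply]
    exact ((pow_dvd_pow ϖ (by omega)).trans (h3 i j)).mul_left _
  have h4 := congrArg (fun x => b.repr x i) hz
  simp only [Module.Basis.repr_self, Finsupp.single_eq_same, map_smul, Finsupp.smul_apply,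
    smul_eq_mul] at h4
  exact hϖ.not_isUnit (IsUnit.of_mul_eq_one _ h4.symm)

theorem exists_isGreatest_gkUnion (hϖ : Irreducible ϖ) {q : QuadraticForm R L} {C : ℕ}
    (hC : ∀ x, (∀ y, ϖ ^ C ∣ QuadraticMap.polar q x y) → ∃ z, x = ϖ • z)
    (b : Module.Basis (Fin n) R L) : ∃ a, IsGreatest (gkUnion q n) a := by
  have hfin : (gkUnion q n).Finite := by
    have h1 : (Set.univ.pi fun _ : Fin n => Set.Iio (2 * C)).Finite :=
      Set.Finite.pi fun _ => Set.finite_Iio _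
    refine (h1.preimage ofLex.injective.injOn).subset fun a ha i _ => ?_
    exact lt_of_mem_gkUnion hϖ hC ha i
  have hne : (gkUnion q n).Nonempty :=
    ⟨toLex 0, b, (mem_gkSet_iff hϖ q b _).mpr ⟨fun _ _ _ => le_rfl,
      fun i => by change ϖ ^ 0 ∣ _; simp, fun i j => by change ϖ ^ ((0 + 0 + 1) / 2) ∣ _; simp⟩⟩
  obtain ⟨a, ha, h⟩ := Set.exists_max_image _ id hfin hne
  exact ⟨a, ha, h⟩

theorem isGreatest_grossKeating (hϖ : Irreducible ϖ) {q : QuadraticForm R L} {C : ℕ}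
    (hC : ∀ x, (∀ y, ϖ ^ C ∣ QuadraticMap.polar q x y) → ∃ z, x = ϖ • z)
    (b : Module.Basis (Fin (Module.finrank R L)) R L) :
    IsGreatest (gkUnion q (Module.finrank R L)) (toLex (grossKeating q)) :=
  Classical.epsilon_spec (exists_isGreatest_gkUnion hϖ hC b)

omit [IsDomain R] [IsDiscreteValuationRing R] in
theorem exists_basis_update (b : Module.Basis (Fin n) R L) {y : L} {j : Fin n}
    (h : IsUnit (b.repr y j)) :
    ∃ c : Module.Basis (Fin n) R L, ⇑c = Function.update b j y := by
  have h1 : IsUnit (b.det (Function.update b j y)) := by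
    rw [Module.Basis.det_apply, Module.Basis.toMatrix_update, Module.Basis.toMatrix_self,
      ← Matrix.cramer_apply, Matrix.cramer_one]
    exact h
  obtain ⟨hl, hs⟩ := (Module.Basis.is_basis_iff_det b).mpr h1
  exact ⟨Module.Basis.mk hl hs.ge, Module.Basis.coe_mk _ _⟩

/-- If `a` is maximal, no vector of a basis realizing `a` can be replaced by one that would allow its
entry to be increased. -/
theorem false_of_improvement (hϖ : Irreducible ϖ) {q : QuadraticForm R L}
    {b : Module.Basis (Fin n) R L} {a : Fin n → ℕ} (ha : a ∈ gkSet q b)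
    (hmax : ∀ a' ∈ gkUnion q n, a' ≤ toLex a) {j : Fin n} {y : L} (hy : IsUnit (b.repr y j))
    (hq : ϖ ^ (a j + 1) ∣ q y)
    (hp : ∀ i, i ≠ j → ϖ ^ ((a j + a i + 2) / 2) ∣ QuadraticMap.polar q y (b i)) : False := by
  classical
  obtain ⟨hm, h1, h2⟩ := (mem_gkSet_iff hϖ q b _).mp ha
  obtain ⟨c, hc⟩ := exists_basis_update b hy
  set a₁ : Fin n → ℕ := Function.update a j (a j + 1) with ha₁
  have hc1 : ∀ i, ϖ ^ a₁ i ∣ q (c i) := by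
    intro i
    rw [hc, ha₁]
    rcases eq_or_ne i j with rfl | hij
    · simpa using hq
    · simpa [hij] using h1 i
  have hc2 : ∀ i k, ϖ ^ ((a₁ i + a₁ k + 1) / 2) ∣ QuadraticMap.polar q (c i) (c k) := by
    intro i k
    rw [hc, ha₁]
    rcases eq_or_ne i j with rfl | hij <;> rcases eq_or_ne k i with rfl | hkj
    · rw [Function.update_self, Function.update_self, QuadraticMap.polar_self]
      refine ((pow_dvd_pow ϖ ?_).trans hq).trans (dvd_smul_of_dvd _ dvd_rfl)
      omega
    · rw [Function.update_self, Function.update_self, Function.update_of_ne hkj,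
        Function.update_of_ne hkj]
      exact (pow_dvd_pow ϖ (by omega)).trans (hp k hkj)
    · rw [Function.update_of_ne hij, Function.update_of_ne hij]
      exact h2 k k
    · rw [Function.update_of_ne hij, Function.update_of_ne hij]
      rcases eq_or_ne k j with rfl | hk
      · rw [Function.update_self, Function.update_self, QuadraticMap.polar_comm]
        exact (pow_dvd_pow ϖ (by omega)).trans (hp i hij)
      · rw [Function.update_of_ne hk, Function.update_of_ne hk]
        exact h2 i k
  -- the last index with the same entry: there the entry can be increased without losing monotonicity
  obtain ⟨l, hl, hlmax⟩ := Set.exists_max_image {i | a i = a j} id (Set.toFinite _) ⟨j, rfl⟩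
  have hl : a l = a j := hl
  set a₂ : Fin n → ℕ := Function.update a l (a l + 1) with ha₂
  have h12 : ∀ i, a₂ i = a₁ (Equiv.swap j l i) := by
    intro i
    rw [ha₁, ha₂]
    rcases eq_or_ne i l with rfl | hil
    · simp [hl]
    · rw [Function.update_of_ne hil]
      rcases eq_or_ne i j with rfl | hij
      · rw [Equiv.swap_apply_left, Function.update_of_ne hil.symm, hl]
      · rw [Equiv.swap_apply_of_ne_of_ne hij hil, Function.update_of_ne hij]
  have hmem : toLex a₂ ∈ gkUnion q n := by
    refine ⟨c.reindex (Equiv.swap j l), (mem_gkSet_iff hϖ q _ _).mpr ⟨fun i k hik => ?_,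
      fun i => ?_, fun i k => ?_⟩⟩
    · change a₂ i ≤ a₂ k
      have h3 := hm hik
      rw [ha₂, Function.update_apply, Function.update_apply]
      split_ifs with hi hk hk
      · exact le_rfl
      · subst hi
        refine Nat.succ_le_of_lt (lt_of_le_of_ne h3 fun h => hk ?_)
        exact le_antisymm (hlmax k (show a k = a j by rw [← h, hl])) hik
      · subst hk
        omega
      · exact h3
    · change ϖ ^ a₂ i ∣ _
      rw [h12, Module.Basis.reindex_apply, Equiv.symm_swap]
      exact hc1 _
    · change ϖ ^ ((a₂ i + a₂ k + 1) / 2) ∣ _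
      rw [h12, h12, Module.Basis.reindex_apply, Module.Basis.reindex_apply, Equiv.symm_swap]
      exact hc2 _ _
  refine (hmax _ hmem).not_gt ⟨l, fun i hi => ?_, ?_⟩
  · exact (Function.update_of_ne hi.ne _ _).symm
  · change a l < a₂ l
    rw [ha₂, Function.update_self]
    exact Nat.lt_succ_self _

/-- If the vectors `b i` with `i ∉ S` lie in the preimage of the radical of the reduction, then the
sequence with entries `0` for `i ∈ S` and `1` otherwise, once sorted, belongs to a set `S(B)`; hence a
maximal sequence has at most `card S` zeros. -/
theorem card_zeros_le (hϖ : Irreducible ϖ) {q : QuadraticForm R L} {a : Fin n → ℕ}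
    (hm : Monotone a) (hmax : ∀ a' ∈ gkUnion q n, a' ≤ toLex a) (b : Module.Basis (Fin n) R L)
    (S : Set (Fin n)) (h1 : ∀ i, i ∉ S → ϖ ∣ q (b i))
    (h2 : ∀ i, i ∉ S → ∀ j, ϖ ∣ QuadraticMap.polar q (b i) (b j)) :
    Nat.card {i // a i = 0} ≤ Nat.card S := by
  classical
  let s : Fin n → ℕ := fun i => if i ∈ S then 0 else 1
  let σ := Tuple.sort s
  have hσ : Monotone (s ∘ σ) := Tuple.monotone_sort s
  have hs1 : ∀ i, s i ≤ 1 := fun i => by dsimp only [s]; split_ifs <;> omega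
  have hmem : toLex (s ∘ σ) ∈ gkUnion q n := by
    refine ⟨b.reindex σ.symm, (mem_gkSet_iff hϖ q _ _).mpr ⟨hσ, fun i => ?_, fun i j => ?_⟩⟩
    · rw [Module.Basis.reindex_apply, Equiv.symm_symm]
      change ϖ ^ (if σ i ∈ S then 0 else 1) ∣ _
      split_ifs with h
      · simp
      · simpa using h1 _ h
    · rw [Module.Basis.reindex_apply, Module.Basis.reindex_apply, Equiv.symm_symm]
      change ϖ ^ ((s (σ i) + s (σ j) + 1) / 2) ∣ _
      by_cases hi : σ i ∈ S
      · by_cases hj : σ j ∈ S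
        · simp [s, hi, hj]
        · rw [QuadraticMap.polar_comm]
          refine (pow_dvd_pow ϖ ?_).trans ((pow_one ϖ).symm ▸ h2 _ hj _)
          have := hs1 (σ i)
          have := hs1 (σ j)
          omega
      · refine (pow_dvd_pow ϖ ?_).trans ((pow_one ϖ).symm ▸ h2 _ hi _)
        have := hs1 (σ i)
        have := hs1 (σ j)
        omega
  have hsub : ∀ i, a i = 0 → s (σ i) = 0 := by
    intro i hi
    rcases (hmax _ hmem).eq_or_lt with h | ⟨k, hk, hlt⟩
    · have := congrFun (congrArg ofLex h) i
      exact this.trans hi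
    · have hlt : s (σ k) < a k := hlt
      have hik : i < k := by
        by_contra! h
        have := hm h
        omega
      exact (hk i hik).trans hi
  refine Nat.card_le_card_of_injective (fun i => ⟨σ i.1, ?_⟩) fun i j h => ?_
  · have h3 := hsub i.1 i.2
    by_contra h
    simp [s, h] at h3
  · exact Subtype.ext (σ.injective (congrArg Subtype.val h))

end GrossKeating

/-! ### Lattices attached to a Gross-Keating basis -/

section Order

variable {F : Type*} [Field F] [ValuativeRel F] {ϖ : 𝒪[F]} {m m' : ℤ} {x y : F}

/-- The inequality `m ≤ ord x`, where `ϖ` is a uniformizer. -/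
def OrdGE (ϖ : 𝒪[F]) (m : ℤ) (x : F) : Prop := (ϖ : F) ^ (-m) * x ∈ 𝒪[F]

theorem ordGE_zero_iff : OrdGE ϖ 0 x ↔ x ∈ 𝒪[F] := by simp [OrdGE]

theorem OrdGE.zero (m : ℤ) : OrdGE ϖ m 0 := by simp [OrdGE]

theorem OrdGE.add (hx : OrdGE ϖ m x) (hy : OrdGE ϖ m y) : OrdGE ϖ m (x + y) := by
  rw [OrdGE, mul_add]
  exact add_mem hx hy

theorem OrdGE.neg (hx : OrdGE ϖ m x) : OrdGE ϖ m (-x) := by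
  rw [OrdGE, mul_neg]
  exact neg_mem hx

theorem OrdGE.sub (hx : OrdGE ϖ m x) (hy : OrdGE ϖ m y) : OrdGE ϖ m (x - y) := by
  rw [sub_eq_add_neg]
  exact hx.add hy.neg

theorem OrdGE.sum {ι : Type*} {s : Finset ι} {g : ι → F} (h : ∀ i ∈ s, OrdGE ϖ m (g i)) :
    OrdGE ϖ m (∑ i ∈ s, g i) := by
  rw [OrdGE, Finset.mul_sum]
  exact sum_mem h

theorem OrdGE.mul (h0 : (ϖ : F) ≠ 0) (hx : OrdGE ϖ m x) (hy : OrdGE ϖ m' y) :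
    OrdGE ϖ (m + m') (x * y) := by
  rw [OrdGE, neg_add, zpow_add₀ h0, mul_mul_mul_comm]
  exact mul_mem hx hy

theorem OrdGE.mono (h0 : (ϖ : F) ≠ 0) (hx : OrdGE ϖ m x) (h : m' ≤ m) : OrdGE ϖ m' x := by
  obtain ⟨j, rfl⟩ := Int.le.dest h
  have : (ϖ : F) ^ (-m') * x = (ϖ : F) ^ j * ((ϖ : F) ^ (-(m' + j)) * x) := by
    rw [← mul_assoc, ← zpow_natCast, ← zpow_add₀ h0]
    congr 2
    ring
  rw [OrdGE, this]
  exact mul_mem (pow_mem ϖ.2 _) hx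

theorem ordGE_zpow_mul (h0 : (ϖ : F) ≠ 0) (s : ℤ) :
    OrdGE ϖ m ((ϖ : F) ^ s * x) ↔ OrdGE ϖ (m - s) x := by
  rw [OrdGE, OrdGE, ← mul_assoc, ← zpow_add₀ h0]
  congr! 3
  ring

theorem OrdGE.smul (c : 𝒪[F]) (hx : OrdGE ϖ m x) : OrdGE ϖ m ((c : F) * x) := by
  rw [OrdGE, mul_left_comm]
  exact mul_mem c.2 hx

theorem ordGE_natCast_iff (h0 : (ϖ : F) ≠ 0) (j : ℕ) (r : 𝒪[F]) :
    OrdGE ϖ j (r : F) ↔ ϖ ^ j ∣ r := by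
  constructor
  · intro h
    refine ⟨⟨_, h⟩, Subtype.ext ?_⟩
    change (r : F) = (ϖ : F) ^ j * ((ϖ : F) ^ (-(j : ℤ)) * r)
    rw [← mul_assoc, zpow_neg, zpow_natCast, mul_inv_cancel₀ (pow_ne_zero _ h0), one_mul]
  · rintro ⟨c, rfl⟩
    change (ϖ : F) ^ (-(j : ℤ)) * ((ϖ : F) ^ j * c) ∈ _
    rw [← mul_assoc, zpow_neg, zpow_natCast, inv_mul_cancel₀ (pow_ne_zero _ h0), one_mul]
    exact c.2

variable [TopologicalSpace F] [IsNonarchimedeanLocalField F]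

theorem exists_ordGE (hϖ : Irreducible ϖ) (x : F) : ∃ N : ℕ, OrdGE ϖ (-N) x := by
  by_cases hx : x = 0
  · exact ⟨0, by rw [hx]; exact OrdGE.zero _⟩
  have h0 : (ϖ : F) ≠ 0 := fun h => hϖ.ne_zero (Subtype.ext h)
  obtain ⟨j, u, hu⟩ :=
    IsDiscreteValuationRing.exists_units_eq_smul_zpow_of_irreducible hϖ hx
  refine ⟨j.natAbs, ?_⟩
  have h1 : OrdGE ϖ j x := by
    rw [hu]
    change (ϖ : F) ^ (-j) * (((u : 𝒪[F]) : F) * (ϖ : F) ^ j) ∈ _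
    rw [mul_left_comm, ← zpow_add₀ h0, neg_add_cancel, zpow_zero, mul_one]
    exact (u : 𝒪[F]).2
  exact h1.mono h0 (by omega)

theorem OrdGE.isUnit (hϖ : Irreducible ϖ) (h : OrdGE ϖ m x) (h' : ¬ OrdGE ϖ (m + 1) x) :
    IsUnit (⟨(ϖ : F) ^ (-m) * x, h⟩ : 𝒪[F]) := by
  have h0 : (ϖ : F) ≠ 0 := fun h => hϖ.ne_zero (Subtype.ext h)
  by_contra hu
  have h1 : (⟨(ϖ : F) ^ (-m) * x, h⟩ : 𝒪[F]) ∈ maximalIdeal 𝒪[F] := hu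
  rw [hϖ.maximalIdeal_eq, Ideal.mem_span_singleton] at h1
  have h2 := (ordGE_natCast_iff h0 1 _).mpr ((pow_one ϖ).dvd.trans h1)
  rw [ordGE_zpow_mul h0] at h2
  refine h' (h2.mono h0 ?_)
  push_cast
  omega

end Order

section Lattice

variable {F : Type*} [Field F] [ValuativeRel F] {V : Type*} [AddCommGroup V] [Module F V]
  {ϖ : 𝒪[F]} {n : ℕ}

/-- The lattice of the vectors `x` whose coordinates in the basis `b` satisfy `ord x_i ≥ s_i`. -/
def ordLattice (ϖ : 𝒪[F]) (b : Module.Basis (Fin n) F V) (s : Fin n → ℤ) : Submodule 𝒪[F] V where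
  carrier := {x | ∀ i, OrdGE ϖ (s i) (b.repr x i)}
  zero_mem' i := by rw [map_zero]; exact OrdGE.zero _
  add_mem' hx hy i := by rw [map_add]; exact (hx i).add (hy i)
  smul_mem' c x hx i := by
    change OrdGE ϖ _ (b.repr ((c : F) • x) i)
    rw [map_smul]
    exact (hx i).smul c

/-- The lattice of level `e`: the vectors `x` whose coordinates in the basis `b` satisfy
`2 ord x_i + a_i ≥ e`. The integer division rounds `(e - a_i) / 2` up. -/
abbrev gkLattice (ϖ : 𝒪[F]) (b : Module.Basis (Fin n) F V) (a : Fin n → ℕ) (e : ℤ) :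
    Submodule 𝒪[F] V :=
  ordLattice ϖ b fun i => (e - a i + 1) / 2

variable {b : Module.Basis (Fin n) F V} {a : Fin n → ℕ} {e e' : ℤ} {x y : V}

theorem mem_gkLattice : x ∈ gkLattice ϖ b a e ↔ ∀ i, OrdGE ϖ ((e - a i + 1) / 2) (b.repr x i) :=
  Iff.rfl

theorem gkLattice_anti (h0 : (ϖ : F) ≠ 0) (h : e' ≤ e) : gkLattice ϖ b a e ≤ gkLattice ϖ b a e' :=
  fun _ hx => mem_gkLattice.mpr fun i => (mem_gkLattice.mp hx i).mono h0 (by omega)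

theorem zpow_smul_mem_gkLattice (h0 : (ϖ : F) ≠ 0) (s : ℤ) :
    (ϖ : F) ^ s • x ∈ gkLattice ϖ b a e ↔ x ∈ gkLattice ϖ b a (e - 2 * s) := by
  rw [mem_gkLattice, mem_gkLattice]
  refine forall_congr' fun i => ?_
  rw [map_smul, Finsupp.smul_apply, smul_eq_mul, ordGE_zpow_mul h0]
  congr! 1
  omega

theorem zpow_smul_basis_mem_gkLattice (h0 : (ϖ : F) ≠ 0) (i : Fin n) :
    (ϖ : F) ^ ((e - a i + 1) / 2) • b i ∈ gkLattice ϖ b a e := by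
  intro k
  rw [map_smul, Finsupp.smul_apply, smul_eq_mul, b.repr_self]
  rcases eq_or_ne i k with rfl | h
  · rw [Finsupp.single_eq_same, ordGE_zpow_mul h0, sub_self, ordGE_zero_iff]
    exact one_mem _
  · rw [Finsupp.single_eq_of_ne h.symm, mul_zero]
    exact OrdGE.zero _

omit [ValuativeRel F] in
theorem bilin_eq_sum (B : LinearMap.BilinForm F V) (b : Module.Basis (Fin n) F V) (x y : V) :
    B x y = ∑ i, ∑ j, b.repr x i * b.repr y j * B (b i) (b j) := by
  conv_lhs => rw [← b.sum_repr x, ← b.sum_repr y]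
  simp only [map_sum, LinearMap.sum_apply, map_smul, LinearMap.smul_apply, smul_eq_mul]
  rw [Finset.sum_comm]
  refine Finset.sum_congr rfl fun i _ => ?_
  rw [Finset.mul_sum]
  refine Finset.sum_congr rfl fun j _ => ?_
  ring

variable {Q : QuadraticForm F V}

theorem ordGE_polar (h0 : (ϖ : F) ≠ 0)
    (hp : ∀ i j, OrdGE ϖ ((a i + a j + 1) / 2) (QuadraticMap.polar Q (b i) (b j)))
    (hx : x ∈ gkLattice ϖ b a e) (hy : y ∈ gkLattice ϖ b a e') :
    OrdGE ϖ ((e + e' + 1) / 2) (QuadraticMap.polar Q x y) := by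
  rw [← QuadraticMap.polarBilin_apply_apply, bilin_eq_sum _ b]
  refine OrdGE.sum fun i _ => OrdGE.sum fun j _ => ?_
  exact (((mem_gkLattice.mp hx i).mul h0 (mem_gkLattice.mp hy j)).mul h0 (hp i j)).mono h0 (by omega)

theorem ordGE_form (h0 : (ϖ : F) ≠ 0) (hq : ∀ i, OrdGE ϖ (a i) (Q (b i)))
    (hp : ∀ i j, OrdGE ϖ ((a i + a j + 1) / 2) (QuadraticMap.polar Q (b i) (b j)))
    (hx : x ∈ gkLattice ϖ b a e) : OrdGE ϖ e (Q x) := by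
  have h1 : Q x = Q.toBilin b x x := by
    conv_lhs => rw [← Q.toQuadraticMap_toBilin b]
    rfl
  rw [h1, bilin_eq_sum _ b]
  refine OrdGE.sum fun i _ => OrdGE.sum fun j _ => ?_
  rw [QuadraticMap.toBilin_apply]
  split_ifs with hij
  · subst hij
    exact (((mem_gkLattice.mp hx i).mul h0 (mem_gkLattice.mp hx i)).mul h0 (hq i)).mono h0 (by omega)
  · exact (((mem_gkLattice.mp hx i).mul h0 (mem_gkLattice.mp hx j)).mul h0 (hp i j)).mono h0 (by omega)
  · rw [mul_zero]
    exact OrdGE.zero _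

variable [TopologicalSpace F] [IsNonarchimedeanLocalField F]
  {L : Submodule 𝒪[F] V} [Submodule.IsLattice F L] {hL : IsIntegralOn Q L}

theorem ordGE_of_mem_gkSet (hϖ : Irreducible ϖ) {b : Module.Basis (Fin n) 𝒪[F] L}
    (ha : a ∈ gkSet (latticeForm Q L hL) b) :
    (∀ i, OrdGE ϖ (a i) (Q (b.extendOfIsLattice F i))) ∧
    ∀ i j, OrdGE ϖ ((a i + a j + 1) / 2)
      (QuadraticMap.polar Q (b.extendOfIsLattice F i) (b.extendOfIsLattice F j)) := by
  have h0 : (ϖ : F) ≠ 0 := fun h => hϖ.ne_zero (Subtype.ext h)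
  obtain ⟨_, h1, h2⟩ := (mem_gkSet_iff hϖ _ b a).mp ha
  refine ⟨fun i => ?_, fun i j => ?_⟩
  · have := (ordGE_natCast_iff h0 _ _).mpr (h1 i)
    rw [latticeForm_apply] at this
    rwa [Module.Basis.extendOfIsLattice_apply]
  · have := (ordGE_natCast_iff h0 _ _).mpr (h2 i j)
    rw [polar_latticeForm] at this
    rwa [Module.Basis.extendOfIsLattice_apply, Module.Basis.extendOfIsLattice_apply]

/-- The step of `mem_gkLattice_of_pairing`. If `x` violated the conclusion, a multiple of the part of `x`
carried by the offending coordinates would be integral on the basis, with a unit at the last offending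
index `j`. The hypotheses on `x` say that it could replace `b j` and the entry `a j` could be
increased, contrary to the maximality of `a`. -/
theorem mem_gkLattice_of_smul_mem (hϖ : Irreducible ϖ) {b : Module.Basis (Fin n) 𝒪[F] L}
    (ha : a ∈ gkSet (latticeForm Q L hL) b)
    (hmax : ∀ a' ∈ gkUnion (latticeForm Q L hL) n, a' ≤ toLex a)
    (hx : OrdGE ϖ e (Q x))
    (hxM : ∀ y ∈ gkLattice ϖ (b.extendOfIsLattice F) a (1 - e), OrdGE ϖ 1 (QuadraticMap.polar Q x y))
    (hϖx : ϖ • x ∈ gkLattice ϖ (b.extendOfIsLattice F) a e) :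
    x ∈ gkLattice ϖ (b.extendOfIsLattice F) a e := by
  classical
  have h0 : (ϖ : F) ≠ 0 := fun h => hϖ.ne_zero (Subtype.ext h)
  obtain ⟨hq, hp⟩ := ordGE_of_mem_gkSet hϖ ha
  set c := b.extendOfIsLattice F with hc
  have hcb : ∀ i, c i = b i := fun i => by rw [hc]; simp
  have hm : Monotone a := ha.1
  by_contra hxn
  have hx1 : ∀ i, OrdGE ϖ ((e - a i + 1) / 2 - 1) (c.repr x i) := by
    have : (ϖ : F) ^ (1 : ℤ) • x ∈ gkLattice ϖ c a e := by rw [zpow_one]; exact hϖx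
    rw [zpow_smul_mem_gkLattice h0] at this
    exact fun i => (mem_gkLattice.mp this i).mono h0 (by omega)
  set I : Finset (Fin n) := {i | ¬ OrdGE ϖ ((e - a i + 1) / 2) (c.repr x i)} with hI
  have hIne : I.Nonempty := by
    rw [mem_gkLattice] at hxn
    push Not at hxn
    obtain ⟨i, hi⟩ := hxn
    exact ⟨i, by simpa [hI] using hi⟩
  obtain ⟨j, hjI, hj⟩ := I.exists_max_image id hIne
  have hjI' : ¬ OrdGE ϖ ((e - a j + 1) / 2) (c.repr x j) := by simpa [hI] using hjI
  -- the part of `x` that does not lie in the lattice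
  set x' : V := ∑ i ∈ I, c.repr x i • c i with hx'
  have hx'r : ∀ i, c.repr x' i = if i ∈ I then c.repr x i else 0 := by
    intro i
    rw [hx', map_sum, Finsupp.finsetSum_apply]
    simp [Finsupp.single_apply]
  have hz : x - x' ∈ gkLattice ϖ c a e := by
    intro i
    rw [map_sub, Finsupp.sub_apply, hx'r]
    split_ifs with hi
    · rw [sub_self]; exact OrdGE.zero _
    · rw [sub_zero]; simpa [hI] using hi
  have hxz : OrdGE ϖ e (QuadraticMap.polar Q x (x - x')) := by
    have h1 := hxM ((ϖ : F) ^ (1 - e) • (x - x')) (by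
      rw [zpow_smul_mem_gkLattice h0]
      exact gkLattice_anti h0 (by omega) hz)
    rw [QuadraticMap.polar_smul_right, smul_eq_mul, ordGE_zpow_mul h0] at h1
    exact h1.mono h0 (by omega)
  have hQx' : OrdGE ϖ e (Q x') := by
    have h1 : Q x' = Q x + Q (x - x') - QuadraticMap.polar Q x (x - x') := by
      have h2 : x' = x + -(x - x') := by abel
      conv_lhs => rw [h2]
      rw [QuadraticMap.map_add Q, QuadraticMap.map_neg, QuadraticMap.polar_neg_right]
      ring
    rw [h1]
    exact (hx.add (ordGE_form h0 hq hp hz)).sub hxz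
  have hx'M : ∀ y ∈ gkLattice ϖ c a (1 - e), OrdGE ϖ 1 (QuadraticMap.polar Q x' y) := by
    intro y hy
    have h1 : QuadraticMap.polar Q x' y =
        QuadraticMap.polar Q x y - QuadraticMap.polar Q (x - x') y := by
      rw [QuadraticMap.polar_sub_left]
      ring
    rw [h1]
    exact (hxM y hy).sub ((ordGE_polar h0 hp hz hy).mono h0 (by omega))
  -- a multiple of it can replace the vector of index `j` of the basis
  set s : ℤ := (e - a j + 1) / 2 - 1 with hs
  have hco : ∀ i, (ϖ : F) ^ (-s) * c.repr x' i ∈ 𝒪[F] := by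
    intro i
    rw [hx'r]
    split_ifs with hi
    · have h1 : a i ≤ a j := hm (hj i hi)
      exact (hx1 i).mono h0 (by omega)
    · rw [mul_zero]; exact zero_mem _
  set y : L := ∑ i, (⟨_, hco i⟩ : 𝒪[F]) • b i with hy
  have hyr : ∀ i, b.repr y i = ⟨_, hco i⟩ := fun i => by
    rw [hy, b.repr_sum_self]
  have hyV : (y : V) = (ϖ : F) ^ (-s) • x' := by
    rw [← c.sum_repr x', Finset.smul_sum, hy, Submodule.coe_sum]
    refine Finset.sum_congr rfl fun i _ => ?_
    rw [smul_smul, hcb]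
    rfl
  refine false_of_improvement hϖ ha hmax (j := j) (y := y) ?_ ?_ fun i hi => ?_
  · have h1 := (hx1 j).isUnit hϖ (by rwa [sub_add_cancel])
    rw [hyr]
    have h2 : (ϖ : F) ^ (-s) * c.repr x' j = (ϖ : F) ^ (-s) * c.repr x j := by
      rw [hx'r, if_pos hjI]
    exact (Subtype.ext h2 : (⟨_, hco j⟩ : 𝒪[F]) = ⟨_, hx1 j⟩) ▸ h1
  · rw [← ordGE_natCast_iff h0, latticeForm_apply, hyV, QuadraticMap.map_smul, smul_eq_mul,
      ← zpow_add₀ h0, ordGE_zpow_mul h0]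
    refine hQx'.mono h0 ?_
    push_cast
    omega
  · have h1 := hx'M _ (zpow_smul_basis_mem_gkLattice (b := c) (a := a) (e := 1 - e) h0 i)
    rw [QuadraticMap.polar_smul_right, smul_eq_mul, ordGE_zpow_mul h0] at h1
    rw [← ordGE_natCast_iff h0, polar_latticeForm, hyV, QuadraticMap.polar_smul_left, smul_eq_mul,
      ordGE_zpow_mul h0, ← hcb]
    refine h1.mono h0 ?_
    push_cast
    omega

/-- For a basis realizing the Gross-Keating invariant, a vector `x` with `ord Q(x) ≥ e`
that pairs with the lattice of level `1 - e` into the maximal ideal lies in the lattice of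
level `e`. -/
theorem mem_gkLattice_of_pairing (hϖ : Irreducible ϖ) {b : Module.Basis (Fin n) 𝒪[F] L}
    (ha : a ∈ gkSet (latticeForm Q L hL) b)
    (hmax : ∀ a' ∈ gkUnion (latticeForm Q L hL) n, a' ≤ toLex a)
    (hx : OrdGE ϖ e (Q x))
    (hxM : ∀ y ∈ gkLattice ϖ (b.extendOfIsLattice F) a (1 - e),
      OrdGE ϖ 1 (QuadraticMap.polar Q x y)) :
    x ∈ gkLattice ϖ (b.extendOfIsLattice F) a e := by
  classical
  have h0 : (ϖ : F) ≠ 0 := fun h => hϖ.ne_zero (Subtype.ext h)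
  set c := b.extendOfIsLattice F with hc
  obtain ⟨N, hN⟩ : ∃ N : ℕ, ϖ ^ N • x ∈ gkLattice ϖ c a e := by
    choose N hN using fun i => exists_ordGE hϖ (c.repr x i)
    refine ⟨∑ i, (N i + e.natAbs + 1), ?_⟩
    change (ϖ : F) ^ _ • x ∈ _
    rw [← zpow_natCast, zpow_smul_mem_gkLattice h0, mem_gkLattice]
    intro i
    refine (hN i).mono h0 ?_
    have := Finset.single_le_sum (f := fun i => N i + e.natAbs + 1) (fun _ _ => Nat.zero_le _)
      (Finset.mem_univ i)
    omega
  induction N with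
  | zero => simpa using hN
  | succ N ih =>
    refine ih (mem_gkLattice_of_smul_mem hϖ ha hmax ?_ (fun y hy => ?_) ?_)
    · change OrdGE ϖ e (Q (((ϖ ^ N : 𝒪[F]) : F) • x))
      rw [QuadraticMap.map_smul, smul_eq_mul, mul_assoc]
      exact (hx.smul _).smul _
    · change OrdGE ϖ 1 (QuadraticMap.polar Q (((ϖ ^ N : 𝒪[F]) : F) • x) y)
      rw [QuadraticMap.polar_smul_left]
      exact (hxM y hy).smul _
    · rwa [smul_smul, ← pow_succ']

end Lattice

/-! ### The length of an integral overlattice -/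

section RelLength

variable {R : Type*} [CommRing R] {V : Type*} [AddCommGroup V] [Module R V]

/-- The length of `A / (A ∩ B)`. -/
noncomputable def relLength (B A : Submodule R V) : ℕ∞ := Module.length R (A ⧸ B.submoduleOf A)

theorem relLength_add {Z B A : Submodule R V} (h1 : Z ≤ B) (h2 : B ≤ A) :
    relLength Z A = relLength Z B + relLength B A := by
  have hle : Z.submoduleOf A ≤ B.submoduleOf A := Submodule.comap_mono h1
  refine Module.length_eq_add_of_exact
    ((Z.submoduleOf B).mapQ (Z.submoduleOf A) (Submodule.inclusion h2) fun x hx => hx)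
    (Submodule.factor hle) ?_ (Submodule.factor_surjective hle) ?_
  · rw [← LinearMap.ker_eq_bot, LinearMap.ker_eq_bot']
    intro x hx
    obtain ⟨x, rfl⟩ := Submodule.Quotient.mk_surjective _ x
    exact (Submodule.Quotient.mk_eq_zero _).mpr
      ((Submodule.Quotient.mk_eq_zero (Z.submoduleOf A) (x := Submodule.inclusion h2 x)).mp hx)
  · intro y
    obtain ⟨y, rfl⟩ := Submodule.Quotient.mk_surjective _ y
    constructor
    · intro h
      have h3 : (y : V) ∈ B := 
        (Submodule.Quotient.mk_eq_zero (B.submoduleOf A) (x := y)).mp h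
      exact ⟨Submodule.Quotient.mk ⟨y, h3⟩, rfl⟩
    · rintro ⟨x, hx⟩
      obtain ⟨x, rfl⟩ := Submodule.Quotient.mk_surjective _ x
      rw [← hx]
      exact (Submodule.Quotient.mk_eq_zero _).mpr x.2

end RelLength

section Lattice

variable {F : Type*} [Field F] [ValuativeRel F] {V : Type*} [AddCommGroup V] [Module F V]
  {ϖ : 𝒪[F]} {n : ℕ}

/-- The basis `ϖ ^ s_i b_i` of the lattice `ord x_i ≥ s_i`. -/
noncomputable def ordLatticeBasis (hϖ : Irreducible ϖ) (b : Module.Basis (Fin n) F V)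
    (s : Fin n → ℤ) : Module.Basis (Fin n) 𝒪[F] (ordLattice ϖ b s) :=
  have h0 : (ϖ : F) ≠ 0 := fun h => hϖ.ne_zero (Subtype.ext h)
  Module.Basis.ofEquivFun
    { toFun := fun x i => ⟨_, x.2 i⟩
      map_add' := fun x y => funext fun i => Subtype.ext (by
        change (ϖ : F) ^ (-s i) * b.repr ((x : V) + y) i = _ * _ + _ * _
        rw [map_add, Finsupp.add_apply, mul_add])
      map_smul' := fun c x => funext fun i => Subtype.ext (by
        change (ϖ : F) ^ (-s i) * b.repr ((c : F) • (x : V)) i = (c : F) * (_ * _)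
        rw [map_smul, Finsupp.smul_apply, smul_eq_mul, mul_left_comm])
      invFun := fun r => ⟨∑ i, ((ϖ : F) ^ s i * r i) • b i, fun i => by
        rw [b.repr_sum_self, ordGE_zpow_mul h0, sub_self, ordGE_zero_iff]
        exact (r i).2⟩
      left_inv := fun x => Subtype.ext (by
        change (∑ i, ((ϖ : F) ^ s i * ((ϖ : F) ^ (-s i) * b.repr x i)) • b i) = x
        conv_rhs => rw [← b.sum_repr (x : V)]
        refine Finset.sum_congr rfl fun i _ => ?_
        rw [← mul_assoc, ← zpow_add₀ h0, add_neg_cancel, zpow_zero, one_mul])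
      right_inv := fun r => funext fun i => Subtype.ext (by
        change (ϖ : F) ^ (-s i) * b.repr (∑ i, ((ϖ : F) ^ s i * r i) • b i) i = _
        rw [b.repr_sum_self, ← mul_assoc, ← zpow_add₀ h0, neg_add_cancel, zpow_zero, one_mul]) }

theorem ordLatticeBasis_repr (hϖ : Irreducible ϖ) (b : Module.Basis (Fin n) F V) (s : Fin n → ℤ)
    (x : ordLattice ϖ b s) (i : Fin n) :
    (((ordLatticeBasis hϖ b s).repr x i : 𝒪[F]) : F) = (ϖ : F) ^ (-s i) * b.repr x i := rfl

theorem ordLattice_anti (hϖ : Irreducible ϖ) {b : Module.Basis (Fin n) F V} {s s' : Fin n → ℤ}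
    (h : s ≤ s') : ordLattice ϖ b s' ≤ ordLattice ϖ b s :=
  fun _ hx i => (hx i).mono (fun h => hϖ.ne_zero (Subtype.ext h)) (h i)

theorem eq_ordLattice (L : Submodule 𝒪[F] V) [Submodule.IsLattice F L]
    (b : Module.Basis (Fin n) 𝒪[F] L) : ordLattice ϖ (b.extendOfIsLattice F) 0 = L := by
  ext x
  constructor
  · intro h
    rw [← (b.extendOfIsLattice F).sum_repr x]
    refine sum_mem fun i _ => ?_
    rw [Module.Basis.extendOfIsLattice_apply]
    exact L.smul_mem ⟨_, ordGE_zero_iff.mp (h i)⟩ (b i).2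
  · intro h i
    refine ordGE_zero_iff.mpr ?_
    have h1 : x = ∑ i, ((b.repr ⟨x, h⟩ i : 𝒪[F]) : F) • b.extendOfIsLattice F i := by
      have h2 := congrArg (fun y : L => (y : V)) (b.sum_repr ⟨x, h⟩)
      simp only [Submodule.coe_sum] at h2
      refine h2.symm.trans (Finset.sum_congr rfl fun i _ => ?_)
      rw [Module.Basis.extendOfIsLattice_apply]
      rfl
    rw [h1, Module.Basis.repr_sum_self]
    exact (b.repr ⟨x, h⟩ i).2

theorem zpow_smul_mem_ordLattice (hϖ : Irreducible ϖ) {b : Module.Basis (Fin n) F V}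
    {s : Fin n → ℤ} (j : ℤ) {x : V} :
    (ϖ : F) ^ j • x ∈ ordLattice ϖ b s ↔ x ∈ ordLattice ϖ b fun i => s i - j := by
  have h0 : (ϖ : F) ≠ 0 := fun h => hϖ.ne_zero (Subtype.ext h)
  refine forall_congr' fun i => ?_
  rw [map_smul, Finsupp.smul_apply, smul_eq_mul, ordGE_zpow_mul h0]

theorem isLattice_ordLattice (hϖ : Irreducible ϖ) (b : Module.Basis (Fin n) F V) (s : Fin n → ℤ) :
    Submodule.IsLattice F (ordLattice ϖ b s) where
  fg := by
    have := Module.Finite.of_basis (ordLatticeBasis hϖ b s)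
    exact Module.Finite.iff_fg.mp this
  span_eq_top := by
    have h0 : (ϖ : F) ≠ 0 := fun h => hϖ.ne_zero (Subtype.ext h)
    rw [eq_top_iff, ← b.span_eq, Submodule.span_le]
    rintro _ ⟨i, rfl⟩
    have h1 : (ϖ : F) ^ s i • b i ∈ ordLattice ϖ b s := by
      intro k
      rw [map_smul, Finsupp.smul_apply, smul_eq_mul, b.repr_self]
      rcases eq_or_ne i k with rfl | h
      · rw [Finsupp.single_eq_same, ordGE_zpow_mul h0, sub_self, ordGE_zero_iff]
        exact one_mem _
      · rw [Finsupp.single_eq_of_ne h.symm, mul_zero]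
        exact OrdGE.zero _
    have h2 := Submodule.smul_mem _ ((ϖ : F) ^ (-s i))
      (Submodule.subset_span (R := F) (s := (ordLattice ϖ b s : Set V)) h1)
    rwa [smul_smul, ← zpow_add₀ h0, neg_add_cancel, zpow_zero, one_smul] at h2

variable [TopologicalSpace F] [IsNonarchimedeanLocalField F]

theorem relLength_ordLattice (hϖ : Irreducible ϖ) (b : Module.Basis (Fin n) F V) {s s' : Fin n → ℤ}
    (h : s ≤ s') : relLength (ordLattice ϖ b s') (ordLattice ϖ b s) =
      (∑ i, (s' i - s i).toNat : ℕ) := by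
  have h0 : (ϖ : F) ≠ 0 := fun h => hϖ.ne_zero (Subtype.ext h)
  have h1 : (ordLattice ϖ b s').submoduleOf (ordLattice ϖ b s) =
      diagSub (ordLatticeBasis hϖ b s) ϖ fun i => (s' i - s i).toNat := by
    ext x
    change (∀ i, OrdGE ϖ (s' i) (b.repr (x : V) i)) ↔
      ∀ i, ϖ ^ (s' i - s i).toNat ∣ (ordLatticeBasis hϖ b s).repr x i
    refine forall_congr' fun i => ?_
    have : s i ≤ s' i := h i
    rw [← ordGE_natCast_iff h0, ordLatticeBasis_repr, ordGE_zpow_mul h0]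
    congr! 1
    omega
  rw [relLength, h1, length_quotient_diagSub (ordLatticeBasis hϖ b s) hϖ]

/-- If `A` and `N` pair into the maximal ideal, pairing with `M` modulo the maximal ideal factors through
`M / N`. So if the vectors of `A` that pair with `M` into the maximal ideal lie in `D`, then
`A / (A ∩ D)` is not longer than `M / N`. -/
theorem relLength_le_of_pairing (hϖ : Irreducible ϖ) (B : LinearMap.BilinForm F V)
    {A D M N : Submodule 𝒪[F] V} [Submodule.IsLattice F N] (hNM : N ≤ M) (hM : M.FG)
    (hN : ∀ x ∈ A, ∀ y ∈ N, OrdGE ϖ 1 (B x y))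
    (hD : ∀ x ∈ A, (∀ y ∈ M, OrdGE ϖ 1 (B x y)) → x ∈ D) :
    relLength D A ≤ relLength N M := by
  have h0 : (ϖ : F) ≠ 0 := fun h => hϖ.ne_zero (Subtype.ext h)
  obtain ⟨b, b', t, hb, hlen⟩ := exists_adapted_bases hϖ hNM hM
  have hmem : ∀ (x : A) (j : Fin (Module.finrank 𝒪[F] N)), (ϖ : F) ^ ((t j : ℤ) - 1) * B x (b' j) ∈ 𝒪[F] := by
    intro x j
    have h1 := hN x x.2 (b j) (b j).2
    have h2 : ((b j : N) : V) = (ϖ : F) ^ (t j : ℤ) • ((b' j : M) : V) := by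
      rw [zpow_natCast]
      exact congrArg (fun z : M => (z : V)) (hb j)
    rw [h2, map_smul, smul_eq_mul, ordGE_zpow_mul h0] at h1
    have h3 : (t j : ℤ) - 1 = -(1 - t j) := by ring
    rw [h3]
    exact h1
  let Φ : A →ₗ[𝒪[F]] (Fin (Module.finrank 𝒪[F] N) → 𝒪[F]) :=
    { toFun := fun x j => ⟨_, hmem x j⟩
      map_add' := fun x y => funext fun j => Subtype.ext (by
        change _ * B ((x : V) + y) _ = _ * _ + _ * _
        rw [map_add, LinearMap.add_apply, mul_add])
      map_smul' := fun c x => funext fun j => Subtype.ext (by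
        change _ * B ((c : F) • (x : V)) _ = (c : F) * (_ * _)
        rw [map_smul, LinearMap.smul_apply, smul_eq_mul, mul_left_comm]) }
  set T := diagSub (Pi.basisFun 𝒪[F] (Fin (Module.finrank 𝒪[F] N))) ϖ t with hT
  let Ψ := T.mkQ ∘ₗ Φ
  have hker : LinearMap.ker Ψ ≤ D.submoduleOf A := by
    intro x hx
    have hx' : Φ x ∈ T := (Submodule.Quotient.mk_eq_zero _).mp hx
    have h1 : ∀ j, ϖ ^ t j ∣ Φ x j := hx'
    have h2 : ∀ j, OrdGE ϖ 1 (B x (b' j)) := by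
      intro j
      have h3 := (ordGE_natCast_iff h0 _ _).mpr (h1 j)
      change OrdGE ϖ (t j) ((ϖ : F) ^ ((t j : ℤ) - 1) * B x (b' j)) at h3
      rw [ordGE_zpow_mul h0] at h3
      exact h3.mono h0 (by omega)
    refine hD x x.2 fun y hy => ?_
    have h3 := congrArg (fun z : M => (z : V)) (b'.sum_repr ⟨y, hy⟩)
    simp only [Submodule.coe_sum] at h3
    rw [← h3, map_sum]
    refine OrdGE.sum fun j _ => ?_
    change OrdGE ϖ 1 (B x (((b'.repr ⟨y, hy⟩ j : 𝒪[F]) : F) • ((b' j : M) : V)))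
    rw [map_smul]
    exact (h2 j).smul _
  calc relLength D A ≤ Module.length 𝒪[F] (A ⧸ LinearMap.ker Ψ) :=
        Module.length_le_of_surjective (Submodule.factor hker) (Submodule.factor_surjective hker)
    _ ≤ Module.length 𝒪[F] ((Fin (Module.finrank 𝒪[F] N) → 𝒪[F]) ⧸ T) :=
        Module.length_le_of_injective ((LinearMap.ker Ψ).liftQ Ψ le_rfl)
          (LinearMap.ker_eq_bot.mp (Submodule.ker_liftQ_eq_bot _ _ _ le_rfl))
    _ = relLength N M := by rw [hT, length_quotient_diagSub _ hϖ, ← hlen]; rfl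

variable {Q : QuadraticForm F V} {a : Fin n → ℕ} {L L' : Submodule 𝒪[F] V}
  [Submodule.IsLattice F L] {hL : IsIntegralOn Q L}

/-- The length of `L' / L` is at most half the sum of the entries of the Gross-Keating invariant.

Let `M₀` and `M₁` be the lattices of levels `0` and `1`, and `P = ϖ L'`. By
`mem_gkLattice_of_pairing`, the pairing of `L'` with `M₁` bounds `L' / (L' ∩ M₀)` by `M₁ / (M₁ ∩ P)`,
and the pairing of `P` with `M₀` bounds `P / (P ∩ M₁)` by `M₀ / (M₀ ∩ L')`. Adding up, the lengths of
`L'` and `P` over `Z = ϖ L` are together at most those of `M₀` and `M₁`. The former are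
`n + length (L' / L)` and `length (L' / L)`, and the latter add up to `n + ∑ a i`. -/
theorem two_mul_relLength_le (hϖ : Irreducible ϖ) {b : Module.Basis (Fin n) 𝒪[F] L}
    (ha : a ∈ gkSet (latticeForm Q L hL) b)
    (hmax : ∀ a' ∈ gkUnion (latticeForm Q L hL) n, a' ≤ toLex a)
    (hL' : L' ∈ integralOverlattices Q L) : 2 * relLength L L' ≤ (∑ i, a i : ℕ) := by
  have h0 : (ϖ : F) ≠ 0 := fun h => hϖ.ne_zero (Subtype.ext h)
  have : Submodule.IsLattice F L' := Submodule.IsLattice.of_le_of_isLattice_of_fg F hL'.1 hL'.2.1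
  have hr : Module.finrank 𝒪[F] L' = n := by
    rw [Module.finrank, Submodule.IsLattice.rank' F L', ← Submodule.IsLattice.rank' F L,
      ← Module.finrank, Module.finrank_eq_card_basis b, Fintype.card_fin]
  set b' : Module.Basis (Fin n) 𝒪[F] L' := (Module.finBasis 𝒪[F] L').reindex (finCongr hr)
  have h01 : (0 : Fin n → ℤ) ≤ 1 := fun _ => zero_le_one
  set c := b.extendOfIsLattice F
  set c' := b'.extendOfIsLattice F
  have hcL : ordLattice ϖ c 0 = L := eq_ordLattice L b
  have hcL' : ordLattice ϖ c' 0 = L' := eq_ordLattice L' b'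
  set Z := ordLattice ϖ c 1
  set P := ordLattice ϖ c' 1
  set M₀ := gkLattice ϖ c a 0
  set M₁ := gkLattice ϖ c a 1
  have hZ : ∀ x, x ∈ Z ↔ (ϖ : F) ^ (-1 : ℤ) • x ∈ L := fun x => by
    rw [← hcL, zpow_smul_mem_ordLattice hϖ]
    rfl
  have hP : ∀ x, x ∈ P ↔ (ϖ : F) ^ (-1 : ℤ) • x ∈ L' := fun x => by
    rw [← hcL', zpow_smul_mem_ordLattice hϖ]
    rfl
  have hZL : Z ≤ L := by
    rw [← hcL]
    exact ordLattice_anti hϖ h01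
  have hPL : P ≤ L' := by
    rw [← hcL']
    exact ordLattice_anti hϖ h01
  have hZP : Z ≤ P := fun x hx => (hP x).mpr (hL'.1 ((hZ x).mp hx))
  have hZ₁ : Z ≤ M₁ := ordLattice_anti hϖ fun i => by
    change (1 - (a i : ℤ) + 1) / 2 ≤ 1
    omega
  have h₁₀ : M₁ ≤ M₀ := gkLattice_anti h0 zero_le_one
  have : Submodule.IsLattice F Z := isLattice_ordLattice hϖ c 1
  have : Submodule.IsLattice F P := isLattice_ordLattice hϖ c' 1
  have : Submodule.IsLattice F M₀ := isLattice_ordLattice hϖ c _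
  have : Submodule.IsLattice F M₁ := isLattice_ordLattice hϖ c _
  have hfin : Module.Finite F V := Module.Finite.of_basis c
  have hint : ∀ x ∈ L', ∀ y ∈ L', OrdGE ϖ 0 (QuadraticMap.polar Q x y) := fun x hx y hy =>
    ordGE_zero_iff.mpr (QuadraticMap.polar (latticeForm Q L' hL'.2.2) ⟨x, hx⟩ ⟨y, hy⟩).2
  have hpair : ∀ x ∈ L', ∀ y ∈ P, OrdGE ϖ 1 (QuadraticMap.polar Q x y) := fun x hx y hy => by
    have h1 := hint x hx _ ((hP y).mp hy)
    rw [QuadraticMap.polar_smul_right, smul_eq_mul, ordGE_zpow_mul h0] at h1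
    exact h1.mono h0 (by omega)
  have hQP : ∀ x ∈ P, OrdGE ϖ 1 (Q x) := fun x hx => by
    have h1 : OrdGE ϖ 0 (Q ((ϖ : F) ^ (-1 : ℤ) • x)) := ordGE_zero_iff.mpr (hL'.2.2 _ ((hP x).mp hx))
    rw [QuadraticMap.map_smul, smul_eq_mul, ← zpow_add₀ h0, ordGE_zpow_mul h0] at h1
    exact h1.mono h0 (by omega)
  have key₁ : relLength (L' ⊓ M₀) L' ≤ relLength (M₁ ⊓ P) M₁ :=
    relLength_le_of_pairing hϖ Q.polarBilin inf_le_left Submodule.IsLattice.fg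
      (fun x hx y hy => hpair x hx y hy.2)
      fun x hx h => ⟨hx, mem_gkLattice_of_pairing hϖ ha hmax (ordGE_zero_iff.mpr (hL'.2.2 x hx))
        fun y hy => h y (by simpa using hy)⟩
  have key₂ : relLength (P ⊓ M₁) P ≤ relLength (M₀ ⊓ L') M₀ :=
    relLength_le_of_pairing hϖ Q.polarBilin inf_le_left Submodule.IsLattice.fg
      (fun x hx y hy => by
        change OrdGE ϖ 1 (QuadraticMap.polar Q x y)
        rw [QuadraticMap.polar_comm]
        exact hpair y hy.2 x hx)
      fun x hx h => ⟨hx, mem_gkLattice_of_pairing hϖ ha hmax (hQP x hx)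
        fun y hy => h y (by simpa using hy)⟩
  have e₁ := relLength_add (le_inf (hZL.trans hL'.1) (hZ₁.trans h₁₀)) (inf_le_left (a := L') (b := M₀))
  have e₂ := relLength_add (le_inf hZP hZ₁) (inf_le_left (a := P) (b := M₁))
  have e₃ := relLength_add (le_inf hZ₁ hZP) (inf_le_left (a := M₁) (b := P))
  have e₄ := relLength_add (le_inf (hZ₁.trans h₁₀) (hZL.trans hL'.1)) (inf_le_left (a := M₀) (b := L'))
  have hle : relLength Z L' + relLength Z P ≤ relLength Z M₀ + relLength Z M₁ := by
    rw [e₁, e₂, e₃, e₄, inf_comm L' M₀, inf_comm P M₁]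
    calc _ ≤ (relLength Z (M₀ ⊓ L') + relLength (M₁ ⊓ P) M₁) +
          (relLength Z (M₁ ⊓ P) + relLength (M₀ ⊓ L') M₀) := by
          rw [inf_comm M₀ L', inf_comm M₁ P]
          rw [inf_comm M₁ P] at key₁
          rw [inf_comm M₀ L'] at key₂
          gcongr
      _ = _ := by ring
  have f₁ : relLength Z L' = n + relLength L L' := by
    rw [relLength_add hZL hL'.1]
    congr 1
    rw [← hcL, relLength_ordLattice hϖ c h01]
    simp
  have f₂ : relLength P L' = n := by
    rw [← hcL', relLength_ordLattice hϖ c' h01]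
    simp
  have f₃ : relLength Z P = relLength L L' := by
    have h1 := relLength_add hZP hPL
    rw [f₁, f₂, add_comm] at h1
    exact (ENat.add_left_injective_of_ne_top (ENat.natCast_ne_top n) h1).symm
  have f₄ : relLength Z M₀ + relLength Z M₁ = (n + ∑ i, a i : ℕ) := by
    rw [relLength_ordLattice hϖ c fun i => ?_, relLength_ordLattice hϖ c fun i => ?_]
    · rw [← Nat.cast_add, ← Finset.sum_add_distrib]
      congr 1
      have h1 : ∀ i, ((1 : Fin n → ℤ) i - (0 - (a i : ℤ) + 1) / 2).toNat +
          ((1 : Fin n → ℤ) i - (1 - (a i : ℤ) + 1) / 2).toNat = 1 + a i := fun i => by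
        rw [Pi.one_apply]
        omega
      rw [Finset.sum_congr rfl fun i _ => h1 i, Finset.sum_add_distrib]
      simp
    · change (1 - (a i : ℤ) + 1) / 2 ≤ 1
      omega
    · change (0 - (a i : ℤ) + 1) / 2 ≤ 1
      omega
  rw [f₁, f₃, f₄, add_assoc, ← two_mul] at hle
  push_cast at hle ⊢
  exact (ENat.add_le_add_iff_left (ENat.natCast_ne_top n)).mp hle

end Lattice

/-! ### The dimension of the nonsingular part of the reduction -/

section Reduction

variable {R : Type*} [CommRing R] [IsDomain R] [IsDiscreteValuationRing R]
  {L : Type*} [AddCommGroup L] [Module R L] {n : ℕ} {ϖ : R}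

theorem finite_reduction (R L : Type*) [CommRing R] [IsLocalRing R] [AddCommGroup L] [Module R L]
    [Module.Finite R L] :
    Module.Finite (R ⧸ maximalIdeal R) (L ⧸ (maximalIdeal R • ⊤ : Submodule R L)) :=
  Module.Finite.of_restrictScalars_finite R _ _

theorem finrank_reduction [Finite (ResidueField R)] (hϖ : Irreducible ϖ)
    (b : Module.Basis (Fin n) R L) :
    Module.finrank (R ⧸ maximalIdeal R) (L ⧸ (maximalIdeal R • ⊤ : Submodule R L)) = n := by
  let : Field (R ⧸ maximalIdeal R) := Ideal.Quotient.field _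
  have : Finite (R ⧸ maximalIdeal R) := inferInstanceAs (Finite (ResidueField R))
  have : Module.Finite R L := Module.Finite.of_basis b
  have hpow : (maximalIdeal R • ⊤ : Submodule R L) = powSub L ϖ 1 := by
    ext x
    exact mem_maximalIdeal_smul_top_iff hϖ x
  have hcard := card_quotient_powSub b hϖ 1
  rw [one_mul, Fintype.card_fin, ← hpow] at hcard
  have : Finite (L ⧸ (maximalIdeal R • ⊤ : Submodule R L)) :=
    hpow ▸ finite_quotient_powSub b hϖ 1
  have h2 := Module.natCard_eq_pow_finrank (K := R ⧸ maximalIdeal R)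
    (V := L ⧸ (maximalIdeal R • ⊤ : Submodule R L))
  exact Nat.pow_right_injective (Finite.one_lt_card (α := ResidueField R)) (h2.symm.trans hcard)

theorem mk_mem_radical_reducedForm_iff (hϖ : Irreducible ϖ) (q : QuadraticForm R L) (x : L) :
    Submodule.Quotient.mk x ∈ (reducedForm q).radical ↔
      ϖ ∣ q x ∧ ∀ y, ϖ ∣ QuadraticMap.polar q x y := by
  have h1 : ∀ y : L, reducedForm q (Submodule.Quotient.mk x + Submodule.Quotient.mk y) =
      Ideal.Quotient.mk (maximalIdeal R) (q (x + y)) := fun y => rfl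
  rw [QuadraticMap.mem_radical_iff', reducedForm_mk, mk_eq_zero_iff_dvd hϖ]
  refine and_congr_right fun hx => ⟨fun h y => ?_, fun h y => ?_⟩
  · have h2 := h (Submodule.Quotient.mk y)
    rw [h1, reducedForm_mk, ← sub_eq_zero, ← map_sub, mk_eq_zero_iff_dvd hϖ] at h2
    have h3 : QuadraticMap.polar q x y = (q (x + y) - q y) - q x := by
      rw [QuadraticMap.polar]
      ring
    rw [h3]
    exact dvd_sub h2 hx
  · obtain ⟨y, rfl⟩ := Submodule.Quotient.mk_surjective _ y
    rw [h1, reducedForm_mk, ← sub_eq_zero, ← map_sub, mk_eq_zero_iff_dvd hϖ]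
    have h3 : q (x + y) - q y = q x + QuadraticMap.polar q x y := by
      rw [QuadraticMap.polar]
      ring
    rw [h3]
    exact dvd_add hx (h y)

theorem nonsingularDim_le [Finite (ResidueField R)] (hϖ : Irreducible ϖ) (q : QuadraticForm R L)
    (b : Module.Basis (Fin n) R L) : nonsingularDim q ≤ n := by
  have : Module.Finite R L := Module.Finite.of_basis b
  let : Field (R ⧸ maximalIdeal R) := Ideal.Quotient.field _
  have := finite_reduction R L
  conv_rhs => rw [← finrank_reduction hϖ b]
  exact Submodule.finrank_quotient_le (R := R ⧸ maximalIdeal R) (reducedForm q).radical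

/-- Vectors of `L` that are linearly independent modulo the radical of the reduction bound the
dimension of its nonsingular part from below. -/
theorem card_le_nonsingularDim [Module.Finite R L] (hϖ : Irreducible ϖ) (q : QuadraticForm R L)
    {ι : Type*} [Fintype ι] (v : ι → L)
    (hv : ∀ r : ι → R, ϖ ∣ q (∑ i, r i • v i) →
      (∀ y, ϖ ∣ QuadraticMap.polar q (∑ i, r i • v i) y) → ∀ i, ϖ ∣ r i) :
    Fintype.card ι ≤ nonsingularDim q := by
  let : Field (R ⧸ maximalIdeal R) := Ideal.Quotient.field _
  have := finite_reduction R L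
  let w : ι → L ⧸ (maximalIdeal R • ⊤ : Submodule R L) := fun i => Submodule.Quotient.mk (v i)
  have hli : LinearIndependent (R ⧸ maximalIdeal R) fun i => (reducedForm q).radical.mkQ (w i) := by
    rw [Fintype.linearIndependent_iff]
    intro g hg i
    choose r hr using fun i => Ideal.Quotient.mk_surjective (g i)
    have h1 : (Submodule.Quotient.mk (∑ i, r i • v i) :
        L ⧸ (maximalIdeal R • ⊤ : Submodule R L)) = ∑ i, g i • w i := by
      rw [← Submodule.mkQ_apply, map_sum]
      refine Finset.sum_congr rfl fun i _ => ?_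
      rw [← hr i, map_smul]
      rfl
    have h2 : Submodule.Quotient.mk (∑ i, r i • v i) ∈ (reducedForm q).radical := by
      rw [h1, ← Submodule.Quotient.mk_eq_zero, ← Submodule.mkQ_apply, map_sum, ← hg]
      exact Finset.sum_congr rfl fun i _ => map_smul _ _ _
    obtain ⟨h3, h4⟩ := (mk_mem_radical_reducedForm_iff hϖ q _).mp h2
    rw [← hr, mk_eq_zero_iff_dvd hϖ]
    exact hv r h3 h4 i
  exact hli.fintype_card_le_finrank

end Reduction

section Lattice

variable {F : Type*} [Field F] [ValuativeRel F] [TopologicalSpace F] [IsNonarchimedeanLocalField F]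
  {V : Type*} [AddCommGroup V] [Module F V] {ϖ : 𝒪[F]}

/-- Since the dual lattice of `L` is finitely generated, no primitive vector of `L` pairs with `L` into
arbitrarily high powers of the maximal ideal. -/
theorem exists_polar_bound (hϖ : Irreducible ϖ) (Q : QuadraticForm F V)
    (hQ : Q.polarBilin.Nondegenerate) (L : Submodule 𝒪[F] V) [Submodule.IsLattice F L]
    (hL : IsIntegralOn Q L) : ∃ C : ℕ, ∀ x : L,
      (∀ y, ϖ ^ C ∣ QuadraticMap.polar (latticeForm Q L hL) x y) → ∃ z, x = ϖ • z := by
  have h0 : (ϖ : F) ≠ 0 := fun h => hϖ.ne_zero (Subtype.ext h)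
  obtain ⟨c, hc⟩ := exists_pow_smul_le hϖ L _ (fg_dual Q hQ L)
  refine ⟨c + 1, fun x hx => ?_⟩
  have h1 : (ϖ : F) ^ (-(c + 1 : ℤ)) • (x : V) ∈
      LinearMap.BilinForm.dualSubmodule Q.polarBilin L := by
    intro y hy
    obtain ⟨r, hr⟩ := hx ⟨y, hy⟩
    rw [Submodule.mem_one]
    refine ⟨r, ?_⟩
    have h2 : QuadraticMap.polar Q x y = (ϖ : F) ^ (c + 1) * r := congrArg (fun z : 𝒪[F] => (z : F)) hr
    change (r : F) = QuadraticMap.polar Q ((ϖ : F) ^ (-(c + 1 : ℤ)) • (x : V)) y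
    rw [QuadraticMap.polar_smul_left, h2, smul_eq_mul, ← mul_assoc, ← zpow_natCast, ← zpow_add₀ h0]
    push_cast
    rw [neg_add_cancel, zpow_zero, one_mul]
  refine ⟨⟨_, hc _ h1⟩, Subtype.ext ?_⟩
  change (x : V) = (ϖ : F) • (ϖ : F) ^ c • (ϖ : F) ^ (-(c + 1 : ℤ)) • (x : V)
  rw [smul_smul, smul_smul, ← pow_succ', ← zpow_natCast, ← zpow_add₀ h0]
  push_cast
  rw [add_neg_cancel, zpow_zero, one_smul]

variable {Q : QuadraticForm F V} {L L' : Submodule 𝒪[F] V} [Submodule.IsLattice F L]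

/-- The number of zeros of a maximal member of the sets `S(B)` is at most the dimension of the
nonsingular part of the reduction of any integral overlattice `L'`. Choose a basis of `L` adapted to
the sublattice of the vectors whose images in `L'` lie in the radical of the reduction: the vectors of
the basis outside of that sublattice are independent modulo the radical, and `card_zeros_le` applies
to the others. -/
theorem card_zeros_le_nonsingularDim (hϖ : Irreducible ϖ) {hL : IsIntegralOn Q L}
    {a : Fin (Module.finrank 𝒪[F] L) → ℕ} (hm : Monotone a)
    (hmax : ∀ a' ∈ gkUnion (latticeForm Q L hL) (Module.finrank 𝒪[F] L), a' ≤ toLex a)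
    (hL' : L' ∈ integralOverlattices Q L) :
    Nat.card {i // a i = 0} ≤ nonsingularDim (latticeForm Q L' hL'.2.2) := by
  classical
  have : Submodule.IsLattice F L' := Submodule.IsLattice.of_le_of_isLattice_of_fg F hL'.1 hL'.2.1
  set q := latticeForm Q L hL with hq
  set q' := latticeForm Q L' hL'.2.2 with hq'
  let ι := Submodule.inclusion hL'.1
  have hι : ∀ x, q' (ι x) = q x := fun x => rfl
  have hιp : ∀ x y, QuadraticMap.polar q' (ι x) (ι y) = QuadraticMap.polar q x y := fun x y => rfl
  -- the vectors of `L` whose images lie in the radical of the reduction of `L'`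
  let N₀ : Submodule 𝒪[F] L :=
    { carrier := {x | ϖ ∣ q' (ι x) ∧ ∀ y, ϖ ∣ QuadraticMap.polar q' (ι x) y}
      zero_mem' := by simp
      add_mem' := by
        rintro x y ⟨hx, hx'⟩ ⟨hy, hy'⟩
        refine ⟨?_, fun z => ?_⟩
        · rw [map_add, QuadraticMap.map_add q']
          exact dvd_add (dvd_add hx hy) (hx' _)
        · rw [map_add, QuadraticMap.polar_add_left]
          exact dvd_add (hx' z) (hy' z)
      smul_mem' := by
        rintro c x ⟨hx, hx'⟩
        refine ⟨?_, fun z => ?_⟩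
        · rw [map_smul, QuadraticMap.map_smul, smul_eq_mul]
          exact hx.mul_left _
        · rw [map_smul, QuadraticMap.polar_smul_left, smul_eq_mul]
          exact (hx' z).mul_left _ }
  have hϖN : ∀ x : L, ϖ • x ∈ N₀ := fun x => by
    refine ⟨?_, fun z => ?_⟩
    · rw [map_smul, QuadraticMap.map_smul, smul_eq_mul, mul_assoc]
      exact dvd_mul_right _ _
    · rw [map_smul, QuadraticMap.polar_smul_left, smul_eq_mul]
      exact dvd_mul_right _ _
  have hrank : Module.finrank 𝒪[F] N₀ = Module.finrank 𝒪[F] L := by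
    refine le_antisymm (Submodule.finrank_le N₀) ?_
    refine LinearMap.finrank_le_finrank_of_injective
      (f := (LinearMap.lsmul 𝒪[F] L ϖ).codRestrict N₀ hϖN) fun x y hxy => ?_
    have h1 : ϖ • x = ϖ • y := congrArg Subtype.val hxy
    exact smul_right_injective L hϖ.ne_zero h1
  obtain ⟨b, t, bN, h1, h2⟩ := exists_eq_diagSub (Module.finBasis 𝒪[F] L) hϖ N₀ hrank
  have hN : ∀ x, x ∈ N₀ ↔ ∀ i, ϖ ^ t i ∣ b.repr x i := fun x => by rw [h1]; rfl
  have hS := card_zeros_le hϖ hm hmax b {i | t i ≠ 0}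
    (fun i hi => by
      have hi : t i = 0 := by simpa using hi
      have := (bN i).2.1
      rwa [h2, hi, pow_zero, one_smul] at this)
    (fun i hi j => by
      have hi : t i = 0 := by simpa using hi
      have := (bN i).2.2 (ι (b j))
      rwa [h2, hi, pow_zero, one_smul] at this)
  refine hS.trans ?_
  rw [Nat.card_eq_fintype_card]
  refine card_le_nonsingularDim hϖ q' (fun i => ι (b (i : Fin _))) fun r h3 h4 i => ?_
  have h5 : ι (∑ i, r i • b (i : Fin _)) = ∑ i, r i • ι (b (i : Fin _)) := by
    rw [map_sum]
    exact Finset.sum_congr rfl fun i _ => map_smul _ _ _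
  rw [← h5] at h3 h4
  have h6 := (hN _).mp (show ∑ i, r i • b (i : Fin _) ∈ N₀ from ⟨h3, h4⟩) i
  have h7 : b.repr (∑ i, r i • b (i : Fin _)) i = r i := by
    rw [map_sum, Finsupp.finsetSum_apply, Finset.sum_eq_single i]
    · simp
    · intro j _ hj
      rw [map_smul, Finsupp.smul_apply, b.repr_self, Finsupp.single_eq_of_ne, smul_zero]
      exact fun h => hj (Subtype.ext h.symm)
    · simp
  rw [h7] at h6
  exact (dvd_pow_self ϖ i.2).trans h6

theorem overlattice_bounds (hQ : Q.polarBilin.Nondegenerate) {hL : IsIntegralOn Q L}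
    (hL' : L' ∈ integralOverlattices Q L) :
    2 * (Module.length 𝒪[F] (L' ⧸ L.submoduleOf L')).toNat ≤ gkSum (latticeForm Q L hL) ∧
    gkZeros (latticeForm Q L hL) ≤ nonsingularDim (latticeForm Q L' hL'.2.2) ∧
    nonsingularDim (latticeForm Q L' hL'.2.2) ≤ Module.finrank 𝒪[F] L := by
  have : Submodule.IsLattice F L' := Submodule.IsLattice.of_le_of_isLattice_of_fg F hL'.1 hL'.2.1
  obtain ⟨ϖ, hϖ⟩ := IsDiscreteValuationRing.exists_irreducible 𝒪[F]
  obtain ⟨C, hC⟩ := exists_polar_bound hϖ Q hQ L hL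
  obtain ⟨⟨b, hb⟩, hmax⟩ := isGreatest_grossKeating hϖ hC (Module.finBasis 𝒪[F] L)
  obtain ⟨b₁, b', t, _, hlen⟩ := exists_adapted_bases hϖ hL'.1 hL'.2.1
  refine ⟨?_, card_zeros_le_nonsingularDim hϖ hb.1 hmax hL', nonsingularDim_le hϖ _ b'⟩
  have h1 := two_mul_relLength_le hϖ hb hmax hL'
  rw [relLength, hlen] at h1
  rw [hlen, ENat.toNat_natCast]
  exact_mod_cast h1

end Lattice

/-! ### The formula for the local density -/

section Reduction

variable {R : Type*} [CommRing R] [IsDomain R] [IsDiscreteValuationRing R]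
  {L : Type*} [AddCommGroup L] [Module R L] {n : ℕ} {ϖ : R}

/-- The formula for embeddings over the residue field, with the factor `1 + f ^ (-k)` cancelled. -/
theorem isometryCount_reducedForm [Finite (ResidueField R)] (hϖ : Irreducible ϖ)
    (q : QuadraticForm R L) (b : Module.Basis (Fin n) R L) (hn : 1 ≤ n) {k : ℕ} (hk : n ≤ k) :
    (isometryCount (reducedForm q) k : ℝ) =
      (Nat.card (ResidueField R) : ℝ) ^ (2 * (k : ℤ) * n - Fintype.card (UpperPair n)) *
      ((1 - (Nat.card (ResidueField R) : ℝ) ^ (-(k : ℤ))) *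
      ((1 + (reductionSign q : ℝ) *
        (Nat.card (ResidueField R) : ℝ) ^ ((n : ℤ) - (nonsingularDim q / 2 : ℕ) - k)) *
      ∏ i ∈ (Finset.Ico 1 n).filter fun i => 2 * i + nonsingularDim q < 2 * n,
        (1 - (Nat.card (ResidueField R) : ℝ) ^ (2 * (i : ℤ) - 2 * k)))) := by
  have : Module.Finite R L := Module.Finite.of_basis b
  let : Field (R ⧸ maximalIdeal R) := Ideal.Quotient.field _
  have : Finite (R ⧸ maximalIdeal R) := inferInstanceAs (Finite (ResidueField R))
  have := finite_reduction R L
  have hr := finrank_reduction hϖ b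
  have ha := nonsingularDim_le hϖ q b
  have h1 : EmbFormula (reducedForm q) (nonsingularDim q) (reductionSign q) :=
    embFormula (reducedForm q)
  have h2 := h1 k (hr.trans_le hk)
  rw [hr] at h2
  set f : ℝ := (Nat.card (ResidueField R) : ℝ) with hf
  have hf1 : 1 < f := by
    rw [hf]
    exact_mod_cast Finite.one_lt_card (α := ResidueField R)
  have hf0 : f ≠ 0 := by positivity
  have hpos : 1 + f ^ (-(k : ℤ)) ≠ 0 := by positivity
  have h3 : (Finset.range n).filter (fun i => 2 * i + nonsingularDim q < 2 * n) =
      insert 0 ((Finset.Ico 1 n).filter fun i => 2 * i + nonsingularDim q < 2 * n) := by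
    ext i
    simp only [Finset.mem_insert, Finset.mem_filter, Finset.mem_range, Finset.mem_Ico]
    omega
  refine mul_left_cancel₀ hpos (h2.trans ?_)
  rw [h3, Finset.prod_insert (by simp)]
  have h4 : 1 - f ^ (2 * ((0 : ℕ) : ℤ) - 2 * k) = (1 - f ^ (-(k : ℤ))) * (1 + f ^ (-(k : ℤ))) := by
    have h5 : f ^ (2 * ((0 : ℕ) : ℤ) - 2 * k) = f ^ (-(k : ℤ)) * f ^ (-(k : ℤ)) := by
      rw [← zpow_add₀ hf0]
      congr 1
      push_cast
      ring
    rw [h5]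
    ring
  change f ^ _ * (1 + _ * f ^ _) * ((1 - f ^ (2 * ((0 : ℕ) : ℤ) - 2 * k)) *
    ∏ i ∈ (Finset.Ico 1 n).filter fun i => 2 * i + nonsingularDim q < 2 * n,
      (1 - f ^ (2 * (i : ℤ) - 2 * k))) = _
  rw [h4]
  ring

end Reduction

/-- A finite sum of a function of three invariants, grouped by their values. -/
theorem sum_eq_sum_ncard {α : Type*} {T : Set α} [Fintype T] (β γ : T → ℕ) (σ : T → SignType)
    (O : ℕ → SignType → ℕ → Set α)
    (hO : ∀ a s b x, x ∈ O a s b ↔ ∃ h : x ∈ T, β ⟨x, h⟩ = b ∧ γ ⟨x, h⟩ = a ∧ σ ⟨x, h⟩ = s)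
    {B A : Finset ℕ} (hβ : ∀ x, β x ∈ B) (hγ : ∀ x, γ x ∈ A) (G : ℕ → ℕ → SignType → ℝ) :
    ∑ x, G (β x) (γ x) (σ x) = ∑ b ∈ B, ∑ a ∈ A, ∑ s, ((O a s b).ncard : ℝ) * G b a s := by
  classical
  have h1 : ∀ a s b, ((O a s b).ncard : ℝ) =
      ∑ x : T, if b = β x then if a = γ x then if s = σ x then (1 : ℝ) else 0 else 0 else 0 := by
    intro a s b
    have h2 : O a s b = Subtype.val '' {x : T | β x = b ∧ γ x = a ∧ σ x = s} := by
      ext x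
      rw [hO]
      simp
    rw [h2, Set.ncard_image_of_injective _ Subtype.val_injective, Set.ncard_eq_toFinset_card',
      Set.toFinset_ofPred, Finset.card_filter]
    push_cast
    refine Finset.sum_congr rfl fun x _ => ?_
    simp only [← ite_and, eq_comm]
  simp only [h1, Finset.sum_mul]
  have h3 : ∀ b ∈ B, ∀ a ∈ A, ∑ s, ∑ x : T,
      (if b = β x then if a = γ x then if s = σ x then (1 : ℝ) else 0 else 0 else 0) * G b a s =
      ∑ x : T, if b = β x then if a = γ x then G (β x) (γ x) (σ x) else 0 else 0 := by
    intro b _ a _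
    rw [Finset.sum_comm]
    refine Finset.sum_congr rfl fun x _ => ?_
    by_cases hb : b = β x
    · by_cases ha : a = γ x
      · simp [hb, ha]
      · simp [ha]
    · simp [hb]
  rw [Finset.sum_congr rfl fun b hb => Finset.sum_congr rfl fun a ha => h3 b hb a ha]
  rw [Finset.sum_congr rfl fun b _ => Finset.sum_comm, Finset.sum_comm]
  refine Finset.sum_congr rfl fun x _ => ?_
  rw [Finset.sum_eq_single_of_mem _ (hβ x) fun b _ hb => ?_]
  · rw [Finset.sum_eq_single_of_mem _ (hγ x) fun a _ ha => ?_]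
    · simp
    · simp [ha]
  · simp [hb]

theorem mem_range_of_two_mul_le {m s : ℕ} (h : 2 * m ≤ s) : m ∈ Finset.range (s / 2 + 1) := by
  rw [Finset.mem_range]
  omega

section Lattice

variable {F : Type*} [Field F] [ValuativeRel F] [TopologicalSpace F] [IsNonarchimedeanLocalField F]
  {V : Type*} [AddCommGroup V] [Module F V]

theorem length_eq_natCast {Q : QuadraticForm F V} {L L' : Submodule 𝒪[F] V}
    [Submodule.IsLattice F L] (h : L' ∈ integralOverlattices Q L) :
    Module.length 𝒪[F] (L' ⧸ L.submoduleOf L') =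
      ((Module.length 𝒪[F] (L' ⧸ L.submoduleOf L')).toNat : ℕ∞) := by
  obtain ⟨ϖ, hϖ⟩ := IsDiscreteValuationRing.exists_irreducible 𝒪[F]
  obtain ⟨_, _, t, _, hlen⟩ := exists_adapted_bases hϖ h.1 h.2.1
  refine (ENat.natCast_toNat ?_).symm
  rw [hlen]
  exact ENat.natCast_ne_top _

set_option maxHeartbeats 2000000 in
/-- The explicit formula for the local density. -/
theorem localDensity_formula (Q : QuadraticForm F V) (hQ : Q.polarBilin.Nondegenerate)
    (L : Submodule 𝒪[F] V) [Submodule.IsLattice F L] (hL : IsIntegralOn Q L) {n : ℕ}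
    (hn : Module.finrank 𝒪[F] L = n) (hpos : 1 ≤ n) {k : ℕ} (hk : n ≤ k) :
    localDensity (latticeForm Q L hL) k ≠ ∞ ∧
    (localDensity (latticeForm Q L hL) k).toReal =
      (1 - (Nat.card (ResidueField 𝒪[F]) : ℝ) ^ (-(k : ℤ))) *
        ∑ b ∈ Finset.range (gkSum (latticeForm Q L hL) / 2 + 1),
          ∑ a ∈ Finset.Icc (gkZeros (latticeForm Q L hL)) n, ∑ s : SignType,
            ((overlattices Q L a s b).ncard : ℝ) *
              ((Nat.card (ResidueField 𝒪[F]) : ℝ) ^ ((b : ℤ) * (n + 1 - 2 * k)) *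
              ((1 + (s : ℝ) * (Nat.card (ResidueField 𝒪[F]) : ℝ) ^ ((n : ℤ) - (a / 2 : ℕ) - k)) *
              ∏ i ∈ (Finset.Ico 1 n).filter (fun i => 2 * i + a < 2 * n),
                (1 - (Nat.card (ResidueField 𝒪[F]) : ℝ) ^ (2 * (i : ℤ) - 2 * k)))) := by
  obtain ⟨ϖ, hϖ⟩ := IsDiscreteValuationRing.exists_irreducible 𝒪[F]
  let : Fintype (integralOverlattices Q L) := (finite_integralOverlattices Q hQ L).fintype
  have hsum := localDensity_eq_sum Q hQ L hL k
  rw [hn] at hsum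
  obtain ⟨hfin, hsum⟩ := hsum
  refine ⟨hfin, hsum.trans ?_⟩
  set f : ℝ := (Nat.card (ResidueField 𝒪[F]) : ℝ) with hf
  have hf1 : 1 < f := by
    rw [hf]
    exact_mod_cast Finite.one_lt_card (α := ResidueField 𝒪[F])
  have hf0 : f ≠ 0 := by positivity
  have hO : ∀ a s b L', L' ∈ overlattices Q L a s b ↔ ∃ h : L' ∈ integralOverlattices Q L,
      (Module.length 𝒪[F] (L' ⧸ L.submoduleOf L')).toNat = b ∧
      nonsingularDim (latticeForm Q L' h.2.2) = a ∧
      reductionSign (latticeForm Q L' h.2.2) = s := by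
    intro a s b L'
    constructor
    · rintro ⟨h1, h2, h3, h4, h5, h6⟩
      exact ⟨⟨h1, h2, h4⟩, by simp only [h3, ENat.toNat_natCast], h5, h6⟩
    · rintro ⟨h, h1, h2, h3⟩
      exact ⟨h.1, h.2.1, by rw [length_eq_natCast h, h1], h.2.2, h2, h3⟩
  let β : integralOverlattices Q L → ℕ := fun L' =>
    (Module.length 𝒪[F] (L'.1 ⧸ L.submoduleOf L'.1)).toNat
  let γ : integralOverlattices Q L → ℕ := fun L' => nonsingularDim (latticeForm Q L'.1 L'.2.2.2)
  let σ : integralOverlattices Q L → SignType := fun L' =>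
    reductionSign (latticeForm Q L'.1 L'.2.2.2)
  have hβ : ∀ L', β L' ∈ Finset.range (gkSum (latticeForm Q L hL) / 2 + 1) := fun L' =>
    mem_range_of_two_mul_le (overlattice_bounds hQ (hL := hL) L'.2).1
  have hγ : ∀ L', γ L' ∈ Finset.Icc (gkZeros (latticeForm Q L hL)) n := fun L' => by
    have h := (overlattice_bounds hQ (hL := hL) L'.2).2
    rw [hn] at h
    exact Finset.mem_Icc.mpr h
  have key := sum_eq_sum_ncard β γ σ (overlattices Q L) hO hβ hγ
    (fun b a s => f ^ ((b : ℤ) * (n + 1 - 2 * k)) *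
      ((1 + (s : ℝ) * f ^ ((n : ℤ) - (a / 2 : ℕ) - k)) *
        ∏ i ∈ (Finset.Ico 1 n).filter (fun i => 2 * i + a < 2 * n),
          (1 - f ^ (2 * (i : ℤ) - 2 * k))))
  rw [← key, Finset.mul_sum, Finset.mul_sum]
  refine Finset.sum_congr rfl fun L' _ => ?_
  obtain ⟨_, b', _, _, _⟩ := exists_adapted_bases hϖ L'.2.1 L'.2.2.1
  have h1 : f ^ ((Fintype.card (UpperPair n) : ℤ) - Fintype.card (Coord n k)) *
      f ^ (2 * (k : ℤ) * n - Fintype.card (UpperPair n)) = 1 := by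
    rw [← zpow_add₀ hf0]
    convert zpow_zero f
    simp only [Fintype.card_prod, Fintype.card_sum, Fintype.card_fin]
    push_cast
    ring
  rw [isometryCount_reducedForm hϖ (latticeForm Q L'.1 L'.2.2.2) (b'.reindex (finCongr hn)) hpos hk, ← mul_assoc,
    ← mul_assoc, h1, one_mul, mul_assoc, mul_comm (_ * _) (f ^ _)]

end Lattice

/-! ### The Siegel series -/

theorem polynomial_eq_of_eval_zpow {f : ℝ} (hf : 1 < f) {P P' : ℝ[X]} (n : ℕ)
    (h : ∀ k : ℕ, n ≤ k → P.eval (f ^ (-(k : ℤ))) = P'.eval (f ^ (-(k : ℤ)))) : P = P' := by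
  refine Polynomial.eq_of_infinite_eval_eq P P' (Set.infinite_of_injective_forall_mem
    (f := fun k : ℕ => f ^ (-((n + k : ℕ) : ℤ))) (fun k k' hk => ?_) fun k => h _ (Nat.le_add_right _ _))
  have := zpow_right_injective₀ (zero_lt_one.trans hf) hf.ne' hk
  omega

/-- The explicit polynomial of the theorem, for arbitrary numbers `N a s b` in place of the numbers
of overlattices. -/
noncomputable def siegelPolynomial (n f g z : ℕ) (N : ℕ → SignType → ℕ → ℕ) : ℝ[X] :=
  (1 - Polynomial.X) *
    ∑ b ∈ Finset.range (g / 2 + 1), ∑ a ∈ Finset.Icc z n, ∑ s : SignType,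
      Polynomial.C (N a s b : ℝ) * Polynomial.C ((f : ℝ) ^ (b * (n + 1))) *
        Polynomial.X ^ (2 * b) *
        (1 + Polynomial.C ((s : ℝ) * (f : ℝ) ^ (n - a / 2)) * Polynomial.X) *
        ∏ i ∈ (Finset.Ico 1 n).filter (fun i => 2 * i + a < 2 * n),
          (1 - Polynomial.C ((f : ℝ) ^ (2 * i)) * Polynomial.X ^ 2)

theorem eval_siegelPolynomial {n f g z k : ℕ} (hf : (f : ℝ) ≠ 0) (N : ℕ → SignType → ℕ → ℕ) :
    (siegelPolynomial n f g z N).eval ((f : ℝ) ^ (-(k : ℤ))) =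
      (1 - (f : ℝ) ^ (-(k : ℤ))) *
        ∑ b ∈ Finset.range (g / 2 + 1), ∑ a ∈ Finset.Icc z n, ∑ s : SignType,
          (N a s b : ℝ) * ((f : ℝ) ^ ((b : ℤ) * (n + 1 - 2 * k)) *
            ((1 + (s : ℝ) * (f : ℝ) ^ ((n : ℤ) - (a / 2 : ℕ) - k)) *
            ∏ i ∈ (Finset.Ico 1 n).filter (fun i => 2 * i + a < 2 * n),
              (1 - (f : ℝ) ^ (2 * (i : ℤ) - 2 * k)))) := by
  have h1 : ∀ i : ℕ, (f : ℝ) ^ (2 * i) * ((f : ℝ) ^ (-(k : ℤ))) ^ 2 =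
      (f : ℝ) ^ (2 * (i : ℤ) - 2 * k) := fun i => by
    rw [← zpow_natCast, ← zpow_natCast, ← zpow_mul, ← zpow_add₀ hf]
    congr 1
    push_cast
    ring
  have h2 : ∀ b : ℕ, (f : ℝ) ^ (b * (n + 1)) * ((f : ℝ) ^ (-(k : ℤ))) ^ (2 * b) =
      (f : ℝ) ^ ((b : ℤ) * (n + 1 - 2 * k)) := fun b => by
    rw [← zpow_natCast, ← zpow_natCast, ← zpow_mul, ← zpow_add₀ hf]
    congr 1
    push_cast
    ring
  have h3 : ∀ a ≤ n, (f : ℝ) ^ (n - a / 2) * (f : ℝ) ^ (-(k : ℤ)) =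
      (f : ℝ) ^ ((n : ℤ) - (a / 2 : ℕ) - k) := fun a ha => by
    rw [← zpow_natCast, ← zpow_add₀ hf, Nat.cast_sub (by omega)]
    rfl
  simp only [siegelPolynomial, Polynomial.eval_mul, Polynomial.eval_sub, Polynomial.eval_one,
    Polynomial.eval_X, Polynomial.eval_finsetSum, Polynomial.eval_C, Polynomial.eval_pow,
    Polynomial.eval_add, Polynomial.eval_prod, h1]
  refine congrArg _ (Finset.sum_congr rfl fun b _ => Finset.sum_congr rfl fun a ha =>
    Finset.sum_congr rfl fun s _ => ?_)
  rw [mul_assoc (N a s b : ℝ), h2, mul_assoc (s : ℝ), h3 a (Finset.mem_Icc.mp ha).2]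
  simp only [mul_assoc]

end SiegelSeries

theorem corollary3
    {F : Type*} [Field F] [ValuativeRel F] [TopologicalSpace F] [IsNonarchimedeanLocalField F]
    [CharZero F]
    {V : Type*} [AddCommGroup V] [Module F V]
    (Q : QuadraticForm F V) (hQ : (QuadraticMap.polarBilin Q).Nondegenerate)
    (L : Submodule 𝒪[F] V) [Submodule.IsLattice F L] (hL : SiegelSeries.IsIntegralOn Q L)
    (n : ℕ) (hn : Module.finrank 𝒪[F] L = n) (hpos : 1 ≤ n)
    (f : ℕ) (hf : f = Nat.card 𝓀[F])
    (q : QuadraticForm 𝒪[F] L) (hq : q = SiegelSeries.latticeForm Q L hL) :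
    (∀ k : ℕ, n ≤ k →
      SiegelSeries.localDensity q k ≠ ∞ ∧
      (SiegelSeries.localDensity q k).toReal =
        (1 - (f : ℝ) ^ (-(k : ℤ))) *
          ∑ b ∈ Finset.range (SiegelSeries.gkSum q / 2 + 1),
            ∑ a ∈ Finset.Icc (SiegelSeries.gkZeros q) n, ∑ s : SignType,
              ((SiegelSeries.overlattices Q L a s b).ncard : ℝ) *
                (f : ℝ) ^ ((b : ℤ) * (n + 1 - 2 * k)) *
                (1 + (s : ℝ) * (f : ℝ) ^ ((n : ℤ) - (a / 2 : ℕ) - k)) *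
                ∏ i ∈ (Finset.Ico 1 n).filter (fun i => 2 * i + a < 2 * n),
                  (1 - (f : ℝ) ^ (2 * (i : ℤ) - 2 * k))) ∧
    ∀ P : ℝ[X], SiegelSeries.IsSiegelSeries q P ↔
      P = (1 - Polynomial.X) *
          ∑ b ∈ Finset.range (SiegelSeries.gkSum q / 2 + 1),
            ∑ a ∈ Finset.Icc (SiegelSeries.gkZeros q) n, ∑ s : SignType,
              Polynomial.C ((SiegelSeries.overlattices Q L a s b).ncard : ℝ) *
                Polynomial.C ((f : ℝ) ^ (b * (n + 1))) * Polynomial.X ^ (2 * b) *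
                (1 + Polynomial.C ((s : ℝ) * (f : ℝ) ^ (n - a / 2)) * Polynomial.X) *
                ∏ i ∈ (Finset.Ico 1 n).filter (fun i => 2 * i + a < 2 * n),
                  (1 - Polynomial.C ((f : ℝ) ^ (2 * i)) * Polynomial.X ^ 2) := by
  subst hf hq
  have hf1 : (1 : ℝ) < (Nat.card 𝓀[F] : ℝ) := by
    exact_mod_cast Finite.one_lt_card (α := 𝓀[F])
  have key := fun k (hk : n ≤ k) => SiegelSeries.localDensity_formula Q hQ L hL hn hpos hk
  have hdens : ∀ k : ℕ, n ≤ k →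
      (SiegelSeries.localDensity (SiegelSeries.latticeForm Q L hL) k).toReal =
      (SiegelSeries.siegelPolynomial n (Nat.card 𝓀[F])
        (SiegelSeries.gkSum (SiegelSeries.latticeForm Q L hL))
        (SiegelSeries.gkZeros (SiegelSeries.latticeForm Q L hL))
        fun a s b => (SiegelSeries.overlattices Q L a s b).ncard).eval
          ((Nat.card 𝓀[F] : ℝ) ^ (-(k : ℤ))) := fun k hk =>
    (key k hk).2.trans (SiegelSeries.eval_siegelPolynomial (by positivity) _).symm
  refine ⟨fun k hk => ⟨(key k hk).1, (key k hk).2.trans ?_⟩, fun P => ⟨fun hP => ?_, ?_⟩⟩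
  · simp only [mul_assoc]
  · refine SiegelSeries.polynomial_eq_of_eval_zpow hf1 n fun k hk => ?_
    exact (hP k (hn.trans_le hk)).2.symm.trans (hdens k hk)
  · rintro rfl k hk
    exact ⟨(key k (hn ▸ hk)).1, hdens k (hn ▸ hk)⟩
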